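/- Let $X$ be a locally compact Hausdorff space with countable base. A kernel $T$ on $X$ (with respect to the Borel sets) is a *boundary kernel* for an open set $U$ if $T(x,X\setminus\partial U)=0$ for $x\in U$ and $T(x,\cdot)=\varepsilon_x$ for $x\notin U$; write $Tf(x)=\int f\,dT(x,\cdot)$. Let $\mathcal V$ be a base of relatively compact open sets and, for $V\in\mathcal V$, let $H_V$ be a boundary kernel for $V$. For open $U$ let $\mathcal V(U)=\{W\in\mathcal V:\overline W\subset U\}$. A *local choice* $\mathcal W$ on $U$ assigns to every $x\in U$ a fundamental system $\mathcal W(x)\subset\mathcal V(U)$ of neighborhoods of $x$; a lower semicontinuous $u:U\to(-\infty,\infty]$ is *$\mathcal W$-hyperharmonic* if $H_Wu(x)\le u(x)$ for all $x\in U$, $W\in\mathcal W(x)$, and *hyperharmonic* if this holds with $\mathcal W(x)=\{W\in\mathcal V(U):x\in W\}$. A continuous $h:U\to\mathbb R$ is *harmonic* if $H_Vh=h$ on $V$ for all $V\in\mathcal V(U)$. The family $(H_V)_{V\in\mathcal V}$ is a *normal Bauer family of harmonic boundary kernels* if for every $V\in\mathcal V$: (1) $H_WH_V=H_V$ for $W\in\mathcal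 V$, $W\subset V$; (2) $H_V1=1$ and $H_Vf$ is continuous on $X$ for continuous $f:X\to\mathbb R$; (3) for some local choice $\mathcal W$ on $V$ the positive $\mathcal W$-hyperharmonic functions separate the points of $V$; (4) $H_Vf$ is continuous on $V$ for every bounded Borel function $f$. Let $(H_V)_{V\in\mathcal V}$ be such a family. An open set $U$ is a *$\mathcal P$-set* if the positive hyperharmonic functions on $U$ separate its points. A relatively compact open set $U$ is *regular* if every $f\in C(\partial U)$ has a unique continuous extension to $\overline U$ that is harmonic on $U$, and this extension is positive if $f\ge 0$; $H_U$ denotes the corresponding boundary kernel for $U$. A compact set $K\neq\emptyset$ is *strongly stable* if it is contained in a $\mathcal P$-set $W$ such that some strictly positive harmonic function on $W\setminus K$ tends to zero at $\partial K$. Fix a strongly stable compact $K$. (i) Let $W_0\supset K$ be any regular $\mathcal P$-set such that $W_0\setminus K$ is regular and $g:=H_{W_0\setminus K}1_{\partial W_0}>0$ on $W_0\setminus K$. For $0<r<1$ let $A_r=\{x\in W_0\setminus K: g(x)<r\}$, $S_r=\{x\in W_0\setminus K: g(x)=r\}$ (the sets $A_r$ are regular). Let $(\eta_n)$ be a sequence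 in $(0,1)$ strictly decreasing to $0$ and, for every $n$, let $\nu_n$ be a probability measure on $S_{\eta_n}$. Then there is a subsequence $(\nu_{n_k})$ such that, for every $0<r<1$, the measures $$\sigma_{r,k}:=\frac{r}{\eta_{n_k}}\,(\nu_{n_k}H_{A_r})|_{S_r}\qquad(\eta_{n_k}<r)$$ are probability measures on $S_r$ which converge weakly, as $k\to\infty$, to a probability measure $\sigma_r$ on $S_r$. The measures $\sigma_r$ are compatible, that is, $\sigma_rH_{A_t}=(r/t)\,\sigma_t$ on $S_t$ for all $0<r<t<1$. (ii) A darning of $K$ exists: the space $X_0$ obtained from $X$ by identifying $K$ with a single point is locally compact Hausdorff with countable base, and there is a normal Bauer family of harmonic boundary kernels on $X_0$ which contains all kernels $H_V$, $V\in\mathcal V$, $\overline V\cap K=\emptyset$ (transported to $X_0$). -/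

import Mathlib

open MeasureTheory ProbabilityTheory Set Filter Topology
open scoped ENNReal

noncomputable section

namespace Darning

section Families

variable {X : Type*} [TopologicalSpace X] [MeasurableSpace X]

/-- `T` is a boundary kernel for `U`: the measures `T(x,·)`, `x ∈ U`, do not charge the complement
of `∂U`, and `T(x,·)` is the Dirac measure at `x` for `x ∉ U`. -/
def IsBoundaryKernel (U : Set X) (T : Kernel X X) : Prop :=
  (∀ x ∈ U, T x (frontier U)ᶜ = 0) ∧ ∀ x ∉ U, T x = Measure.dirac x

/-- The integral `∫ u⁺ dμ - ∫ u⁻ dμ` of an extended real function. It is used only for functions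
which are lower semicontinuous and `> -∞` on a compact set carrying the finite measure `μ`, so that
the negative part has a finite integral. -/
def eintegral (μ : Measure X) (u : X → EReal) : EReal :=
  ((∫⁻ y, (u y).toENNReal ∂μ : ℝ≥0∞) : EReal) - ((∫⁻ y, (-u y).toENNReal ∂μ : ℝ≥0∞) : EReal)

/-- A local choice from `𝒱` in `U`: each `𝒲 x`, `x ∈ U`, is a fundamental system of neighborhoods
of `x` consisting of sets `W ∈ 𝒱` with closure in `U`. -/
def IsLocalChoice (𝒱 : Set (Set X)) (U : Set X) (𝒲 : X → Set (Set X)) : Prop :=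
  ∀ x ∈ U, (∀ W ∈ 𝒲 x, W ∈ 𝒱 ∧ closure W ⊆ U ∧ x ∈ W) ∧ ∀ N ∈ 𝓝 x, ∃ W ∈ 𝒲 x, W ⊆ N

/-- The choice of all `W ∈ 𝒱` which contain `x` and have closure in `U`. -/
def fullChoice (𝒱 : Set (Set X)) (U : Set X) (x : X) : Set (Set X) :=
  {W | W ∈ 𝒱 ∧ closure W ⊆ U ∧ x ∈ W}

/-- `u` is `𝒲`-hyperharmonic on `U`. Only the values of `u` on `U` matter. -/
def IsHyperharmonicOn (H : Set X → Kernel X X) (𝒲 : X → Set (Set X)) (u : X → EReal)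
    (U : Set X) : Prop :=
  LowerSemicontinuousOn u U ∧ (∀ x ∈ U, u x ≠ ⊥) ∧
    ∀ x ∈ U, ∀ W ∈ 𝒲 x, eintegral (H W x) u ≤ u x

/-- The positive `𝒲`-hyperharmonic functions on `U` separate the points of `U`. -/
def PosHyperharmonicSeparates (H : Set X → Kernel X X) (𝒲 : X → Set (Set X)) (U : Set X) : Prop :=
  ∀ x ∈ U, ∀ y ∈ U, x ≠ y →
    ∃ u : X → EReal, IsHyperharmonicOn H 𝒲 u U ∧ (∀ z ∈ U, 0 ≤ u z) ∧ u x ≠ u y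

/-- `h` is harmonic on `U`. Only the values of `h` on `U` matter. -/
def IsHarmonicOn (𝒱 : Set (Set X)) (H : Set X → Kernel X X) (h : X → ℝ) (U : Set X) : Prop :=
  ContinuousOn h U ∧ ∀ V ∈ 𝒱, closure V ⊆ U → ∀ x ∈ V, ∫ y, h y ∂(H V x) = h x

/-- `(H V)_{V ∈ 𝒱}` is a normal Bauer family of harmonic boundary kernels.
(Values `H V` for `V ∉ 𝒱` are irrelevant.) -/
structure IsNormalBauerFamily (𝒱 : Set (Set X)) (H : Set X → Kernel X X) : Prop where
  isTopologicalBasis : TopologicalSpace.IsTopologicalBasis 𝒱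
  isCompact_closure : ∀ V ∈ 𝒱, IsCompact (closure V)
  isBoundaryKernel : ∀ V ∈ 𝒱, IsBoundaryKernel V (H V)
  /-- `H_W H_V = H_V` for `W ⊆ V`; the composition `H V ∘ₖ H W` is `x ↦ ∫ H_V(y,·) H_W(x,dy)`. -/
  comp_eq : ∀ V ∈ 𝒱, ∀ W ∈ 𝒱, W ⊆ V → H V ∘ₖ H W = H V
  continuous_integral : ∀ V ∈ 𝒱, ∀ f : X → ℝ, Continuous f →
    Continuous fun x => ∫ y, f y ∂(H V x)
  normal : ∀ V ∈ 𝒱, ∀ x, H V x univ = 1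
  separates : ∀ V ∈ 𝒱, ∃ 𝒲 : X → Set (Set X),
    IsLocalChoice 𝒱 V 𝒲 ∧ PosHyperharmonicSeparates H 𝒲 V
  continuousOn_integral : ∀ V ∈ 𝒱, ∀ f : X → ℝ, Measurable f → (∃ C : ℝ, ∀ x, |f x| ≤ C) →
    ContinuousOn (fun x => ∫ y, f y ∂(H V x)) V

variable (𝒱 : Set (Set X)) (H : Set X → Kernel X X)

/-- `U` is a `𝒫`-set: the positive hyperharmonic functions on the open set `U` separate points. -/
def IsPSet (U : Set X) : Prop :=
  IsOpen U ∧ PosHyperharmonicSeparates H (fullChoice 𝒱 U) U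

/-- `h` is continuous on `closure U`, harmonic on `U`, and equal to `f` on `∂U`. -/
def IsDirichletSolution (U : Set X) (f h : X → ℝ) : Prop :=
  ContinuousOn h (closure U) ∧ IsHarmonicOn 𝒱 H h U ∧ EqOn h f (frontier U)

/-- `U` is regular: `U` is open and relatively compact, and every continuous real function `f` on
`∂U` has a unique continuous extension to `closure U` which is harmonic on `U`; this extension is
positive if `f` is positive. -/
def IsRegular (U : Set X) : Prop :=
  IsOpen U ∧ IsCompact (closure U) ∧
    ∀ f : X → ℝ, ContinuousOn f (frontier U) →
      (∃ h, IsDirichletSolution 𝒱 H U f h) ∧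
      (∀ h₁ h₂, IsDirichletSolution 𝒱 H U f h₁ → IsDirichletSolution 𝒱 H U f h₂ →
        EqOn h₁ h₂ (closure U)) ∧
      ((∀ z ∈ frontier U, 0 ≤ f z) →
        ∀ h, IsDirichletSolution 𝒱 H U f h → ∀ x ∈ closure U, 0 ≤ h x)

/-- `T` is the boundary kernel for `U` which solves the Dirichlet problem on `U`. -/
def IsHarmonicKernel (U : Set X) (T : Kernel X X) : Prop :=
  IsBoundaryKernel U T ∧
    ∀ f : X → ℝ, Continuous f → IsDirichletSolution 𝒱 H U f fun x => ∫ y, f y ∂(T x)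

open Classical in
/-- The harmonic kernel `H_U` of a regular set `U` (with value `0` if there is no such kernel). -/
def harmonicKernel (U : Set X) : Kernel X X :=
  if h : ∃ T, IsHarmonicKernel 𝒱 H U T then h.choose else 0

/-- A compact `K ≠ ∅` is strongly stable if it is contained in a `𝒫`-set `W` such that there is a
strictly positive harmonic function on `W \ K` which tends to zero at `∂K`. -/
def IsStronglyStable (K : Set X) : Prop :=
  IsCompact K ∧ K.Nonempty ∧ ∃ W, IsPSet 𝒱 H W ∧ K ⊆ W ∧
    ∃ h : X → ℝ, IsHarmonicOn 𝒱 H h (W \ K) ∧ (∀ x ∈ W \ K, 0 < h x) ∧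
      ∀ z ∈ frontier K, Tendsto h (𝓝[W \ K] z) (𝓝 0)

/-- The function `g = H_{W₀ \ K} 1_{∂W₀}`. -/
def gFun (W₀ K : Set X) (x : X) : ℝ :=
  (harmonicKernel 𝒱 H (W₀ \ K) x).real (frontier W₀)

/-- `W₀` is a regular `𝒫`-set containing `K` such that `W₀ \ K` is regular
and `g = H_{W₀ \ K} 1_{∂W₀}` is strictly positive on `W₀ \ K`. -/
structure IsAdmissible (K W₀ : Set X) : Prop where
  isRegular : IsRegular 𝒱 H W₀
  isPSet : IsPSet 𝒱 H W₀
  subset : K ⊆ W₀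
  isRegular_diff : IsRegular 𝒱 H (W₀ \ K)
  gFun_pos : ∀ x ∈ W₀ \ K, 0 < gFun 𝒱 H W₀ K x

/-- `A_r = {x ∈ W₀ \ K : g(x) < r}`. -/
def A (W₀ K : Set X) (r : ℝ) : Set X := {x ∈ W₀ \ K | gFun 𝒱 H W₀ K x < r}

/-- `S_r = {x ∈ W₀ \ K : g(x) = r}`. -/
def S (W₀ K : Set X) (r : ℝ) : Set X := {x ∈ W₀ \ K | gFun 𝒱 H W₀ K x = r}

/-- The swept measure `ν H_{A_r} = ∫ H_{A_r}(y,·) ν(dy)`. -/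
def swept (W₀ K : Set X) (ν : Measure X) (r : ℝ) : Measure X :=
  ν.bind (harmonicKernel 𝒱 H (A 𝒱 H W₀ K r))

/-- Compatibility: `σ_r H_{A_t} = (r/t) σ_t` on `S_t` for all `0 < r < t < 1`. -/
def IsCompatible (W₀ K : Set X) (σ : ℝ → Measure X) : Prop :=
  ∀ r t : ℝ, 0 < r → r < t → t < 1 →
    (swept 𝒱 H W₀ K (σ r) t).restrict (S 𝒱 H W₀ K t) =
      ENNReal.ofReal (r / t) • (σ t).restrict (S 𝒱 H W₀ K t)

end Families

section Collapse

variable {X : Type*} [TopologicalSpace X]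

/-- The equivalence relation identifying all points of `K`. -/
def collapseSetoid (K : Set X) : Setoid X where
  r x y := x = y ∨ (x ∈ K ∧ y ∈ K)
  iseqv := by
    refine ⟨fun x => Or.inl rfl, ?_, ?_⟩
    · rintro x y (h | h)
      · exact Or.inl h.symm
      · exact Or.inr ⟨h.2, h.1⟩
    · rintro x y z (rfl | h) (rfl | h')
      · exact Or.inl rfl
      · exact Or.inr h'
      · exact Or.inr h
      · exact Or.inr ⟨h.1, h'.2⟩

/-- The space `X₀` obtained from `X` by identifying `K` with a single point, with the quotient
topology: for closed `K ≠ ∅`, the open sets of `X₀` avoiding that point are the open subsets of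
`X \ K`, and its neighborhoods are given by the neighborhoods of `K` in `X`. -/
def Collapse (K : Set X) : Type _ := Quotient (collapseSetoid K)

instance (K : Set X) : TopologicalSpace (Collapse K) :=
  inferInstanceAs (TopologicalSpace (Quotient (collapseSetoid K)))

/-- `X₀` carries its Borel `σ`-algebra. -/
instance (K : Set X) : MeasurableSpace (Collapse K) := borel _

instance (K : Set X) : BorelSpace (Collapse K) := ⟨rfl⟩

/-- The canonical projection `X → X₀`. -/
def proj (K : Set X) (x : X) : Collapse K := Quotient.mk (collapseSetoid K) x

variable [MeasurableSpace X]

/-- `(H₀ V)_{V ∈ 𝒱₀}` is obtained by darning of `K`: it is a normal Bauer family of harmonic boundary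
kernels on the (locally compact Hausdorff, second countable) space `X₀` which contains the kernels
`H V`, `V ∈ 𝒱`, `closure V ∩ K = ∅`, transported to `X₀`. -/
structure IsDarning (𝒱 : Set (Set X)) (H : Set X → Kernel X X) (K : Set X)
    (𝒱₀ : Set (Set (Collapse K))) (H₀ : Set (Collapse K) → Kernel (Collapse K) (Collapse K)) :
    Prop where
  t2Space : T2Space (Collapse K)
  locallyCompactSpace : LocallyCompactSpace (Collapse K)
  secondCountableTopology : SecondCountableTopology (Collapse K)
  isNormalBauerFamily : IsNormalBauerFamily 𝒱₀ H₀
  image_mem : ∀ V ∈ 𝒱, Disjoint (closure V) K → proj K '' V ∈ 𝒱₀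
  kernel_eq : ∀ V ∈ 𝒱, Disjoint (closure V) K →
    ∀ x, H₀ (proj K '' V) (proj K x) = (H V x).map (proj K)

end Collapse

end Darning

end

/-!
Near `K` the family is governed by a function `g`, harmonic and strictly positive off `K` and
tending to zero at `K`. As `H_{A_r}` reproduces `g` on `A_r = {0 < g < r}`, it maps a point of
`S_s`, `s < r`, to `S_r` with probability `s / r`, so that `μ ↦ (r / s) (μ H_{A_r})|_{S_r}` sends
probability measures on `S_s` to probability measures on `S_r`. These maps are continuous and
compose well, the level sets are compact, and a diagonal argument yields the compatible limits
`σ_r`.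

A neighborhood `{g < r}` of the collapsed point gets the kernel which moves by `H_{A_r}` and is
restarted with `σ_r` when it hits `K`. Compatibility of the `σ_r` says exactly that the kernels for
different `r` are consistent. The points of `{g < r}` are separated by the functions
`min (v + N (r - g)) d`, `v` positive hyperharmonic off `K`: if `d ≤ N r`, then such a function
attains its maximum `d` on `K`, so it is hyperharmonic also there.
-/

noncomputable section

namespace Darning

section BoundedFunctions

variable {Y Z : Type*} [MeasurableSpace Y] [MeasurableSpace Z] {C : ℝ}

lemma integrable_of_measurable_of_abs_le {μ : Measure Y} [IsFiniteMeasure μ] {f : Y → ℝ}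
    (hf : Measurable f) (hC : ∀ x, |f x| ≤ C) : Integrable f μ :=
  Integrable.of_bound hf.aestronglyMeasurable C (ae_of_all _ hC)

lemma abs_integral_le_of_abs_le {μ : Measure Y} [IsProbabilityMeasure μ] {f : Y → ℝ}
    (hC : ∀ x, |f x| ≤ C) : |∫ x, f x ∂μ| ≤ C := by
  simpa using norm_integral_le_of_norm_le_const (μ := μ) (f := f) (C := C) (ae_of_all _ hC)

lemma measurable_integral_kernel (κ : Kernel Y Z) {f : Z → ℝ} (hf : Measurable f) :
    Measurable fun y => ∫ z, f z ∂(κ y) :=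
  (hf.stronglyMeasurable.integral_kernel (κ := κ)).measurable

lemma tendsto_integral_of_abs_le {μ : Measure Y} [IsFiniteMeasure μ] {φ : ℕ → Y → ℝ} {u : Y → ℝ}
    (hφ : ∀ n, Measurable (φ n)) (hC : ∀ n x, |φ n x| ≤ C)
    (hlim : ∀ x, Tendsto (fun n => φ n x) atTop (𝓝 (u x))) :
    Tendsto (fun n => ∫ y, φ n y ∂μ) atTop (𝓝 (∫ y, u y ∂μ)) :=
  tendsto_integral_of_dominated_convergence (fun _ => C) (fun n => (hφ n).aestronglyMeasurable)
    (integrable_const C) (fun n => ae_of_all _ fun x => hC n x) (ae_of_all _ hlim)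

end BoundedFunctions

section LipschitzEnvelope

variable {Y : Type*} [PseudoMetricSpace Y] {u : Y → ℝ} {c : ℝ}

/-- The Pasch–Hausdorff envelope of `u`: the largest `n`-Lipschitz function below `u`. -/
def lipschitzEnvelope (u : Y → ℝ) (n : ℕ) (x : Y) : ℝ := ⨅ y, (u y + n * dist x y)

lemma lipschitzEnvelope_le_add (hc : ∀ x, c ≤ u x) (n : ℕ) (x y : Y) :
    lipschitzEnvelope u n x ≤ u y + n * dist x y :=
  ciInf_le ⟨c, by rintro _ ⟨y, rfl⟩; exact le_add_of_le_of_nonneg (hc y) (by positivity)⟩ y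

lemma lipschitzEnvelope_le (hc : ∀ x, c ≤ u x) (n : ℕ) (x : Y) : lipschitzEnvelope u n x ≤ u x := by
  simpa using lipschitzEnvelope_le_add hc n x x

lemma le_lipschitzEnvelope {n : ℕ} {x : Y} {a : ℝ} (h : ∀ y, a ≤ u y + n * dist x y) :
    a ≤ lipschitzEnvelope u n x :=
  have : Nonempty Y := ⟨x⟩
  le_ciInf h

lemma lipschitzWith_lipschitzEnvelope (hc : ∀ x, c ≤ u x) (n : ℕ) :
    LipschitzWith n (lipschitzEnvelope u n) := by
  refine LipschitzWith.of_le_add_mul _ fun x x' => ?_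
  rw [← sub_le_iff_le_add, NNReal.coe_natCast]
  refine le_lipschitzEnvelope fun y => ?_
  have h : (n : ℝ) * dist x y ≤ n * (dist x x' + dist x' y) := by gcongr; exact dist_triangle _ _ _
  linarith [lipschitzEnvelope_le_add hc n x y]

lemma tendsto_lipschitzEnvelope (hu : LowerSemicontinuous u) (hc : ∀ x, c ≤ u x) (x : Y) :
    Tendsto (fun n => lipschitzEnvelope u n x) atTop (𝓝 (u x)) := by
  refine tendsto_order.2 ⟨fun a ha => ?_, fun a ha =>
    Eventually.of_forall fun n => (lipschitzEnvelope_le hc n x).trans_lt ha⟩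
  obtain ⟨b, hab, hb⟩ := exists_between ha
  obtain ⟨δ, hδ, hball⟩ := Metric.eventually_nhds_iff.1 (hu x b hb)
  filter_upwards [tendsto_natCast_atTop_atTop.eventually_ge_atTop ((b - c) / δ)] with n hn
  refine hab.trans_le (le_lipschitzEnvelope fun y => ?_)
  rcases lt_or_ge (dist y x) δ with hy | hy
  · exact le_add_of_le_of_nonneg (hball hy).le (by positivity)
  · have h : b - c ≤ n * dist x y := calc
      b - c ≤ n * δ := (div_le_iff₀ hδ).1 hn
      _ ≤ n * dist x y := by rw [dist_comm]; gcongr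
    linarith [hc y]

end LipschitzEnvelope

lemma exists_continuous_tendsto_of_lowerSemicontinuous {Y : Type*} [TopologicalSpace Y]
    [TopologicalSpace.PseudoMetrizableSpace Y] {u : Y → ℝ} (hu : LowerSemicontinuous u) {C : ℝ}
    (hC : ∀ x, |u x| ≤ C) :
    ∃ φ : ℕ → Y → ℝ, (∀ n, Continuous (φ n)) ∧ (∀ n x, φ n x ≤ u x) ∧ (∀ n x, |φ n x| ≤ C) ∧
      ∀ x, Tendsto (fun n => φ n x) atTop (𝓝 (u x)) := by
  let _ := TopologicalSpace.pseudoMetrizableSpacePseudoMetric Y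
  have hlow x : -C ≤ u x := (abs_le.1 (hC x)).1
  refine ⟨lipschitzEnvelope u, fun n => (lipschitzWith_lipschitzEnvelope hlow n).continuous,
    lipschitzEnvelope_le hlow, fun n x => abs_le.2 ⟨le_lipschitzEnvelope fun y => ?_,
      (lipschitzEnvelope_le hlow n x).trans (abs_le.1 (hC x)).2⟩, tendsto_lipschitzEnvelope hu hlow⟩
  exact le_add_of_le_of_nonneg (hlow y) (by positivity)

lemma aemeasurable_of_lowerSemicontinuousOn {Y α : Type*} [TopologicalSpace Y] [MeasurableSpace Y]
    [OpensMeasurableSpace Y] [TopologicalSpace α] [LinearOrder α] [OrderTopology α]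
    [SecondCountableTopology α] [MeasurableSpace α] [BorelSpace α] {μ : Measure Y} {u : Y → α}
    {P : Set Y} (hP : IsOpen P) (hu : LowerSemicontinuousOn u P) (hμ : ∀ᵐ y ∂μ, y ∈ P) :
    AEMeasurable u μ := by
  have h : LowerSemicontinuous fun y : P => u y :=
    lowerSemicontinuousOn_univ_iff.1
      (hu.comp continuous_subtype_val.continuousOn fun y _ => y.2)
  rw [← Measure.restrict_eq_self_of_ae_mem hμ]
  exact aemeasurable_restrict_of_measurable_subtype hP.measurableSet h.measurable

section ExtendedIntegral

variable {X : Type*} [MeasurableSpace X] {μ : Measure X}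

lemma eintegral_of_nonneg {u : X → EReal} (h : ∀ᵐ y ∂μ, 0 ≤ u y) :
    eintegral μ u = ((∫⁻ y, (u y).toENNReal ∂μ : ℝ≥0∞) : EReal) := by
  have hneg : ∫⁻ y, (-u y).toENNReal ∂μ = 0 := by
    refine (lintegral_congr_ae (g := 0) ?_).trans lintegral_zero
    filter_upwards [h] with y hy
    exact EReal.toENNReal_of_nonpos (EReal.neg_le_zero.2 hy)
  rw [eintegral, hneg, EReal.coe_ennreal_zero, sub_zero]

lemma ae_le_of_eintegral_le [IsProbabilityMeasure μ] {u : X → EReal} (hu : AEMeasurable u μ)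
    {c : EReal} (hc0 : 0 ≤ c) (hc : c ≠ ⊤) (hle : eintegral μ u ≤ c) (hcu : ∀ᵐ y ∂μ, c ≤ u y) :
    ∀ᵐ y ∂μ, u y ≤ c := by
  have hint : ∫⁻ y, (u y).toENNReal ∂μ ≤ c.toENNReal := by
    rw [eintegral_of_nonneg (hcu.mono fun y => hc0.trans)] at hle
    simpa using EReal.toENNReal_le_toENNReal hle
  have heq : (fun _ => c.toENNReal) =ᵐ[μ] fun y => (u y).toENNReal :=
    ae_eq_of_ae_le_of_lintegral_le (hcu.mono fun y => EReal.toENNReal_le_toENNReal)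
      (by simpa using hc) (measurable_ereal_toENNReal.comp_aemeasurable hu) (by simpa using hint)
  filter_upwards [heq, hcu] with y hy hcy
  rw [← EReal.coe_toENNReal hc0, ← EReal.coe_toENNReal (hc0.trans hcy)]
  exact_mod_cast hy.ge

end ExtendedIntegral

section Basic

variable {X : Type*} [TopologicalSpace X] [MeasurableSpace X] {𝒱 : Set (Set X)}
  {H : Set X → Kernel X X} {V W : Set X}

namespace IsNormalBauerFamily

lemma isOpen (hH : IsNormalBauerFamily 𝒱 H) (hV : V ∈ 𝒱) : IsOpen V :=
  hH.isTopologicalBasis.isOpen hV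

lemma isMarkovKernel (hH : IsNormalBauerFamily 𝒱 H) (hV : V ∈ 𝒱) : IsMarkovKernel (H V) :=
  ⟨fun x => ⟨hH.normal V hV x⟩⟩

lemma ae_mem_frontier (hH : IsNormalBauerFamily 𝒱 H) (hV : V ∈ 𝒱) {x : X} (hx : x ∈ V) :
    ∀ᵐ y ∂(H V x), y ∈ frontier V :=
  (hH.isBoundaryKernel V hV).1 x hx

lemma eq_dirac (hH : IsNormalBauerFamily 𝒱 H) (hV : V ∈ 𝒱) {x : X} (hx : x ∉ V) :
    H V x = Measure.dirac x :=
  (hH.isBoundaryKernel V hV).2 x hx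

lemma exists_closure_subset [RegularSpace X] (hH : IsNormalBauerFamily 𝒱 H) {x : X} {N : Set X}
    (hN : N ∈ 𝓝 x) : ∃ V ∈ 𝒱, x ∈ V ∧ closure V ⊆ N := by
  obtain ⟨C, hC, hCc, hCN⟩ := exists_mem_nhds_isClosed_subset hN
  obtain ⟨V, hV, hxV, hVC⟩ := hH.isTopologicalBasis.mem_nhds_iff.1 hC
  exact ⟨V, hV, hxV, (closure_minimal hVC hCc).trans hCN⟩

lemma integral_integral (hH : IsNormalBauerFamily 𝒱 H) (hV : V ∈ 𝒱) (hW : W ∈ 𝒱) (hWV : W ⊆ V)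
    {f : X → ℝ} (hf : Measurable f) {C : ℝ} (hC : ∀ x, |f x| ≤ C) (x : X) :
    ∫ y, ∫ z, f z ∂(H V y) ∂(H W x) = ∫ z, f z ∂(H V x) := by
  have := hH.isMarkovKernel hV
  have := hH.isMarkovKernel hW
  rw [← Kernel.integral_comp (integrable_of_measurable_of_abs_le hf hC), hH.comp_eq V hV W hW hWV]

lemma integral_eq_of_notMem [MeasurableSingletonClass X] (hH : IsNormalBauerFamily 𝒱 H)
    (hV : V ∈ 𝒱) {x : X} (hx : x ∉ V) (f : X → ℝ) : ∫ y, f y ∂(H V x) = f x := by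
  rw [hH.eq_dirac hV hx, integral_dirac]

lemma lowerSemicontinuous_integral [TopologicalSpace.PseudoMetrizableSpace X] [BorelSpace X]
    (hH : IsNormalBauerFamily 𝒱 H) (hV : V ∈ 𝒱) {u : X → ℝ} (hu : LowerSemicontinuous u) {C : ℝ}
    (hC : ∀ x, |u x| ≤ C) : LowerSemicontinuous fun x => ∫ y, u y ∂(H V x) := by
  have := hH.isMarkovKernel hV
  obtain ⟨φ, hφc, hφu, hφC, hlim⟩ := exists_continuous_tendsto_of_lowerSemicontinuous hu hC
  intro x t ht
  obtain ⟨n, hn⟩ := ((tendsto_integral_of_abs_le (μ := H V x) (fun n => (hφc n).measurable) hφC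
    hlim).eventually_const_lt ht).exists
  filter_upwards [(hH.continuous_integral V hV (φ n) (hφc n)).continuousAt.eventually_const_lt hn]
    with y hy
  exact hy.trans_le (integral_mono
    (integrable_of_measurable_of_abs_le (hφc n).measurable (hφC n))
    (integrable_of_measurable_of_abs_le hu.measurable hC) (hφu n))

end IsNormalBauerFamily

/-- `L` is absorbing for the choice `x ↦ W x` of sets: the measure `H_{W x}(x, ·)` of each point
`x ∈ L` is carried by `L`. -/
def IsAbsorbing (H : Set X → Kernel X X) (W : X → Set X) (L : Set X) : Prop :=
  ∀ x ∈ L, ∀ᵐ y ∂(H (W x) x), y ∈ L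

namespace IsAbsorbing

lemma sInter [SecondCountableTopology X] {W : X → Set X} {c : Set (Set X)}
    (hc : ∀ L ∈ c, IsClosed L) (h : ∀ L ∈ c, IsAbsorbing H W L) : IsAbsorbing H W (⋂₀ c) := by
  refine fun x hx => measure_null_of_locally_null _ fun y hy => ?_
  obtain ⟨L, hL, hyL⟩ : ∃ L ∈ c, y ∉ L := by simpa using hy
  exact ⟨Lᶜ, mem_nhdsWithin_of_mem_nhds ((hc L hL).isOpen_compl.mem_nhds hyL),
    h L hL x (hx L hL)⟩

lemma exists_minimal [T2Space X] [SecondCountableTopology X] {W : X → Set X} {M : Set X}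
    (hM : IsAbsorbing H W M) (hMc : IsCompact M) (hne : M.Nonempty) :
    ∃ L ⊆ M, Minimal (fun L => IsCompact L ∧ L.Nonempty ∧ IsAbsorbing H W L) L := by
  refine zorn_superset_nonempty {L | IsCompact L ∧ L.Nonempty ∧ IsAbsorbing H W L}
    (fun c hc hchain hcne => ?_) M ⟨hMc, hne, hM⟩
  have hclosed : ∀ L ∈ c, IsClosed L := fun L hL => (hc hL).1.isClosed
  have : Nonempty c := hcne.to_subtype
  obtain ⟨L, hL⟩ := id hcne
  refine ⟨⋂₀ c, ⟨(hc hL).1.of_isClosed_subset (isClosed_sInter hclosed) (sInter_subset_of_mem hL),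
    ?_, .sInter hclosed fun L hL => (hc hL).2.2⟩, fun L hL => sInter_subset_of_mem hL⟩
  exact IsCompact.nonempty_sInter_of_directed_nonempty_isCompact_isClosed
    (show IsChain (· ⊇ ·) c from hchain.symm).directedOn
    (fun L hL => (hc hL).2.1) (fun L hL => (hc hL).1) hclosed

lemma setOf_isMinOn [OpensMeasurableSpace X] (hH : IsNormalBauerFamily 𝒱 H) {P L : Set X}
    {W : X → Set X} (hL : IsAbsorbing H W L) (hP : IsOpen P) (hLP : L ⊆ P)
    (hW : ∀ x ∈ L, W x ∈ fullChoice 𝒱 P x) {u : X → EReal}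
    (hu : IsHyperharmonicOn H (fullChoice 𝒱 P) u P) (hpos : ∀ x ∈ P, 0 ≤ u x) {z : X}
    (hz : z ∈ L) (hzmin : IsMinOn u L z) (hztop : u z ≠ ⊤) :
    IsAbsorbing H W {x ∈ L | u x ≤ u z} := by
  intro x ⟨hx, hxz⟩
  have := hH.isMarkovKernel (hW x hx).1
  have hae : ∀ᵐ y ∂(H (W x) x), u y ≤ u z :=
    ae_le_of_eintegral_le
      (aemeasurable_of_lowerSemicontinuousOn hP hu.1 ((hL x hx).mono fun y hy => hLP hy))
      (hpos z (hLP hz)) hztop ((hu.2.2 x (hLP hx) _ (hW x hx)).trans hxz)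
      ((hL x hx).mono fun y hy => hzmin hy)
  filter_upwards [hL x hx, hae] with y hyL hyz using ⟨hyL, hyz⟩

end IsAbsorbing

-- In a minimal absorbing compact set every positive hyperharmonic function is constant, so the set
-- is a point `x`; but `H_{W x}(x, ·)` is carried by `∂(W x)`, which does not contain `x`.
lemma IsPSet.not_isAbsorbing [T2Space X] [SecondCountableTopology X] [OpensMeasurableSpace X]
    (hH : IsNormalBauerFamily 𝒱 H) {P : Set X} (hP : IsPSet 𝒱 H P) {M : Set X} (hM : IsCompact M)
    (hne : M.Nonempty) (hMP : M ⊆ P) {W : X → Set X} (hW : ∀ x ∈ M, W x ∈ fullChoice 𝒱 P x) :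
    ¬ IsAbsorbing H W M := by
  intro hMabs
  obtain ⟨L, hLM, hLmin⟩ := hMabs.exists_minimal hM hne
  obtain ⟨hLc, hLne, hLabs⟩ := hLmin.prop
  have hLP : L ⊆ P := hLM.trans hMP
  have hconst : ∀ x ∈ L, ∀ y ∈ L, x = y := by
    intro x hx y hy
    by_contra hxy
    obtain ⟨u, hu, hpos, hune⟩ := hP.2 x (hLP hx) y (hLP hy) hxy
    obtain ⟨z, hz, hzmin⟩ := (hu.1.mono hLP).exists_isMinOn hLne hLc
    by_cases hztop : u z = ⊤
    · have htop : ∀ w ∈ L, u w = ⊤ := fun w hw => top_le_iff.1 (hztop ▸ hzmin hw)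
      exact hune ((htop x hx).trans (htop y hy).symm)
    have hmin : L ⊆ {w ∈ L | u w ≤ u z} :=
      hLmin.le_of_le ⟨(hu.1.mono hLP).isCompact_inter_preimage_Iic hLc (u z), ⟨z, hz, le_rfl⟩,
        hLabs.setOf_isMinOn hH hP.1 hLP (fun w hw => hW w (hLM hw)) hu hpos hz hzmin hztop⟩
        (sep_subset _ _)
    have heq : ∀ w ∈ L, u w = u z := fun w hw => le_antisymm (hmin hw).2 (hzmin hw)
    exact hune ((heq x hx).trans (heq y hy).symm)
  obtain ⟨x, hx⟩ := hLne
  obtain ⟨hWx, -, hxW⟩ := hW x (hLM hx)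
  have := hH.isMarkovKernel hWx
  obtain ⟨y, hyL, hy⟩ := ((hLabs x hx).and (hH.ae_mem_frontier hWx hxW)).exists
  rw [← hconst x hx y hyL, (hH.isOpen hWx).frontier_eq] at hy
  exact hy.2 hxW

lemma ae_le_of_integral_le {Y : Type*} [MeasurableSpace Y] {μ : Measure Y} [IsProbabilityMeasure μ]
    {v : Y → ℝ} (hv : Integrable v μ) {c : ℝ} (hle : ∫ y, v y ∂μ ≤ c) (hcv : ∀ᵐ y ∂μ, c ≤ v y) :
    ∀ᵐ y ∂μ, v y ≤ c := by
  have hint : ∫ _, c ∂μ = ∫ y, v y ∂μ :=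
    le_antisymm (integral_mono_ae (integrable_const c) hv hcv) (by simpa using hle)
  filter_upwards [(integral_eq_iff_of_ae_le (integrable_const c) hv hcv).1 hint] with y hy
    using hy.ge

lemma IsPSet.nonneg_of_frontier_nonneg [T2Space X] [SecondCountableTopology X]
    [OpensMeasurableSpace X] (hH : IsNormalBauerFamily 𝒱 H) {P U : Set X} (hP : IsPSet 𝒱 H P)
    (hU : IsOpen U) (hUP : U ⊆ P) (hUc : IsCompact (closure U)) {v : X → ℝ}
    (hv : LowerSemicontinuousOn v (closure U)) (hfr : ∀ x ∈ frontier U, 0 ≤ v x)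
    (hloc : ∀ x ∈ U, ∃ W ∈ fullChoice 𝒱 U x, Integrable v (H W x) ∧ ∫ y, v y ∂(H W x) ≤ v x) :
    ∀ x ∈ closure U, 0 ≤ v x := by
  intro x hx
  by_contra! hneg
  obtain ⟨z, hz, hzmin⟩ := hv.exists_isMinOn ⟨x, hx⟩ hUc
  have hz0 : v z < 0 := (hzmin hx).trans_lt hneg
  set M := {w ∈ closure U | v w ≤ v z}
  have hMU : M ⊆ U := fun w hw => by
    by_contra hwU
    linarith [hfr w (hU.frontier_eq ▸ ⟨hw.1, hwU⟩), hw.2]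
  choose! W hW hint hle using hloc
  refine hP.not_isAbsorbing hH (hv.isCompact_inter_preimage_Iic hUc (v z)) ⟨z, hz, le_refl (v z)⟩
    (hMU.trans hUP) (W := W) (fun w hw => ?_) fun w hw => ?_
  · obtain ⟨h𝒱, hcl, hmem⟩ := hW w (hMU hw)
    exact ⟨h𝒱, hcl.trans hUP, hmem⟩
  · obtain ⟨h𝒱, hcl, hmem⟩ := hW w (hMU hw)
    have := hH.isMarkovKernel h𝒱
    have hclosure : ∀ᵐ y ∂(H (W w) w), y ∈ closure U := by
      filter_upwards [hH.ae_mem_frontier h𝒱 hmem] with y hy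
      exact subset_closure (hcl (frontier_subset_closure hy))
    filter_upwards [hclosure, ae_le_of_integral_le (hint w (hMU hw))
      ((hle w (hMU hw)).trans hw.2) (hclosure.mono fun y hy => hzmin hy)] with y hy hyz
    exact ⟨hy, hyz⟩

end Basic

section LocallyHarmonic

variable {X : Type*} [TopologicalSpace X] [MeasurableSpace X] {𝒱 : Set (Set X)}
  {H : Set X → Kernel X X} {P V : Set X} {u : X → ℝ} {C : ℝ}

/-- The super mean value inequality for `u` at `x` along arbitrarily small sets of the base `𝒱`. -/
def LocallySuperharmonicAt (𝒱 : Set (Set X)) (H : Set X → Kernel X X) (u : X → ℝ) (x : X) : Prop :=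
  ∀ N ∈ 𝓝 x, ∃ W ∈ fullChoice 𝒱 N x, ∫ y, u y ∂(H W x) ≤ u x

/-- The mean value property of `u` at `x` along arbitrarily small sets of the base `𝒱`. -/
def LocallyHarmonicAt (𝒱 : Set (Set X)) (H : Set X → Kernel X X) (u : X → ℝ) (x : X) : Prop :=
  ∀ N ∈ 𝓝 x, ∃ W ∈ fullChoice 𝒱 N x, ∫ y, u y ∂(H W x) = u x

namespace LocallyHarmonicAt

variable {x : X}

lemma locallySuperharmonicAt (h : LocallyHarmonicAt 𝒱 H u x) : LocallySuperharmonicAt 𝒱 H u x :=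
  fun N hN => let ⟨W, hW, hu⟩ := h N hN; ⟨W, hW, hu.le⟩

lemma neg (h : LocallyHarmonicAt 𝒱 H u x) : LocallyHarmonicAt 𝒱 H (fun y => -u y) x :=
  fun N hN => let ⟨W, hW, hu⟩ := h N hN; ⟨W, hW, by rw [integral_neg, hu]⟩

end LocallyHarmonicAt

namespace IsNormalBauerFamily

variable [RegularSpace X]

lemma locallySuperharmonicAt_of_forall_subset (hH : IsNormalBauerFamily 𝒱 H) {O : Set X} {x : X}
    (hO : O ∈ 𝓝 x) (h : ∀ W ∈ 𝒱, closure W ⊆ O → x ∈ W → ∫ y, u y ∂(H W x) ≤ u x) :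
    LocallySuperharmonicAt 𝒱 H u x := by
  intro N hN
  obtain ⟨W, hW, hxW, hWN⟩ := hH.exists_closure_subset (inter_mem hN hO)
  exact ⟨W, ⟨hW, hWN.trans inter_subset_left, hxW⟩, h W hW (hWN.trans inter_subset_right) hxW⟩

lemma locallyHarmonicAt_of_forall_subset (hH : IsNormalBauerFamily 𝒱 H) {O : Set X} {x : X}
    (hO : O ∈ 𝓝 x) (h : ∀ W ∈ 𝒱, closure W ⊆ O → x ∈ W → ∫ y, u y ∂(H W x) = u x) :
    LocallyHarmonicAt 𝒱 H u x := by
  intro N hN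
  obtain ⟨W, hW, hxW, hWN⟩ := hH.exists_closure_subset (inter_mem hN hO)
  exact ⟨W, ⟨hW, hWN.trans inter_subset_left, hxW⟩, h W hW (hWN.trans inter_subset_right) hxW⟩

end IsNormalBauerFamily

namespace IsPSet

variable [T2Space X] [SecondCountableTopology X] [BorelSpace X]

lemma integral_le_of_continuous_le (hH : IsNormalBauerFamily 𝒱 H) (hP : IsPSet 𝒱 H P)
    (hV : V ∈ 𝒱) (hVP : V ⊆ P) (hu : LowerSemicontinuous u) (hC : ∀ x, |u x| ≤ C)
    (hloc : ∀ x ∈ V, LocallySuperharmonicAt 𝒱 H u x) {φ : X → ℝ} (hφ : Continuous φ)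
    (hφC : ∀ x, |φ x| ≤ C) (hφu : ∀ x, φ x ≤ u x) {x : X} (hx : x ∈ V) :
    ∫ y, φ y ∂(H V x) ≤ u x := by
  have hVo := hH.isOpen hV
  have hcont := hH.continuous_integral V hV φ hφ
  rw [← sub_nonneg]
  refine hP.nonneg_of_frontier_nonneg hH hVo hVP (hH.isCompact_closure V hV)
    (v := fun y => u y - ∫ z, φ z ∂(H V y)) ?_ (fun y hy => ?_) (fun y hy => ?_) x
    (subset_closure hx)
  · have hlsc := hu.add hcont.neg.lowerSemicontinuous
    simpa [sub_eq_add_neg] using hlsc.lowerSemicontinuousOn (closure V)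
  · rw [hVo.frontier_eq] at hy
    rw [hH.integral_eq_of_notMem hV hy.2]
    exact sub_nonneg.2 (hφu y)
  · obtain ⟨W, hW, hle⟩ := hloc y hy V (hVo.mem_nhds hy)
    have := hH.isMarkovKernel hW.1
    have := hH.isMarkovKernel hV
    have hint : Integrable u (H W y) := integrable_of_measurable_of_abs_le hu.measurable hC
    have hint' : Integrable (fun y => ∫ z, φ z ∂(H V y)) (H W y) :=
      integrable_of_measurable_of_abs_le hcont.measurable fun _ => abs_integral_le_of_abs_le hφC
    refine ⟨W, hW, hint.sub hint', ?_⟩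
    rw [integral_sub hint hint', hH.integral_integral hV hW.1 (subset_closure.trans hW.2.1)
      hφ.measurable hφC]
    exact sub_le_sub_right hle _

variable [LocallyCompactSpace X]

lemma integral_le_of_locallySuperharmonicAt (hH : IsNormalBauerFamily 𝒱 H) (hP : IsPSet 𝒱 H P)
    (hV : V ∈ 𝒱) (hVP : V ⊆ P) (hu : LowerSemicontinuous u) (hC : ∀ x, |u x| ≤ C)
    (hloc : ∀ x ∈ V, LocallySuperharmonicAt 𝒱 H u x) (x : X) : ∫ y, u y ∂(H V x) ≤ u x := by
  by_cases hx : x ∈ V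
  · have := hH.isMarkovKernel hV
    obtain ⟨φ, hφc, hφu, hφC, hlim⟩ := exists_continuous_tendsto_of_lowerSemicontinuous hu hC
    exact le_of_tendsto' (tendsto_integral_of_abs_le (fun n => (hφc n).measurable) hφC hlim)
      fun n => hP.integral_le_of_continuous_le hH hV hVP hu hC hloc (hφc n) (hφC n) (hφu n) hx
  · rw [hH.integral_eq_of_notMem hV hx]

lemma integral_eq_of_locallyHarmonicAt (hH : IsNormalBauerFamily 𝒱 H) (hP : IsPSet 𝒱 H P)
    (hV : V ∈ 𝒱) (hVP : V ⊆ P) (hu : Continuous u) (hC : ∀ x, |u x| ≤ C)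
    (hloc : ∀ x ∈ V, LocallyHarmonicAt 𝒱 H u x) (x : X) : ∫ y, u y ∂(H V x) = u x := by
  refine le_antisymm (hP.integral_le_of_locallySuperharmonicAt hH hV hVP hu.lowerSemicontinuous hC
    (fun x hx => (hloc x hx).locallySuperharmonicAt) x) ?_
  have hneg := hP.integral_le_of_locallySuperharmonicAt hH hV hVP
    (u := fun y => -u y) hu.neg.lowerSemicontinuous
    (by simpa using hC) (fun x hx => (hloc x hx).neg.locallySuperharmonicAt) x
  rwa [integral_neg, neg_le_neg_iff] at hneg

end IsPSet

end LocallyHarmonic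

section Perron

variable {X : Type*} [TopologicalSpace X] [MeasurableSpace X] {𝒱 : Set (Set X)}
  {H : Set X → Kernel X X} {U P : Set X} {F u : X → ℝ} {C : ℝ}

/-- The upper class of the Dirichlet problem on `U` with boundary data `F`: functions bounded by
`C` which are superharmonic on `U`, equal to `F` off `U`, and lower semicontinuous on `X`.
Prescribing the values on the whole complement of `U` allows global functions throughout. -/
structure IsUpper (𝒱 : Set (Set X)) (H : Set X → Kernel X X) (U : Set X) (F : X → ℝ) (C : ℝ)
    (u : X → ℝ) : Prop where
  lsc : LowerSemicontinuous u
  abs_le : ∀ x, |u x| ≤ C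
  eq_of_notMem : ∀ x ∉ U, u x = F x
  integral_le : ∀ V ∈ 𝒱, closure V ⊆ U → ∀ x, ∫ y, u y ∂(H V x) ≤ u x

lemma IsUpper.inf [BorelSpace X] (hH : IsNormalBauerFamily 𝒱 H) {v : X → ℝ}
    (hu : IsUpper 𝒱 H U F C u) (hv : IsUpper 𝒱 H U F C v) :
    IsUpper 𝒱 H U F C fun x => min (u x) (v x) where
  lsc := hu.lsc.inf hv.lsc
  abs_le x := by
    rcases min_choice (u x) (v x) with h | h <;> rw [h]
    exacts [hu.abs_le x, hv.abs_le x]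
  eq_of_notMem x hx := by rw [hu.eq_of_notMem x hx, hv.eq_of_notMem x hx, min_self]
  integral_le V hV hVU x := by
    have := hH.isMarkovKernel hV
    have iu : Integrable u (H V x) := integrable_of_measurable_of_abs_le hu.lsc.measurable hu.abs_le
    have iv : Integrable v (H V x) := integrable_of_measurable_of_abs_le hv.lsc.measurable hv.abs_le
    exact le_min
      ((integral_mono (iu.inf iv) iu fun y => min_le_left _ _).trans (hu.integral_le V hV hVU x))
      ((integral_mono (iu.inf iv) iv fun y => min_le_right _ _).trans (hv.integral_le V hV hVU x))

/-- The Perron solution: the infimum of the upper class. -/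
def perron (𝒱 : Set (Set X)) (H : Set X → Kernel X X) (U : Set X) (F : X → ℝ) (C : ℝ) (x : X) :
    ℝ :=
  ⨅ u : {u : X → ℝ // IsUpper 𝒱 H U F C u}, u.1 x

lemma perron_le (hu : IsUpper 𝒱 H U F C u) (x : X) :
    perron 𝒱 H U F C x ≤ u x :=
  ciInf_le (f := fun u : {u : X → ℝ // IsUpper 𝒱 H U F C u} => u.1 x)
    ⟨-C, by rintro _ ⟨v, rfl⟩; exact (abs_le.1 (v.2.abs_le x)).1⟩ ⟨u, hu⟩

lemma exists_lt_perron_add (hne : ∃ u, IsUpper 𝒱 H U F C u) (x : X) {ε : ℝ} (hε : 0 < ε) :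
    ∃ u, IsUpper 𝒱 H U F C u ∧ u x < perron 𝒱 H U F C x + ε := by
  obtain ⟨u₀, hu₀⟩ := hne
  have : Nonempty {u : X → ℝ // IsUpper 𝒱 H U F C u} := ⟨⟨u₀, hu₀⟩⟩
  obtain ⟨u, hu⟩ := exists_lt_of_ciInf_lt (lt_add_of_pos_right (perron 𝒱 H U F C x) hε)
  exact ⟨u.1, u.2, hu⟩

lemma le_perron (hne : ∃ u, IsUpper 𝒱 H U F C u) {x : X} {a : ℝ}
    (h : ∀ u, IsUpper 𝒱 H U F C u → a ≤ u x) : a ≤ perron 𝒱 H U F C x := by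
  obtain ⟨u₀, hu₀⟩ := hne
  have : Nonempty {u : X → ℝ // IsUpper 𝒱 H U F C u} := ⟨⟨u₀, hu₀⟩⟩
  exact le_ciInf fun u => h u.1 u.2

lemma perron_of_notMem (hne : ∃ u, IsUpper 𝒱 H U F C u) {x : X} (hx : x ∉ U) :
    perron 𝒱 H U F C x = F x := by
  obtain ⟨u₀, hu₀⟩ := id hne
  refine le_antisymm ((perron_le hu₀ x).trans (hu₀.eq_of_notMem x hx).le) ?_
  exact le_perron hne fun u hu => (hu.eq_of_notMem x hx).ge

lemma abs_perron_le (hne : ∃ u, IsUpper 𝒱 H U F C u) (x : X) : |perron 𝒱 H U F C x| ≤ C := by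
  obtain ⟨u₀, hu₀⟩ := id hne
  exact abs_le.2 ⟨le_perron hne fun u hu => (abs_le.1 (hu.abs_le x)).1,
    (perron_le hu₀ x).trans (abs_le.1 (hu₀.abs_le x)).2⟩

lemma exists_antitone_tendsto_perron [BorelSpace X] (hH : IsNormalBauerFamily 𝒱 H)
    (hne : ∃ u, IsUpper 𝒱 H U F C u) (e : ℕ → X) :
    ∃ u : ℕ → X → ℝ, (∀ x, Antitone fun n => u n x) ∧ (∀ n, IsUpper 𝒱 H U F C (u n)) ∧
      ∀ k, Tendsto (fun n => u n (e k)) atTop (𝓝 (perron 𝒱 H U F C (e k))) := by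
  have hex : ∀ k j : ℕ, ∃ w, IsUpper 𝒱 H U F C w ∧
      w (e k) < perron 𝒱 H U F C (e k) + 1 / ((j : ℝ) + 1) := fun k j =>
    exists_lt_perron_add hne (e k) (by positivity)
  choose w hw hwlt using hex
  let ω : ℕ → X → ℝ := fun m => w m.unpair.1 m.unpair.2
  let u : ℕ → X → ℝ := fun n => Nat.rec (ω 0) (fun k v x => min (v x) (ω (k + 1) x)) n
  have hus : ∀ n x, u (n + 1) x = min (u n x) (ω (n + 1) x) := fun n x => rfl
  have hanti : ∀ x, Antitone fun n => u n x := fun x =>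
    antitone_nat_of_succ_le fun n => (hus n x).le.trans (min_le_left _ _)
  have huω : ∀ n x, u n x ≤ ω n x := fun n x => by
    cases n with
    | zero => exact le_rfl
    | succ n => exact (hus n x).le.trans (min_le_right _ _)
  have hup : ∀ n, IsUpper 𝒱 H U F C (u n) := fun n => by
    induction n with
    | zero => exact hw _ _
    | succ n ih => exact ih.inf hH (hw _ _)
  refine ⟨u, hanti, hup, fun k => ?_⟩
  rw [Metric.tendsto_atTop]
  intro ε hε
  obtain ⟨j, hj⟩ := exists_nat_one_div_lt hε
  refine ⟨Nat.pair k j, fun n hn => ?_⟩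
  have h1 : u n (e k) ≤ w k j (e k) := by
    refine (hanti (e k) hn).trans ((huω _ _).trans ?_)
    simp [ω]
  have h2 := hwlt k j
  have h3 := perron_le (hup n) (e k)
  rw [Real.dist_eq, abs_lt]
  constructor <;> linarith

variable [T2Space X] [LocallyCompactSpace X] [SecondCountableTopology X] [BorelSpace X]

lemma IsUpper.integral_kernel (hH : IsNormalBauerFamily 𝒱 H) (hP : IsPSet 𝒱 H P) (hUP : U ⊆ P)
    (hu : IsUpper 𝒱 H U F C u) {V : Set X} (hV : V ∈ 𝒱) (hVU : closure V ⊆ U) :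
    IsUpper 𝒱 H U F C fun x => ∫ y, u y ∂(H V x) := by
  have := hH.isMarkovKernel hV
  have hlsc := hH.lowerSemicontinuous_integral hV hu.lsc hu.abs_le
  have hab : ∀ x, |∫ y, u y ∂(H V x)| ≤ C := fun x => abs_integral_le_of_abs_le hu.abs_le
  refine ⟨hlsc, hab, fun x hx => ?_, fun W hW hWU => ?_⟩
  · rw [hH.integral_eq_of_notMem hV fun h => hx (hVU (subset_closure h)), hu.eq_of_notMem x hx]
  refine hP.integral_le_of_locallySuperharmonicAt hH hW ((subset_closure.trans hWU).trans hUP)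
    hlsc hab fun x hx => ?_
  by_cases hxV : x ∈ V
  · refine hH.locallySuperharmonicAt_of_forall_subset ((hH.isOpen hV).mem_nhds hxV)
      fun W' hW' hW'V _ => ?_
    rw [hH.integral_integral hV hW' (subset_closure.trans hW'V) hu.lsc.measurable hu.abs_le]
  · refine hH.locallySuperharmonicAt_of_forall_subset ((hH.isOpen hW).mem_nhds hx)
      fun W' hW' hW'W _ => ?_
    have := hH.isMarkovKernel hW'
    rw [hH.integral_eq_of_notMem hV hxV]
    refine (integral_mono ?_ ?_ fun y => hu.integral_le V hV hVU y).trans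
      (hu.integral_le W' hW' ((hW'W.trans subset_closure).trans hWU) x)
    · exact integrable_of_measurable_of_abs_le hlsc.measurable hab
    · exact integrable_of_measurable_of_abs_le hu.lsc.measurable hu.abs_le

lemma exists_perron_eq_integral_seq (hH : IsNormalBauerFamily 𝒱 H) (hP : IsPSet 𝒱 H P) (hUP : U ⊆ P)
    (hne : ∃ u, IsUpper 𝒱 H U F C u) {V : Set X} (hV : V ∈ 𝒱) (hVU : closure V ⊆ U) (e : ℕ → X) :
    ∃ v : X → ℝ, Measurable v ∧ (∀ x, |v x| ≤ C) ∧
      ∀ k, ∫ y, v y ∂(H V (e k)) = perron 𝒱 H U F C (e k) := by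
  have := hH.isMarkovKernel hV
  obtain ⟨u, hanti, hup, hlim⟩ := exists_antitone_tendsto_perron hH hne e
  have hbdd : ∀ x, BddBelow (range fun n => u n x) := fun x =>
    ⟨-C, by rintro _ ⟨n, rfl⟩; exact (abs_le.1 ((hup n).abs_le x)).1⟩
  have hconv : ∀ x, Tendsto (fun n => u n x) atTop (𝓝 (⨅ n, u n x)) := fun x =>
    tendsto_atTop_ciInf (hanti x) (hbdd x)
  have hm : Measurable fun x => ⨅ n, u n x :=
    measurable_of_tendsto_metrizable (fun n => (hup n).lsc.measurable)
      (tendsto_pi_nhds.2 hconv)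
  have hintg : ∀ x, Tendsto (fun n => ∫ y, u n y ∂(H V x)) atTop (𝓝 (∫ y, ⨅ n, u n y ∂(H V x))) :=
    fun x => tendsto_integral_of_abs_le (fun n => (hup n).lsc.measurable)
      (fun n => (hup n).abs_le) hconv
  have hge : ∀ x, perron 𝒱 H U F C x ≤ ∫ y, ⨅ n, u n y ∂(H V x) := fun x =>
    ge_of_tendsto' (hintg x) fun n => perron_le ((hup n).integral_kernel hH hP hUP hV hVU) x
  refine ⟨fun x => ⨅ n, u n x, hm, fun x => ?_, fun k => le_antisymm ?_ (hge _)⟩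
  · exact le_of_tendsto' (hconv x).abs fun n => (hup n).abs_le x
  · exact le_of_tendsto_of_tendsto' (hintg (e k)) (hlim k) fun n =>
      (hup n).integral_le V hV hVU (e k)

lemma exists_perron_eq_integral (hH : IsNormalBauerFamily 𝒱 H) (hP : IsPSet 𝒱 H P) (hUP : U ⊆ P)
    (hne : ∃ u, IsUpper 𝒱 H U F C u) {V : Set X} (hV : V ∈ 𝒱) (hVU : closure V ⊆ U) :
    ∃ v : X → ℝ, Measurable v ∧ (∀ x, |v x| ≤ C) ∧
      ∀ x ∈ V, perron 𝒱 H U F C x = ∫ y, v y ∂(H V x) := by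
  cases isEmpty_or_nonempty X
  · exact ⟨perron 𝒱 H U F C, measurable_of_empty _, abs_perron_le hne, isEmptyElim⟩
  obtain ⟨v, hvm, hvC, hve⟩ :=
    exists_perron_eq_integral_seq hH hP hUP hne hV hVU (TopologicalSpace.denseSeq X)
  refine ⟨v, hvm, hvC, fun x hx => ?_⟩
  obtain ⟨v', hvm', hvC', hve'⟩ := exists_perron_eq_integral_seq hH hP hUP hne hV hVU
    fun n => Nat.casesOn n x (TopologicalSpace.denseSeq X)
  have hEq : EqOn (fun y => ∫ z, v z ∂(H V y)) (fun y => ∫ z, v' z ∂(H V y)) V := by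
    refine EqOn.of_subset_closure (s := V ∩ range (TopologicalSpace.denseSeq X)) ?_
      (hH.continuousOn_integral V hV v hvm ⟨C, hvC⟩)
      (hH.continuousOn_integral V hV v' hvm' ⟨C, hvC'⟩)
      inter_subset_left
      ((TopologicalSpace.denseRange_denseSeq X).open_subset_closure_inter (hH.isOpen hV))
    rintro _ ⟨-, n, rfl⟩
    exact (hve n).trans (hve' (n + 1)).symm
  exact (hve' 0).symm.trans (hEq hx).symm

lemma continuousOn_perron (hH : IsNormalBauerFamily 𝒱 H) (hP : IsPSet 𝒱 H P) (hU : IsOpen U)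
    (hUP : U ⊆ P) (hne : ∃ u, IsUpper 𝒱 H U F C u) : ContinuousOn (perron 𝒱 H U F C) U := by
  intro x hx
  obtain ⟨V, hV, hxV, hVU⟩ := hH.exists_closure_subset (hU.mem_nhds hx)
  obtain ⟨v, hvm, hvC, hve⟩ := exists_perron_eq_integral hH hP hUP hne hV hVU
  have h1 : ContinuousOn (perron 𝒱 H U F C) V :=
    (hH.continuousOn_integral V hV v hvm ⟨C, hvC⟩).congr hve
  exact (h1.continuousAt ((hH.isOpen hV).mem_nhds hxV)).continuousWithinAt

lemma locallyHarmonicAt_perron (hH : IsNormalBauerFamily 𝒱 H) (hP : IsPSet 𝒱 H P) (hU : IsOpen U)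
    (hUP : U ⊆ P) (hne : ∃ u, IsUpper 𝒱 H U F C u) {x : X} (hx : x ∈ U) :
    LocallyHarmonicAt 𝒱 H (perron 𝒱 H U F C) x := by
  obtain ⟨V, hV, hxV, hVU⟩ := hH.exists_closure_subset (hU.mem_nhds hx)
  obtain ⟨v, hvm, hvC, hve⟩ := exists_perron_eq_integral hH hP hUP hne hV hVU
  refine hH.locallyHarmonicAt_of_forall_subset ((hH.isOpen hV).mem_nhds hxV) fun W hW hWV hxW => ?_
  rw [hve x hxV, ← hH.integral_integral hV hW (subset_closure.trans hWV) hvm hvC]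
  refine integral_congr_ae ?_
  filter_upwards [hH.ae_mem_frontier hW hxW] with y hy
  exact hve y (hWV (frontier_subset_closure hy))

end Perron

section HarmonicFunctions

variable {X : Type*} [TopologicalSpace X] [MeasurableSpace X] {𝒱 : Set (Set X)}
  {H : Set X → Kernel X X} {U P V : Set X} {h k : X → ℝ}

lemma IsHarmonicOn.mono {U' : Set X} (hh : IsHarmonicOn 𝒱 H h U) (hU' : U' ⊆ U) :
    IsHarmonicOn 𝒱 H h U' :=
  ⟨hh.1.mono hU', fun V hV hVU => hh.2 V hV (hVU.trans hU')⟩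

lemma IsHarmonicOn.congr (hH : IsNormalBauerFamily 𝒱 H) {h' : X → ℝ}
    (hh : IsHarmonicOn 𝒱 H h U) (heq : EqOn h' h U) : IsHarmonicOn 𝒱 H h' U := by
  refine ⟨hh.1.congr heq, fun V hV hVU x hx => ?_⟩
  rw [heq (hVU (subset_closure hx)), ← hh.2 V hV hVU x hx]
  refine integral_congr_ae ?_
  filter_upwards [hH.ae_mem_frontier hV hx] with y hy
  exact heq (hVU (frontier_subset_closure hy))

lemma IsHarmonicOn.const_mul (c : ℝ) (hh : IsHarmonicOn 𝒱 H h U) :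
    IsHarmonicOn 𝒱 H (fun x => c * h x) U := by
  refine ⟨hh.1.const_mul c, fun V hV hVU x hx => ?_⟩
  rw [integral_const_mul, hh.2 V hV hVU x hx]

lemma isHarmonicOn_const (hH : IsNormalBauerFamily 𝒱 H) (c : ℝ) :
    IsHarmonicOn 𝒱 H (fun _ => c) U := by
  refine ⟨continuousOn_const, fun V hV _ x _ => ?_⟩
  have := hH.isMarkovKernel hV
  simp

lemma isHarmonicOn_integral (hH : IsNormalBauerFamily 𝒱 H) (hV : V ∈ 𝒱) {f : X → ℝ}
    (hf : Measurable f) {C : ℝ} (hC : ∀ x, |f x| ≤ C) :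
    IsHarmonicOn 𝒱 H (fun x => ∫ y, f y ∂(H V x)) V :=
  ⟨hH.continuousOn_integral V hV f hf ⟨C, hC⟩,
    fun _ hW hWV x _ => hH.integral_integral hV hW (subset_closure.trans hWV) hf hC x⟩

lemma isHarmonicOn_measureReal (hH : IsNormalBauerFamily 𝒱 H) (hV : V ∈ 𝒱) {B : Set X}
    (hB : MeasurableSet B) : IsHarmonicOn 𝒱 H (fun y => (H V y).real B) V := by
  have hB1 : ∀ y, |B.indicator (1 : X → ℝ) y| ≤ 1 := fun y => by
    by_cases hy : y ∈ B <;> simp [hy]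
  simpa only [integral_indicator_one hB] using
    isHarmonicOn_integral hH hV (measurable_one.indicator hB) hB1

variable [OpensMeasurableSpace X] [T2Space X]

lemma IsNormalBauerFamily.integrable_of_continuousOn (hH : IsNormalBauerFamily 𝒱 H)
    (hV : V ∈ 𝒱) {x : X} (hx : x ∈ V) (hh : ContinuousOn h (closure V)) :
    Integrable h (H V x) := by
  have := hH.isMarkovKernel hV
  have hint : IntegrableOn h (closure V) (H V x) :=
    hh.integrableOn_compact (hH.isCompact_closure V hV)
  rwa [IntegrableOn, Measure.restrict_eq_self_of_ae_mem] at hint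
  filter_upwards [hH.ae_mem_frontier hV hx] with y hy using frontier_subset_closure hy

lemma IsHarmonicOn.add (hH : IsNormalBauerFamily 𝒱 H) (hh : IsHarmonicOn 𝒱 H h U)
    (hk : IsHarmonicOn 𝒱 H k U) : IsHarmonicOn 𝒱 H (fun x => h x + k x) U := by
  refine ⟨hh.1.add hk.1, fun V hV hVU x hx => ?_⟩
  rw [integral_add (hH.integrable_of_continuousOn hV hx (hh.1.mono hVU))
    (hH.integrable_of_continuousOn hV hx (hk.1.mono hVU)), hh.2 V hV hVU x hx, hk.2 V hV hVU x hx]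

lemma IsHarmonicOn.sub (hH : IsNormalBauerFamily 𝒱 H) (hh : IsHarmonicOn 𝒱 H h U)
    (hk : IsHarmonicOn 𝒱 H k U) : IsHarmonicOn 𝒱 H (fun x => h x - k x) U := by
  simpa [sub_eq_add_neg] using hh.add hH (hk.const_mul (-1))

variable [SecondCountableTopology X] [LocallyCompactSpace X]

lemma IsPSet.nonneg_of_isHarmonicOn (hH : IsNormalBauerFamily 𝒱 H) (hP : IsPSet 𝒱 H P)
    (hU : IsOpen U) (hUP : U ⊆ P) (hUc : IsCompact (closure U))
    (hc : ContinuousOn h (closure U)) (hh : IsHarmonicOn 𝒱 H h U)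
    (hfr : ∀ x ∈ frontier U, 0 ≤ h x) : ∀ x ∈ closure U, 0 ≤ h x := by
  refine hP.nonneg_of_frontier_nonneg hH hU hUP hUc hc.lowerSemicontinuousOn hfr fun x hx => ?_
  obtain ⟨W, hW, hxW, hWU⟩ := hH.exists_closure_subset (hU.mem_nhds hx)
  exact ⟨W, ⟨hW, hWU, hxW⟩, hH.integrable_of_continuousOn hW hxW
    (hc.mono (hWU.trans subset_closure)), (hh.2 W hW hWU x hxW).le⟩

lemma IsPSet.eqOn_of_isDirichletSolution (hH : IsNormalBauerFamily 𝒱 H) (hP : IsPSet 𝒱 H P)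
    (hU : IsOpen U) (hUP : U ⊆ P) (hUc : IsCompact (closure U)) {f h₁ h₂ : X → ℝ}
    (h1 : IsDirichletSolution 𝒱 H U f h₁) (h2 : IsDirichletSolution 𝒱 H U f h₂) :
    EqOn h₁ h₂ (closure U) := by
  intro x hx
  have hle : 0 ≤ h₁ x - h₂ x := hP.nonneg_of_isHarmonicOn hH hU hUP hUc (h1.1.sub h2.1)
    (h1.2.1.sub hH h2.2.1) (fun y hy => by simp [h1.2.2 hy, h2.2.2 hy]) x hx
  have hge : 0 ≤ h₂ x - h₁ x := hP.nonneg_of_isHarmonicOn hH hU hUP hUc (h2.1.sub h1.1)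
    (h2.2.1.sub hH h1.2.1) (fun y hy => by simp [h1.2.2 hy, h2.2.2 hy]) x hx
  exact le_antisymm (sub_nonneg.1 hge) (sub_nonneg.1 hle)

end HarmonicFunctions

section Barriers

lemma lowerSemicontinuous_piecewise {X : Type*} [TopologicalSpace X] {U : Set X}
    [∀ x, Decidable (x ∈ U)] (hU : IsOpen U) {f g : X → ℝ} (hf : ContinuousOn f U)
    (hg : LowerSemicontinuous g) (hfg : ∀ x ∉ U, ∀ t < g x, ∀ᶠ y in 𝓝[U] x, t < f y) :
    LowerSemicontinuous (U.piecewise f g) := by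
  intro x t ht
  by_cases hx : x ∈ U
  · rw [piecewise_eq_of_mem _ _ _ hx] at ht
    filter_upwards [(hf.continuousAt (hU.mem_nhds hx)).eventually (lt_mem_nhds ht),
      hU.mem_nhds hx] with y hy hyU
    rwa [piecewise_eq_of_mem _ _ _ hyU]
  · rw [piecewise_eq_of_notMem _ _ _ hx] at ht
    filter_upwards [hg x t ht, eventually_nhdsWithin_iff.1 (hfg x hx t ht)] with y hgy hfy
    by_cases hy : y ∈ U
    · simpa only [piecewise_eq_of_mem _ _ _ hy] using hfy hy
    · simpa only [piecewise_eq_of_notMem _ _ _ hy] using hgy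

variable {X : Type*} {U P V : Set X} {F s u w : X → ℝ} {C ε δ : ℝ} {x z : X}

open Classical in
/-- The function `min C s` on `U ∩ V`, extended by `C` to `U` and by the boundary data `F` to `X`:
the candidate for an element of the upper class on `U` built from a function `s` near a boundary
point. -/
def paste (U V : Set X) (F : X → ℝ) (C : ℝ) (s : X → ℝ) : X → ℝ :=
  (U ∩ V).piecewise (fun x => min C (s x)) (U.piecewise (fun _ => C) F)

lemma paste_of_mem (hx : x ∈ U ∩ V) : paste U V F C s x = min C (s x) := by
  classical exact piecewise_eq_of_mem _ _ _ hx

lemma paste_of_notMem_right (hx : x ∈ U) (hxV : x ∉ V) : paste U V F C s x = C := by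
  classical
  rw [paste, piecewise_eq_of_notMem _ _ _ (fun h => hxV h.2), piecewise_eq_of_mem _ _ _ hx]

lemma paste_of_notMem_left (hx : x ∉ U) : paste U V F C s x = F x := by
  classical
  rw [paste, piecewise_eq_of_notMem _ _ _ (fun h => hx h.1), piecewise_eq_of_notMem _ _ _ hx]

lemma abs_paste_le (hC : ∀ x, |F x| ≤ C) (hFs : ∀ x ∈ U ∩ V, F x ≤ s x) (x : X) :
    |paste U V F C s x| ≤ C := by
  have hF := abs_le.1 (hC x)
  by_cases hx : x ∈ U
  · by_cases hxV : x ∈ V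
    · rw [paste_of_mem ⟨hx, hxV⟩]
      exact abs_le.2 ⟨hF.1.trans (le_min hF.2 (hFs x ⟨hx, hxV⟩)), min_le_left _ _⟩
    · rw [paste_of_notMem_right hx hxV]
      exact (abs_of_nonneg ((abs_nonneg _).trans (hC x))).le
  · rw [paste_of_notMem_left hx]
    exact hC x

variable [TopologicalSpace X]

lemma lowerSemicontinuous_paste (hU : IsOpen U) (hV : IsOpen V) (hF : Continuous F)
    (hC : ∀ x, |F x| ≤ C) (hs : ContinuousOn s (U ∩ V)) (hFs : ∀ x ∈ U ∩ V, F x ≤ s x)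
    (hCs : ∀ x ∈ U \ V, ∀ᶠ y in 𝓝[U ∩ V] x, C ≤ s y) :
    LowerSemicontinuous (paste U V F C s) := by
  classical
  have hFC : ∀ x, F x ≤ C := fun x => (abs_le.1 (hC x)).2
  have hFev : ∀ x, ∀ t < F x, ∀ᶠ y in 𝓝 x, t < F y := fun x _ ht =>
    hF.continuousAt.eventually (lt_mem_nhds ht)
  refine lowerSemicontinuous_piecewise (hU.inter hV) ((continuousOn_const (c := C)).inf hs)
    (lowerSemicontinuous_piecewise hU continuousOn_const hF.lowerSemicontinuous
      fun x _ t ht => Eventually.of_forall fun _ => ht.trans_le (hFC x)) fun x hx t ht => ?_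
  by_cases hxU : x ∈ U
  · rw [piecewise_eq_of_mem _ _ _ hxU] at ht
    filter_upwards [hCs x ⟨hxU, fun h => hx ⟨hxU, h⟩⟩] with y hy using lt_min ht (ht.trans_le hy)
  · rw [piecewise_eq_of_notMem _ _ _ hxU] at ht
    filter_upwards [nhdsWithin_le_nhds (hFev x t ht), self_mem_nhdsWithin] with y hy hyUV
    exact hy.trans_le (le_min (hFC y) (hFs y hyUV))

variable [MeasurableSpace X] {𝒱 : Set (Set X)} {H : Set X → Kernel X X} [T2Space X]
  [LocallyCompactSpace X] [SecondCountableTopology X] [BorelSpace X]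

lemma isUpper_paste (hH : IsNormalBauerFamily 𝒱 H) (hP : IsPSet 𝒱 H P) (hU : IsOpen U)
    (hUP : U ⊆ P) (hV : IsOpen V) (hF : Continuous F) (hC : ∀ x, |F x| ≤ C)
    (hs : IsHarmonicOn 𝒱 H s (U ∩ V)) (hFs : ∀ x ∈ U ∩ V, F x ≤ s x)
    (hCs : ∀ x ∈ U \ V, ∀ᶠ y in 𝓝[U ∩ V] x, C ≤ s y) :
    IsUpper 𝒱 H U F C (paste U V F C s) := by
  have hlsc := lowerSemicontinuous_paste hU hV hF hC hs.1 hFs hCs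
  have hab := abs_paste_le (V := V) hC hFs
  have hle : ∀ W ∈ 𝒱, ∀ x, ∫ y, paste U V F C s y ∂(H W x) ≤ C := fun W hW x => by
    have := hH.isMarkovKernel hW
    exact (abs_le.1 (abs_integral_le_of_abs_le hab)).2
  refine ⟨hlsc, hab, fun x => paste_of_notMem_left, fun V' hV' hV'U =>
    hP.integral_le_of_locallySuperharmonicAt hH hV' ((subset_closure.trans hV'U).trans hUP) hlsc hab
      fun x hx => ?_⟩
  have hxU : x ∈ U := hV'U (subset_closure hx)
  by_cases hxV : x ∈ V
  · refine hH.locallySuperharmonicAt_of_forall_subset ((hU.inter hV).mem_nhds ⟨hxU, hxV⟩)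
      fun W hW hWUV hxW => ?_
    have := hH.isMarkovKernel hW
    rw [paste_of_mem ⟨hxU, hxV⟩]
    refine le_min (hle W hW x) ?_
    rw [← hs.2 W hW hWUV x hxW]
    refine integral_mono_ae (integrable_of_measurable_of_abs_le hlsc.measurable hab)
      (hH.integrable_of_continuousOn hW hxW (hs.1.mono hWUV)) ?_
    filter_upwards [hH.ae_mem_frontier hW hxW] with y hy
    rw [paste_of_mem (hWUV (frontier_subset_closure hy))]
    exact min_le_right _ _
  · refine hH.locallySuperharmonicAt_of_forall_subset univ_mem fun W hW _ _ => ?_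
    rw [paste_of_notMem_right hxU hxV]
    exact hle W hW x

lemma exists_isUpper (hH : IsNormalBauerFamily 𝒱 H) (hP : IsPSet 𝒱 H P) (hU : IsOpen U)
    (hUP : U ⊆ P) (hF : Continuous F) (hC : ∀ x, |F x| ≤ C) : ∃ u, IsUpper 𝒱 H U F C u :=
  ⟨_, isUpper_paste (V := ∅) hH hP hU hUP isOpen_empty hF hC (isHarmonicOn_const hH C)
    (fun x _ => (abs_le.1 (hC x)).2) fun _ _ => Eventually.of_forall fun _ => le_rfl⟩

lemma tendsto_real_of_mem_nhdsWithin_frontier (hH : IsNormalBauerFamily 𝒱 H) (hV : V ∈ 𝒱)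
    (hx : x ∉ V) {B : Set X} (hBm : MeasurableSet B) (hB : B ∈ 𝓝[frontier V] x) :
    Tendsto (fun y => (H V y).real B) (𝓝[V] x) (𝓝 1) := by
  have := hH.isMarkovKernel hV
  obtain ⟨O, hO, hxO, hOB⟩ := mem_nhdsWithin.1 hB
  obtain ⟨φ, hφ0, hφ1, hφ01⟩ := exists_continuous_zero_one_of_isClosed hO.isClosed_compl
    (isClosed_singleton (x := x)) (by simpa using hxO)
  have hlim : Tendsto (fun y => ∫ t, φ t ∂(H V y)) (𝓝[V] x) (𝓝 1) := by
    have h := ((hH.continuous_integral V hV φ φ.continuous).tendsto x).mono_left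
      (nhdsWithin_le_nhds (s := V))
    rwa [hH.integral_eq_of_notMem hV hx, hφ1 rfl] at h
  refine tendsto_of_tendsto_of_tendsto_of_le_of_le' hlim tendsto_const_nhds ?_
    (Eventually.of_forall fun _ => measureReal_le_one)
  filter_upwards [self_mem_nhdsWithin] with y hy
  rw [← integral_indicator_one hBm]
  refine integral_mono_ae (integrable_of_measurable_of_abs_le φ.continuous.measurable (C := 1)
    fun t => abs_le.2 ⟨by linarith [(hφ01 t).1], (hφ01 t).2⟩)
    ((integrable_const 1).indicator hBm) ?_
  filter_upwards [hH.ae_mem_frontier hV hy] with t ht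
  by_cases htB : t ∈ B
  · exact (hφ01 t).2.trans_eq (indicator_of_mem htB (1 : X → ℝ)).symm
  · exact (hφ0 fun htO => htB (hOB ⟨htO, ht⟩)).trans_le (indicator_of_notMem htB _).ge

/-- A multiple of the barrier `w` is large on a compact part `L` of `U ∩ ∂V`; the harmonic measure
of the remaining part `B`, whose mass at `z` is small, takes care of the rest of `U ∩ ∂V`. -/
lemma exists_isHarmonicOn_one_le (hH : IsNormalBauerFamily 𝒱 H) (hU : IsOpen U) (hV : V ∈ 𝒱)
    (hz : z ∈ V) (hw : IsHarmonicOn 𝒱 H w U) (hwpos : ∀ x ∈ U, 0 < w x)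
    (hwlim : Tendsto w (𝓝[U] z) (𝓝 0)) (hδ : 0 < δ) :
    ∃ p, IsHarmonicOn 𝒱 H p (U ∩ V) ∧ (∀ x ∈ U, 0 ≤ p x) ∧ (∀ᶠ x in 𝓝[U] z, p x < δ) ∧
      ∀ x ∈ U \ V, ∀ᶠ y in 𝓝[U ∩ V] x, 1 ≤ p y := by
  have := hH.isMarkovKernel hV
  have hm : MeasurableSet (frontier V ∩ U) := isClosed_frontier.measurableSet.inter hU.measurableSet
  obtain ⟨L, hLsub, hL, hLlt⟩ := hm.exists_isCompact_sdiff_lt (μ := H V z) (measure_ne_top _ _)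
    (ε := ENNReal.ofReal (δ / 4)) (by simpa using hδ)
  obtain ⟨c, hc0, hcL⟩ := hL.exists_forall_le' (hw.1.mono (hLsub.trans inter_subset_right))
    (a := 0) fun y hy => hwpos y (hLsub hy).2
  set B := (frontier V ∩ U) \ L
  have hBm : MeasurableSet B := hm.diff hL.measurableSet
  have hb : IsHarmonicOn 𝒱 H (fun y => (H V y).real B) V := isHarmonicOn_measureReal hH hV hBm
  have hwc : ∀ x ∈ U, 0 ≤ c⁻¹ * w x := fun x hx =>
    mul_nonneg (inv_nonneg.2 hc0.le) (hwpos x hx).le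
  refine ⟨fun y => 2 * (c⁻¹ * w y + (H V y).real B),
    (((hw.mono inter_subset_left).const_mul _).add hH (hb.mono inter_subset_right)).const_mul 2,
    fun x hx => mul_nonneg zero_le_two (add_nonneg (hwc x hx) measureReal_nonneg), ?_, ?_⟩
  · have hbz : (H V z).real B < δ / 4 := ENNReal.toReal_lt_of_lt_ofReal hLlt
    have hbnear := (hb.1.continuousAt ((hH.isOpen hV).mem_nhds hz)).eventually (gt_mem_nhds hbz)
    have hwnear := (hwlim.const_mul c⁻¹).eventually
      (gt_mem_nhds (show c⁻¹ * 0 < δ / 4 by simpa using hδ))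
    filter_upwards [hwnear, nhdsWithin_le_nhds hbnear] with y hwy hby
    linarith
  · rintro x ⟨hxU, hxV⟩
    by_cases hxL : x ∈ L
    · have hgt : 1 < 2 * (c⁻¹ * w x) := by
        have := (one_le_div hc0).2 (hcL x hxL)
        rw [div_eq_inv_mul] at this
        linarith
      filter_upwards [nhdsWithin_le_nhds (((hw.1.continuousAt (hU.mem_nhds hxU)).const_mul
        c⁻¹).const_mul 2 |>.eventually (lt_mem_nhds hgt))] with y hy
      linarith [measureReal_nonneg (μ := H V y) (s := B)]
    · have hB : B ∈ 𝓝[frontier V] x := by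
        filter_upwards [nhdsWithin_le_nhds ((hU.sdiff hL.isClosed).mem_nhds ⟨hxU, hxL⟩),
          self_mem_nhdsWithin] with y hy hyV using ⟨⟨hyV, hy.1⟩, hy.2⟩
      have hlim := tendsto_real_of_mem_nhdsWithin_frontier hH hV hxV hBm hB
      filter_upwards [nhdsWithin_mono x inter_subset_right (hlim.eventually
        (lt_mem_nhds (show (1 / 2 : ℝ) < 1 by norm_num))), self_mem_nhdsWithin] with y hy hyUV
      linarith [hwc y hyUV.1]

lemma exists_isUpper_le_of_barrier (hH : IsNormalBauerFamily 𝒱 H) (hP : IsPSet 𝒱 H P)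
    (hU : IsOpen U) (hUP : U ⊆ P) (hF : Continuous F) (hC : ∀ x, |F x| ≤ C)
    (hw : IsHarmonicOn 𝒱 H w U) (hwpos : ∀ x ∈ U, 0 < w x)
    (hwlim : Tendsto w (𝓝[U] z) (𝓝 0)) (hε : 0 < ε) :
    ∃ u, IsUpper 𝒱 H U F C u ∧ ∀ᶠ x in 𝓝[U] z, u x ≤ F z + ε := by
  have hC0 : 0 ≤ C := (abs_nonneg _).trans (hC z)
  obtain ⟨V, hV, hzV, hVF⟩ := hH.exists_closure_subset (x := z) (N := {y | F y < F z + ε / 2})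
    (hF.continuousAt.eventually (gt_mem_nhds (by linarith)))
  obtain ⟨p, hp, hp0, hpz, hp1⟩ := exists_isHarmonicOn_one_le hH hU hV hzV hw hwpos hwlim
    (δ := ε / (4 * (C + 1))) (by positivity)
  have hCp : ∀ x ∈ U, 0 ≤ 2 * C * p x := fun x hx => mul_nonneg (by positivity) (hp0 x hx)
  refine ⟨_, isUpper_paste hH hP hU hUP (hH.isOpen hV) hF hC
    (s := fun x => F z + ε / 2 + 2 * C * p x)
    ((isHarmonicOn_const hH _).add hH (hp.const_mul (2 * C))) (fun x hx => ?_) (fun x hx => ?_), ?_⟩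
  · exact (hVF (subset_closure hx.2)).le.trans (le_add_of_nonneg_right (hCp x hx.1))
  · filter_upwards [hp1 x hx] with y hy
    have := mul_le_mul_of_nonneg_left hy hC0
    linarith [(abs_le.1 (hC z)).1]
  · filter_upwards [hpz, nhdsWithin_le_nhds ((hH.isOpen hV).mem_nhds hzV), self_mem_nhdsWithin]
      with y hy hyV hyU
    rw [paste_of_mem ⟨hyU, hyV⟩]
    rw [lt_div_iff₀ (by positivity)] at hy
    refine (min_le_right _ _).trans ?_
    linarith [hp0 y hyU]

end Barriers

section Regular

variable {X : Type*} [TopologicalSpace X] [MeasurableSpace X] {𝒱 : Set (Set X)}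
  {H : Set X → Kernel X X} {U P : Set X} {F u v : X → ℝ} {C : ℝ}

/-- `U` has a barrier at every boundary point. -/
def HasBarriers (𝒱 : Set (Set X)) (H : Set X → Kernel X X) (U : Set X) : Prop :=
  ∀ z ∈ frontier U, ∃ w : X → ℝ, IsHarmonicOn 𝒱 H w U ∧ (∀ x ∈ U, 0 < w x) ∧
    Tendsto w (𝓝[U] z) (𝓝 0)

lemma exists_continuous_eqOn_of_isCompact {Y : Type*} [TopologicalSpace Y] [T2Space Y]
    [NormalSpace Y] {s : Set Y} (hs : IsCompact s) {f : Y → ℝ} (hf : ContinuousOn f s) :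
    ∃ (F : Y → ℝ) (C : ℝ), Continuous F ∧ (∀ x, |F x| ≤ C) ∧ EqOn F f s := by
  obtain ⟨C, hC⟩ := hs.exists_bound_of_continuousOn hf
  obtain ⟨g, hg, hgf⟩ := ContinuousMap.exists_restrict_eq_forall_mem_of_closed (s := s)
    ⟨s.domRestrict f, hf.domRestrict⟩ (t := Icc (-|C|) |C|)
    (fun x => abs_le.1 ((hC x x.2).trans (le_abs_self C))) ⟨0, by simp⟩ hs.isClosed
  exact ⟨g, |C|, g.continuous, fun x => abs_le.2 (hg x), fun x hx =>
    congrArg (fun k : C(s, ℝ) => k ⟨x, hx⟩) hgf⟩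

variable [T2Space X] [LocallyCompactSpace X] [SecondCountableTopology X] [BorelSpace X]

lemma IsUpper.neg_le (hH : IsNormalBauerFamily 𝒱 H) (hP : IsPSet 𝒱 H P) (hU : IsOpen U)
    (hUP : U ⊆ P) (hUc : IsCompact (closure U)) (hu : IsUpper 𝒱 H U (-F) C u)
    (hv : IsUpper 𝒱 H U F C v) {x : X} (hx : x ∈ U) : -u x ≤ v x := by
  rw [neg_le_iff_add_nonneg']
  refine hP.nonneg_of_frontier_nonneg hH hU hUP hUc (v := fun y => u y + v y)
    ((hu.lsc.add hv.lsc).lowerSemicontinuousOn _) (fun y hy => ?_) (fun y hy => ?_) x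
    (subset_closure hx)
  · rw [hU.frontier_eq] at hy
    simp [hu.eq_of_notMem y hy.2, hv.eq_of_notMem y hy.2]
  · obtain ⟨W, hW, hyW, hWU⟩ := hH.exists_closure_subset (hU.mem_nhds hy)
    have := hH.isMarkovKernel hW
    have iu : Integrable u (H W y) := integrable_of_measurable_of_abs_le hu.lsc.measurable hu.abs_le
    have iv : Integrable v (H W y) := integrable_of_measurable_of_abs_le hv.lsc.measurable hv.abs_le
    refine ⟨W, ⟨hW, hWU, hyW⟩, iu.add iv, ?_⟩
    rw [integral_add iu iv]
    exact add_le_add (hu.integral_le W hW hWU y) (hv.integral_le W hW hWU y)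

lemma tendsto_perron_of_mem_frontier (hH : IsNormalBauerFamily 𝒱 H) (hP : IsPSet 𝒱 H P)
    (hU : IsOpen U) (hUP : U ⊆ P) (hUc : IsCompact (closure U)) (hbar : HasBarriers 𝒱 H U)
    (hF : Continuous F) (hC : ∀ x, |F x| ≤ C) {z : X} (hz : z ∈ frontier U) :
    Tendsto (perron 𝒱 H U F C) (𝓝[U] z) (𝓝 (F z)) := by
  obtain ⟨w, hw, hwpos, hwlim⟩ := hbar z hz
  refine tendsto_order.2 ⟨fun t ht => ?_, fun t ht => ?_⟩
  · obtain ⟨u, hu, hule⟩ := exists_isUpper_le_of_barrier hH hP hU hUP hF.neg (C := C)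
      (by simpa using hC) hw hwpos hwlim (ε := (F z - t) / 2) (by linarith)
    filter_upwards [hule, self_mem_nhdsWithin] with y hy hyU
    have hle : -u y ≤ perron 𝒱 H U F C y := le_perron (exists_isUpper hH hP hU hUP hF hC)
      fun v hv => IsUpper.neg_le hH hP hU hUP hUc hu hv hyU
    simp only [Pi.neg_apply] at hy
    linarith
  · obtain ⟨u, hu, hule⟩ := exists_isUpper_le_of_barrier hH hP hU hUP hF hC hw hwpos hwlim
      (ε := (t - F z) / 2) (by linarith)
    filter_upwards [hule] with y hy
    linarith [perron_le hu y]

lemma continuous_perron (hH : IsNormalBauerFamily 𝒱 H) (hP : IsPSet 𝒱 H P)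
    (hU : IsOpen U) (hUP : U ⊆ P) (hUc : IsCompact (closure U)) (hbar : HasBarriers 𝒱 H U)
    (hF : Continuous F) (hC : ∀ x, |F x| ≤ C) : Continuous (perron 𝒱 H U F C) := by
  have hne := exists_isUpper hH hP hU hUP hF hC
  rw [continuous_iff_continuousAt]
  intro x
  by_cases hx : x ∈ U
  · exact (continuousOn_perron hH hP hU hUP hne).continuousAt (hU.mem_nhds hx)
  rw [ContinuousAt, perron_of_notMem hne hx, ← nhdsWithin_univ, ← union_compl_self U,
    nhdsWithin_union, tendsto_sup]
  constructor
  · by_cases hxcl : x ∈ closure U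
    · exact tendsto_perron_of_mem_frontier hH hP hU hUP hUc hbar hF hC
        (hU.frontier_eq ▸ ⟨hxcl, hx⟩)
    · rw [mem_closure_iff_nhdsWithin_neBot, not_neBot] at hxcl
      rw [hxcl]
      exact tendsto_bot
  · refine (hF.continuousAt.tendsto.mono_left nhdsWithin_le_nhds).congr' ?_
    filter_upwards [self_mem_nhdsWithin] with y hy
    exact (perron_of_notMem hne hy).symm

theorem IsPSet.isRegular (hH : IsNormalBauerFamily 𝒱 H) (hP : IsPSet 𝒱 H P)
    (hU : IsOpen U) (hUP : U ⊆ P) (hUc : IsCompact (closure U)) (hbar : HasBarriers 𝒱 H U) :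
    IsRegular 𝒱 H U := by
  refine ⟨hU, hUc, fun f hf => ⟨?_, fun h₁ h₂ => hP.eqOn_of_isDirichletSolution hH hU hUP hUc,
    fun hpos h hh => hP.nonneg_of_isHarmonicOn hH hU hUP hUc hh.1 hh.2.1
      fun z hz => (hpos z hz).trans_eq (hh.2.2 hz).symm⟩⟩
  obtain ⟨F, C, hF, hC, hFf⟩ := exists_continuous_eqOn_of_isCompact
    (hUc.of_isClosed_subset isClosed_frontier frontier_subset_closure) hf
  have hne := exists_isUpper hH hP hU hUP hF hC
  have hcont := continuous_perron hH hP hU hUP hUc hbar hF hC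
  refine ⟨perron 𝒱 H U F C, hcont.continuousOn, ⟨hcont.continuousOn, fun V hV hVU x _ => ?_⟩,
    fun x hx => ?_⟩
  · exact hP.integral_eq_of_locallyHarmonicAt hH hV ((subset_closure.trans hVU).trans hUP) hcont
      (abs_perron_le hne) (fun y hy => locallyHarmonicAt_perron hH hP hU hUP hne
        (hVU (subset_closure hy))) x
  · rw [hU.frontier_eq] at hx
    rw [perron_of_notMem hne hx.2, hFf (hU.frontier_eq ▸ hx)]

end Regular

section HarmonicMeasures

open scoped CompactlySupported NNReal

variable {X : Type*} [TopologicalSpace X] [MeasurableSpace X] {𝒱 : Set (Set X)}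
  {H : Set X → Kernel X X} {U : Set X} {f f' h h' : X → ℝ}

namespace IsDirichletSolution

lemma const_mul (c : ℝ) (hh : IsDirichletSolution 𝒱 H U f h) :
    IsDirichletSolution 𝒱 H U (fun x => c * f x) fun x => c * h x :=
  ⟨hh.1.const_mul c, hh.2.1.const_mul c, fun x hx => by simp only [hh.2.2 hx]⟩

lemma congr (hh : IsDirichletSolution 𝒱 H U f h) (hf : EqOn f f' (frontier U)) :
    IsDirichletSolution 𝒱 H U f' h :=
  ⟨hh.1, hh.2.1, hh.2.2.trans hf⟩

lemma congr_left (hH : IsNormalBauerFamily 𝒱 H) (hh : IsDirichletSolution 𝒱 H U f h)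
    (hh' : EqOn h' h (closure U)) : IsDirichletSolution 𝒱 H U f h' :=
  ⟨hh.1.congr hh', hh.2.1.congr hH (hh'.mono subset_closure),
    fun _ hx => (hh' (frontier_subset_closure hx)).trans (hh.2.2 hx)⟩

lemma add [OpensMeasurableSpace X] [T2Space X] (hH : IsNormalBauerFamily 𝒱 H)
    (hh : IsDirichletSolution 𝒱 H U f h) (hh' : IsDirichletSolution 𝒱 H U f' h') :
    IsDirichletSolution 𝒱 H U (fun x => f x + f' x) fun x => h x + h' x :=
  ⟨hh.1.add hh'.1, hh.2.1.add hH hh'.2.1, fun x hx => by simp only [hh.2.2 hx, hh'.2.2 hx]⟩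

end IsDirichletSolution

lemma isDirichletSolution_const (hH : IsNormalBauerFamily 𝒱 H) (c : ℝ) :
    IsDirichletSolution 𝒱 H U (fun _ => c) fun _ => c :=
  ⟨continuousOn_const, isHarmonicOn_const hH c, fun _ _ => rfl⟩

lemma IsRegular.exists_positiveLinearMap [OpensMeasurableSpace X] [T2Space X]
    (hH : IsNormalBauerFamily 𝒱 H) (hU : IsRegular 𝒱 H U) {x : X} (hx : x ∈ U) :
    ∃ Λ : C_c(X, ℝ) →ₚ[ℝ] ℝ, ∀ (f : C_c(X, ℝ)) (f' h : X → ℝ), EqOn f' f (frontier U) →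
      IsDirichletSolution 𝒱 H U f' h → Λ f = h x := by
  have hreg := hU.2.2
  choose sol hsol using fun f : C_c(X, ℝ) => (hreg f f.continuous.continuousOn).1
  have huniq : ∀ (f : C_c(X, ℝ)) (f' h : X → ℝ), EqOn f' f (frontier U) →
      IsDirichletSolution 𝒱 H U f' h → sol f x = h x := fun f f' h hff' hh =>
    (hreg f f.continuous.continuousOn).2.1 _ _ (hsol f) (hh.congr hff') (subset_closure hx)
  exact ⟨PositiveLinearMap.mk₀
    { toFun := fun f => sol f x
      map_add' := fun f g => huniq (f + g) (fun y => f y + g y) _ (fun y _ => by simp)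
        ((hsol f).add hH (hsol g))
      map_smul' := fun c f => huniq (c • f) (fun y => c * f y) _ (fun y _ => by simp)
        ((hsol f).const_mul c) }
    fun f hf => (hreg f f.continuous.continuousOn).2.2 (fun z _ => hf z) _ (hsol f) x
      (subset_closure hx), huniq⟩

lemma rieszMeasure_compl_eq_zero {Y : Type*} [TopologicalSpace Y] [T2Space Y]
    [LocallyCompactSpace Y] [MeasurableSpace Y] [BorelSpace Y] (Λ : C_c(Y, ℝ) →ₚ[ℝ] ℝ) {Z : Set Y}
    (hZ : IsClosed Z) (hΛ : ∀ f : C_c(Y, ℝ), EqOn f 0 Z → Λ f = 0) :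
    RealRMK.rieszMeasure Λ Zᶜ = 0 := by
  rw [hZ.isOpen_compl.measure_eq_iSup_isCompact]
  simp only [ENNReal.iSup_eq_zero]
  intro L hL hLc
  obtain ⟨f, hf1, hf0, hfc, hf01⟩ := exists_continuous_one_zero_of_isCompact hLc hZ
    (disjoint_left.2 fun _ hy => hL hy)
  have hle := RealRMK.rieszMeasure_le_of_eq_one Λ (f := ⟨f, hfc⟩) (fun y => (hf01 y).1) hLc
    fun _ hy => hf1 hy
  simpa [hΛ ⟨f, hfc⟩ fun _ hy => hf0 hy] using hle

variable [BorelSpace X]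

lemma IsRegular.exists_isProbabilityMeasure [T2Space X] [LocallyCompactSpace X]
    (hH : IsNormalBauerFamily 𝒱 H) (hU : IsRegular 𝒱 H U) {x : X} (hx : x ∈ U) :
    ∃ μ : Measure X, IsProbabilityMeasure μ ∧ μ (frontier U)ᶜ = 0 ∧
      ∀ f h : X → ℝ, Continuous f → IsDirichletSolution 𝒱 H U f h → ∫ y, f y ∂μ = h x := by
  obtain ⟨Λ, hΛ⟩ := hU.exists_positiveLinearMap hH hx
  set μ := RealRMK.rieszMeasure Λ
  have hfr : μ (frontier U)ᶜ = 0 := rieszMeasure_compl_eq_zero Λ isClosed_frontier fun f hf =>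
    hΛ f 0 0 hf.symm (isDirichletSolution_const hH 0)
  have hfrc : IsCompact (frontier U) :=
    hU.2.1.of_isClosed_subset isClosed_frontier frontier_subset_closure
  have hfin : IsFiniteMeasure μ := by
    refine ⟨?_⟩
    rw [← measure_add_measure_compl (isClosed_frontier (s := U)).measurableSet, hfr, add_zero]
    exact hfrc.measure_lt_top
  have hintg : ∀ f h : X → ℝ, Continuous f → IsDirichletSolution 𝒱 H U f h →
      ∫ y, f y ∂μ = h x := by
    intro f h hf hh
    obtain ⟨φ, hφ1, -, hφc, -⟩ := exists_continuous_one_zero_of_isCompact hfrc isClosed_empty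
      (disjoint_empty _)
    let fc : C_c(X, ℝ) := ⟨⟨fun y => f y * φ y, hf.mul φ.continuous⟩, hφc.mul_left⟩
    have hfc : EqOn f fc (frontier U) := fun y hy => by
      change f y = f y * φ y
      rw [hφ1 hy, Pi.one_apply, mul_one]
    rw [← hΛ fc f h hfc hh, ← RealRMK.integral_rieszMeasure]
    refine integral_congr_ae ?_
    have hae : ∀ᵐ y ∂μ, y ∈ frontier U := hfr
    filter_upwards [hae] with y hy using hfc hy
  refine ⟨μ, ⟨?_⟩, hfr, hintg⟩
  have huniv := hintg (fun _ => 1) (fun _ => 1) continuous_const (isDirichletSolution_const hH 1)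
  simp only [integral_const, smul_eq_mul, mul_one, Measure.real] at huniv
  rw [← ENNReal.ofReal_toReal (measure_ne_top μ univ), huniv, ENNReal.ofReal_one]

lemma measurable_of_measurable_integral {Y : Type*} [MeasurableSpace Y] [HasOuterApproxClosed X]
    {T : Y → Measure X} (hT : ∀ y, IsProbabilityMeasure (T y))
    (hm : ∀ f : X → ℝ, Continuous f → Measurable fun y => ∫ x, f x ∂(T y)) : Measurable T := by
  refine Measurable.measure_of_isPiSystem_of_isProbabilityMeasure
    (BorelSpace.measurable_eq.trans borel_eq_generateFrom_isClosed) isPiSystem_isClosed ?_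
  intro Z hZ
  replace hZ : IsClosed Z := hZ
  refine measurable_of_tendsto_metrizable (f := fun n y => ∫⁻ x, (hZ.apprSeq n x : ℝ≥0∞) ∂(T y))
    (fun n => ?_) (tendsto_pi_nhds.2 fun y =>
      HasOuterApproxClosed.tendsto_lintegral_apprSeq hZ (T y))
  have hc : Continuous fun x => (hZ.apprSeq n x : ℝ) := by fun_prop
  have hreal : (fun y => ∫⁻ x, (hZ.apprSeq n x : ℝ≥0∞) ∂(T y)) =
      fun y => ENNReal.ofReal (∫ x, (hZ.apprSeq n x : ℝ) ∂(T y)) := by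
    ext y
    rw [ofReal_integral_eq_lintegral_ofReal]
    · simp
    · exact integrable_of_measurable_of_abs_le (C := 1) hc.measurable fun x => by
        simpa using HasOuterApproxClosed.apprSeq_apply_le_one hZ n x
    · exact ae_of_all _ fun x => by simp
  rw [hreal]
  exact (hm _ hc).ennreal_ofReal

namespace IsRegular

variable [T2Space X] [LocallyCompactSpace X] [SecondCountableTopology X]

theorem exists_isHarmonicKernel (hH : IsNormalBauerFamily 𝒱 H) (hU : IsRegular 𝒱 H U) :
    ∃ T, IsHarmonicKernel 𝒱 H U T := by
  classical
  choose μ hμ hμU hμint using fun x : U => hU.exists_isProbabilityMeasure hH x.2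
  let T : X → Measure X := fun x => if hx : x ∈ U then μ ⟨x, hx⟩ else Measure.dirac x
  have hTU : ∀ x (hx : x ∈ U), T x = μ ⟨x, hx⟩ := fun x hx => dif_pos hx
  have hTd : ∀ x ∉ U, T x = Measure.dirac x := fun x hx => dif_neg hx
  have hTp : ∀ x, IsProbabilityMeasure (T x) := fun x => by
    by_cases hx : x ∈ U
    · exact hTU x hx ▸ hμ _
    · exact hTd x hx ▸ inferInstance
  have hTint : ∀ f h : X → ℝ, Continuous f → IsDirichletSolution 𝒱 H U f h →
      (fun x => ∫ y, f y ∂(T x)) = U.piecewise h f := by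
    intro f h hf hh
    ext x
    by_cases hx : x ∈ U
    · rw [piecewise_eq_of_mem _ _ _ hx, hTU x hx, hμint ⟨x, hx⟩ f h hf hh]
    · rw [piecewise_eq_of_notMem _ _ _ hx, hTd x hx, integral_dirac]
  have hm : Measurable T := by
    refine measurable_of_measurable_integral hTp fun f hf => ?_
    obtain ⟨h, hh⟩ := (hU.2.2 f hf.continuousOn).1
    rw [hTint f h hf hh]
    exact hh.2.1.1.measurable_piecewise hf.continuousOn hU.1.measurableSet
  refine ⟨⟨T, hm⟩, ⟨fun x hx => (congrArg (· (frontier U)ᶜ) (hTU x hx)).trans (hμU _), hTd⟩,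
    fun f hf => ?_⟩
  obtain ⟨h, hh⟩ := (hU.2.2 f hf.continuousOn).1
  refine hh.congr_left hH fun x hx => (congrFun (hTint f h hf hh) x).trans ?_
  by_cases hxU : x ∈ U
  · rw [piecewise_eq_of_mem _ _ _ hxU]
  · rw [piecewise_eq_of_notMem _ _ _ hxU, hh.2.2 (hU.1.frontier_eq ▸ ⟨hx, hxU⟩)]

lemma isHarmonicKernel_harmonicKernel (hH : IsNormalBauerFamily 𝒱 H)
    (hU : IsRegular 𝒱 H U) : IsHarmonicKernel 𝒱 H U (harmonicKernel 𝒱 H U) := by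
  have hex := hU.exists_isHarmonicKernel hH
  rw [harmonicKernel, dif_pos hex]
  exact hex.choose_spec

end IsRegular

end HarmonicMeasures

lemma kernel_ext_of_integral_eq {X Y : Type*} [TopologicalSpace X] [MeasurableSpace X]
    [BorelSpace X] [HasOuterApproxClosed X] [MeasurableSpace Y] {κ η : Kernel Y X}
    [IsMarkovKernel κ] [IsMarkovKernel η]
    (h : ∀ (f : X → ℝ) (C : ℝ), Continuous f → (∀ x, |f x| ≤ C) →
      ∀ x, ∫ y, f y ∂(κ x) = ∫ y, f y ∂(η x)) : κ = η := by
  ext1 x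
  refine ext_of_forall_integral_eq_of_IsFiniteMeasure fun f => ?_
  exact h f ‖f‖ f.continuous (fun x => f.norm_coe_le_norm x) x

section HarmonicKernel

variable {X : Type*} [TopologicalSpace X] [T2Space X] [LocallyCompactSpace X]
  [SecondCountableTopology X] [MeasurableSpace X] [BorelSpace X]
  {𝒱 : Set (Set X)} {H : Set X → Kernel X X} {U U' P : Set X}

namespace IsRegular

lemma integral_eq (hH : IsNormalBauerFamily 𝒱 H) (hU : IsRegular 𝒱 H U) {f h : X → ℝ}
    (hf : Continuous f) (hh : IsDirichletSolution 𝒱 H U f h) {x : X} (hx : x ∈ closure U) :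
    ∫ y, f y ∂(harmonicKernel 𝒱 H U x) = h x :=
  (hU.2.2 f hf.continuousOn).2.1 _ _
    ((hU.isHarmonicKernel_harmonicKernel hH).2 f hf) hh hx

lemma eq_dirac (hH : IsNormalBauerFamily 𝒱 H) (hU : IsRegular 𝒱 H U) {x : X}
    (hx : x ∉ U) : harmonicKernel 𝒱 H U x = Measure.dirac x :=
  (hU.isHarmonicKernel_harmonicKernel hH).1.2 x hx

lemma ae_mem_frontier (hH : IsNormalBauerFamily 𝒱 H) (hU : IsRegular 𝒱 H U) {x : X}
    (hx : x ∈ U) : ∀ᵐ y ∂(harmonicKernel 𝒱 H U x), y ∈ frontier U :=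
  (hU.isHarmonicKernel_harmonicKernel hH).1.1 x hx

lemma isMarkovKernel (hH : IsNormalBauerFamily 𝒱 H) (hU : IsRegular 𝒱 H U) :
    IsMarkovKernel (harmonicKernel 𝒱 H U) := by
  refine ⟨fun x => ?_⟩
  by_cases hx : x ∈ U
  · have h1 := hU.integral_eq hH (f := fun _ => 1) (h := fun _ => 1) continuous_const
      (isDirichletSolution_const hH 1) (subset_closure hx)
    simp only [integral_const, smul_eq_mul, mul_one] at h1
    exact isProbabilityMeasure_iff_real.2 h1
  · rw [hU.eq_dirac hH hx]
    infer_instance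

lemma continuous_integral (hH : IsNormalBauerFamily 𝒱 H) (hU : IsRegular 𝒱 H U)
    {f : X → ℝ} (hf : Continuous f) : Continuous fun x => ∫ y, f y ∂(harmonicKernel 𝒱 H U x) := by
  have h1 := ((hU.isHarmonicKernel_harmonicKernel hH).2 f hf).1
  have h2 : ContinuousOn (fun x => ∫ y, f y ∂(harmonicKernel 𝒱 H U x)) Uᶜ := by
    refine hf.continuousOn.congr fun x hx => ?_
    simp only [hU.eq_dirac hH hx, integral_dirac]
  have h3 := h1.union_of_isClosed h2 isClosed_closure hU.1.isClosed_compl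
  have huniv : closure U ∪ Uᶜ = univ :=
    eq_univ_of_forall fun x => (em (x ∈ U)).imp (fun h => subset_closure h) id
  rwa [huniv, continuousOn_univ] at h3

lemma comp_kernel_eq (hH : IsNormalBauerFamily 𝒱 H) (hP : IsPSet 𝒱 H P) (hUP : U ⊆ P)
    (hU : IsRegular 𝒱 H U) {V : Set X} (hV : V ∈ 𝒱) (hVU : V ⊆ U) :
    harmonicKernel 𝒱 H U ∘ₖ H V = harmonicKernel 𝒱 H U := by
  have := hU.isMarkovKernel hH
  have := hH.isMarkovKernel hV
  refine kernel_ext_of_integral_eq fun f C hf hC x => ?_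
  rw [Kernel.integral_comp (integrable_of_measurable_of_abs_le hf.measurable hC)]
  have hsol := (hU.isHarmonicKernel_harmonicKernel hH).2 f hf
  exact hP.integral_eq_of_locallyHarmonicAt hH hV (hVU.trans hUP) (hU.continuous_integral hH hf)
    (fun x => abs_integral_le_of_abs_le hC) (fun y hy => hH.locallyHarmonicAt_of_forall_subset
      ((hH.isOpen hV).mem_nhds hy) fun W hW hWV hyW => hsol.2.1.2 W hW (hWV.trans hVU) y hyW) x

lemma comp_harmonicKernel_eq (hH : IsNormalBauerFamily 𝒱 H)
    (hU : IsRegular 𝒱 H U) (hU' : IsRegular 𝒱 H U') (hUU : U' ⊆ U) :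
    harmonicKernel 𝒱 H U ∘ₖ harmonicKernel 𝒱 H U' = harmonicKernel 𝒱 H U := by
  have := hU.isMarkovKernel hH
  have := hU'.isMarkovKernel hH
  refine kernel_ext_of_integral_eq fun f C hf hC x => ?_
  rw [Kernel.integral_comp (integrable_of_measurable_of_abs_le hf.measurable hC)]
  by_cases hx : x ∈ U'
  · have hc := hU.continuous_integral hH hf
    exact hU'.integral_eq hH hc ⟨hc.continuousOn,
      ((hU.isHarmonicKernel_harmonicKernel hH).2 f hf).2.1.mono hUU, fun _ _ => rfl⟩
      (subset_closure hx)
  · rw [hU'.eq_dirac hH hx, integral_dirac]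

lemma continuousOn_integral (hH : IsNormalBauerFamily 𝒱 H) (hP : IsPSet 𝒱 H P)
    (hUP : U ⊆ P) (hU : IsRegular 𝒱 H U) {f : X → ℝ} (hf : Measurable f) {C : ℝ}
    (hC : ∀ x, |f x| ≤ C) : ContinuousOn (fun x => ∫ y, f y ∂(harmonicKernel 𝒱 H U x)) U := by
  have := hU.isMarkovKernel hH
  intro x hx
  obtain ⟨V, hV, hxV, hVU⟩ := hH.exists_closure_subset (hU.1.mem_nhds hx)
  have := hH.isMarkovKernel hV
  have heq : ∀ y, ∫ z, f z ∂(harmonicKernel 𝒱 H U y) =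
      ∫ t, ∫ z, f z ∂(harmonicKernel 𝒱 H U t) ∂(H V y) := fun y => by
    rw [← Kernel.integral_comp (integrable_of_measurable_of_abs_le hf hC),
      hU.comp_kernel_eq hH hP hUP hV (subset_closure.trans hVU)]
  have h1 := hH.continuousOn_integral V hV (fun t => ∫ z, f z ∂(harmonicKernel 𝒱 H U t))
    (measurable_integral_kernel _ hf) ⟨C, fun t => abs_integral_le_of_abs_le hC⟩
  have h2 := h1.continuousAt ((hH.isOpen hV).mem_nhds hxV)
  simp only [← heq] at h2
  exact h2.continuousWithinAt

end IsRegular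

end HarmonicKernel

section Annulus

variable {X : Type*} [TopologicalSpace X] [MeasurableSpace X]

/-- `g` is a continuous function on a neighborhood `O` of the compact `K` in a `𝒫`-set, which
vanishes on `K`, is harmonic and strictly positive on `O \ K`, and has compact sublevel sets
`{g ≤ r}`, `r < R`. -/
structure IsAnnular (𝒱 : Set (Set X)) (H : Set X → Kernel X X) (K O : Set X) (g : X → ℝ)
    (R : ℝ) : Prop where
  exists_isPSet : ∃ P, IsPSet 𝒱 H P ∧ O ⊆ P
  isOpen : IsOpen O
  isCompact : IsCompact K
  subset : K ⊆ O
  continuousOn : ContinuousOn g O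
  eq_zero : ∀ x ∈ K, g x = 0
  pos : ∀ x ∈ O \ K, 0 < g x
  isHarmonicOn : IsHarmonicOn 𝒱 H g (O \ K)
  isCompact_le : ∀ r < R, IsCompact {x ∈ O | g x ≤ r}

/-- The open set `{g < r}` in `O \ K`. -/
def annulus (O K : Set X) (g : X → ℝ) (r : ℝ) : Set X := {x ∈ O \ K | g x < r}

/-- The level set `{g = r}` in `O \ K`. -/
def level (O K : Set X) (g : X → ℝ) (r : ℝ) : Set X := {x ∈ O \ K | g x = r}

variable {𝒱 : Set (Set X)} {H : Set X → Kernel X X} {K O : Set X} {g : X → ℝ}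
  {R r : ℝ}

namespace IsAnnular

variable [T2Space X]

lemma isOpen_diff (ha : IsAnnular 𝒱 H K O g R) : IsOpen (O \ K) :=
  ha.isOpen.sdiff ha.isCompact.isClosed

lemma isOpen_annulus (ha : IsAnnular 𝒱 H K O g R) (r : ℝ) : IsOpen (annulus O K g r) :=
  (ha.continuousOn.mono sdiff_subset).isOpen_inter_preimage ha.isOpen_diff isOpen_Iio

lemma closure_annulus_subset (ha : IsAnnular 𝒱 H K O g R) (hr : r < R) :
    closure (annulus O K g r) ⊆ {x ∈ O | g x ≤ r} :=
  closure_minimal (fun _ hx => ⟨hx.1.1, hx.2.le⟩) (ha.isCompact_le r hr).isClosed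

lemma isCompact_closure_annulus (ha : IsAnnular 𝒱 H K O g R) (hr : r < R) :
    IsCompact (closure (annulus O K g r)) :=
  (ha.isCompact_le r hr).of_isClosed_subset isClosed_closure (ha.closure_annulus_subset hr)

lemma frontier_annulus_subset (ha : IsAnnular 𝒱 H K O g R) (hr : r < R) :
    frontier (annulus O K g r) ⊆ K ∪ level O K g r := by
  intro x hx
  rw [(ha.isOpen_annulus r).frontier_eq] at hx
  have h1 := ha.closure_annulus_subset hr hx.1
  by_cases hxK : x ∈ K
  · exact Or.inl hxK
  · refine Or.inr ⟨⟨h1.1, hxK⟩, le_antisymm h1.2 ?_⟩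
    by_contra! h
    exact hx.2 ⟨⟨h1.1, hxK⟩, h⟩

lemma isCompact_level (ha : IsAnnular 𝒱 H K O g R) (hr0 : 0 < r) (hr : r < R) :
    IsCompact (level O K g r) := by
  have hL := ha.isCompact_le r hr
  have hclosed : IsClosed ({x ∈ O | g x ≤ r} ∩ g ⁻¹' {r}) :=
    (ha.continuousOn.mono fun x hx => hx.1).preimage_isClosed_of_isClosed hL.isClosed
      isClosed_singleton
  have hlevel : level O K g r = {x ∈ O | g x ≤ r} ∩ g ⁻¹' {r} := by
    refine subset_antisymm (fun x hx => ⟨⟨hx.1.1, hx.2.le⟩, hx.2⟩) ?_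
    rintro x ⟨hx, hgx : g x = r⟩
    exact ⟨⟨hx.1, fun hxK => hr0.ne' (hgx.symm.trans (ha.eq_zero x hxK))⟩, hgx⟩
  rw [hlevel]
  exact hL.of_isClosed_subset hclosed inter_subset_left

variable [LocallyCompactSpace X] [SecondCountableTopology X] [BorelSpace X]

lemma isRegular_annulus (hH : IsNormalBauerFamily 𝒱 H) (ha : IsAnnular 𝒱 H K O g R) (hr : r < R) :
    IsRegular 𝒱 H (annulus O K g r) := by
  obtain ⟨P, hP, hOP⟩ := ha.exists_isPSet
  refine hP.isRegular hH (ha.isOpen_annulus r) (fun x hx => hOP hx.1.1)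
    (ha.isCompact_closure_annulus hr) fun z hz => ?_
  have hzO := (ha.closure_annulus_subset hr (frontier_subset_closure hz)).1
  have hlim : Tendsto g (𝓝[annulus O K g r] z) (𝓝 (g z)) :=
    (ha.continuousOn z hzO).mono fun x hx => hx.1.1
  have hharm : IsHarmonicOn 𝒱 H g (annulus O K g r) := ha.isHarmonicOn.mono fun x hx => hx.1
  rcases ha.frontier_annulus_subset hr hz with hzK | hzS
  · refine ⟨g, hharm, fun x hx => ha.pos x hx.1, ?_⟩
    rwa [ha.eq_zero z hzK] at hlim
  · refine ⟨fun x => r - g x, (isHarmonicOn_const hH r).sub hH hharm,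
      fun x hx => sub_pos.2 hx.2, ?_⟩
    have := hlim.const_sub r
    rwa [hzS.2, sub_self] at this

lemma measure_level (hH : IsNormalBauerFamily 𝒱 H) (ha : IsAnnular 𝒱 H K O g R)
    (hr0 : 0 < r) (hr : r < R) {x : X} (hx : x ∈ annulus O K g r) :
    harmonicKernel 𝒱 H (annulus O K g r) x (level O K g r) = ENNReal.ofReal (g x / r) := by
  have hreg := ha.isRegular_annulus hH hr
  have := hreg.isMarkovKernel hH
  have hS := ha.isCompact_level hr0 hr
  obtain ⟨φ, hφ0, hφ1, -⟩ := exists_continuous_zero_one_of_isClosed ha.isCompact.isClosed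
    hS.isClosed (disjoint_left.2 fun y hyK hyS => hyS.1.2 hyK)
  have hsol : IsDirichletSolution 𝒱 H (annulus O K g r) φ fun y => r⁻¹ * g y := by
    refine ⟨(ha.continuousOn.mono fun y hy => (ha.closure_annulus_subset hr hy).1).const_mul _,
      (ha.isHarmonicOn.mono fun y hy => hy.1).const_mul _, fun y hy => ?_⟩
    rcases ha.frontier_annulus_subset hr hy with h | h
    · simp [hφ0 h, ha.eq_zero y h]
    · simp only [hφ1 h, h.2, Pi.one_apply]
      field_simp
  have hg := hreg.integral_eq hH φ.continuous hsol (subset_closure hx)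
  have hlevel : ∫ y, φ y ∂(harmonicKernel 𝒱 H (annulus O K g r) x) =
      (harmonicKernel 𝒱 H (annulus O K g r) x).real (level O K g r) := by
    rw [← integral_indicator_one hS.measurableSet]
    refine integral_congr_ae ?_
    filter_upwards [hreg.ae_mem_frontier hH hx] with y hy
    rcases ha.frontier_annulus_subset hr hy with h | h
    · rw [hφ0 h, indicator_of_notMem fun h' => h'.1.2 h, Pi.zero_apply]
    · rw [hφ1 h, indicator_of_mem h]
  rw [← ENNReal.ofReal_toReal (measure_ne_top _ (level O K g r)), ← Measure.real, ← hlevel, hg]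
  congr 1
  field_simp

end IsAnnular

end Annulus

lemma integral_measure_comp {Y Z E : Type*} [MeasurableSpace Y] [MeasurableSpace Z]
    [NormedAddCommGroup E] [NormedSpace ℝ E] {μ : Measure Y} {κ : Kernel Y Z}
    {f : Z → E} (hf : Integrable f (κ ∘ₘ μ)) :
    ∫ z, f z ∂(κ ∘ₘ μ) = ∫ y, ∫ z, f z ∂(κ y) ∂μ := by
  rw [Measure.comp_eq_comp_const_apply] at hf ⊢
  simpa only [Kernel.const_apply] using Kernel.integral_comp hf

section Sweeping

lemma level_subset_annulus {X : Type*} {K O : Set X} {g : X → ℝ} {r t : ℝ} (hrt : r < t) :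
    level O K g r ⊆ annulus O K g t :=
  fun _ hx => ⟨hx.1, hx.2.trans_lt hrt⟩

variable {X : Type*} [TopologicalSpace X] [MeasurableSpace X] {𝒱 : Set (Set X)}
  {H : Set X → Kernel X X} {K O : Set X} {g : X → ℝ} {R r s t : ℝ}

variable (𝒱 H K O g) in
/-- The normalized swept measure `(t/r) (μ H_{A_t})|_{S_t}` of a measure `μ` on `S_r`. -/
def sweepMeasure (r t : ℝ) (μ : Measure X) : Measure X :=
  ENNReal.ofReal (t / r) •
    (harmonicKernel 𝒱 H (annulus O K g t) ∘ₘ μ).restrict (level O K g t)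

open Classical in
variable (𝒱 H K O g) in
/-- The probability measure `(t/r) (μ H_{A_t})|_{S_t}`, with junk value `μ` if this is not a
probability measure. -/
def sweep (r t : ℝ) (μ : ProbabilityMeasure X) : ProbabilityMeasure X :=
  if h : IsProbabilityMeasure (sweepMeasure 𝒱 H K O g r t μ) then ⟨_, h⟩ else μ

variable (𝒱 H K O g R) in
/-- Probability measures `σ r` on the level sets `S_r`, `0 < r < R`, each of which is swept to the
later ones. -/
structure IsCompatibleFamily (σ : ℝ → ProbabilityMeasure X) : Prop where
  compl_level : ∀ r ∈ Ioo 0 R, (σ r : Measure X) (level O K g r)ᶜ = 0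
  sweep_eq : ∀ r t, 0 < r → r < t → t < R → sweep 𝒱 H K O g r t (σ r) = σ t

namespace IsAnnular

variable [T2Space X] [BorelSpace X]

lemma isCompact_setOf_compl_level (ha : IsAnnular 𝒱 H K O g R) (hr : 0 < r) (hrR : r < R) :
    IsCompact {μ : ProbabilityMeasure X | (μ : Measure X) (level O K g r)ᶜ = 0} := by
  convert isCompact_setOfPred_probabilityMeasure_mass_eq_compl_isCompact_le (E := X)
    (u := fun _ => 0) (K := fun _ => level O K g r) tendsto_const_nhds
    (fun _ => ha.isCompact_level hr hrR) (Or.inr monotone_const) using 2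
  simp

variable [LocallyCompactSpace X] [SecondCountableTopology X]

lemma isProbabilityMeasure_sweepMeasure (hH : IsNormalBauerFamily 𝒱 H)
    (ha : IsAnnular 𝒱 H K O g R) (hr : 0 < r) (hrt : r < t) (htR : t < R) {μ : Measure X}
    [IsProbabilityMeasure μ] (hμ : μ (level O K g r)ᶜ = 0) :
    IsProbabilityMeasure (sweepMeasure 𝒱 H K O g r t μ) := by
  have ht : 0 < t := hr.trans hrt
  have hS := (ha.isCompact_level ht htR).measurableSet
  have hae : ∀ᵐ x ∂μ, x ∈ level O K g r := hμ
  have hmass : (harmonicKernel 𝒱 H (annulus O K g t) ∘ₘ μ) (level O K g t) =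
      ENNReal.ofReal (r / t) := by
    rw [Measure.bind_apply hS (Kernel.aemeasurable _), lintegral_congr_ae
      (g := fun _ => ENNReal.ofReal (r / t)), lintegral_const, measure_univ, mul_one]
    filter_upwards [hae] with x hx
    rw [ha.measure_level hH ht htR (level_subset_annulus hrt hx), hx.2]
  refine ⟨?_⟩
  rw [sweepMeasure, Measure.smul_apply, Measure.restrict_apply_univ, hmass, smul_eq_mul,
    ← ENNReal.ofReal_mul (by positivity), show t / r * (r / t) = 1 by field_simp,
    ENNReal.ofReal_one]

lemma coe_sweep (hH : IsNormalBauerFamily 𝒱 H) (ha : IsAnnular 𝒱 H K O g R) (hr : 0 < r)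
    (hrt : r < t) (htR : t < R) {μ : ProbabilityMeasure X}
    (hμ : (μ : Measure X) (level O K g r)ᶜ = 0) :
    (sweep 𝒱 H K O g r t μ : Measure X) = sweepMeasure 𝒱 H K O g r t μ :=
  congrArg ((↑) : ProbabilityMeasure X → Measure X)
    (dif_pos (ha.isProbabilityMeasure_sweepMeasure hH hr hrt htR hμ))

lemma sweep_compl_level (hH : IsNormalBauerFamily 𝒱 H) (ha : IsAnnular 𝒱 H K O g R)
    (hr : 0 < r) (hrt : r < t) (htR : t < R) {μ : ProbabilityMeasure X}
    (hμ : (μ : Measure X) (level O K g r)ᶜ = 0) :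
    (sweep 𝒱 H K O g r t μ : Measure X) (level O K g t)ᶜ = 0 := by
  have hS := (ha.isCompact_level (hr.trans hrt) htR).measurableSet
  rw [ha.coe_sweep hH hr hrt htR hμ, sweepMeasure, Measure.smul_apply,
    Measure.restrict_apply hS.compl, compl_inter_self, measure_empty, smul_zero]

lemma ae_comp_mem_union_level (hH : IsNormalBauerFamily 𝒱 H) (ha : IsAnnular 𝒱 H K O g R)
    (hr : 0 < r) (hrt : r < t) (htR : t < R) {μ : Measure X} (hμ : μ (level O K g r)ᶜ = 0) :
    ∀ᵐ y ∂(harmonicKernel 𝒱 H (annulus O K g t) ∘ₘ μ), y ∈ K ∪ level O K g t := by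
  have hae : ∀ᵐ x ∂μ, x ∈ level O K g r := hμ
  refine Measure.ae_comp_of_ae_ae
    (ha.isCompact.union (ha.isCompact_level (hr.trans hrt) htR)).measurableSet ?_
  filter_upwards [hae] with x hx
  filter_upwards [(ha.isRegular_annulus hH htR).ae_mem_frontier hH (level_subset_annulus hrt hx)]
    with y hy using ha.frontier_annulus_subset htR hy

/-- The part of `μ H_{A_r}` on `K` is not moved by `H_{A_t}`, so it may be discarded. -/
lemma restrict_comp_restrict_comp (hH : IsNormalBauerFamily 𝒱 H) (ha : IsAnnular 𝒱 H K O g R)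
    (hs : 0 < s) (hsr : s < r) (hrt : r < t) (htR : t < R) {μ : Measure X}
    (hμ : μ (level O K g s)ᶜ = 0) :
    (harmonicKernel 𝒱 H (annulus O K g t) ∘ₘ
      (harmonicKernel 𝒱 H (annulus O K g r) ∘ₘ μ).restrict (level O K g r)).restrict
        (level O K g t) =
      (harmonicKernel 𝒱 H (annulus O K g t) ∘ₘ μ).restrict (level O K g t) := by
  have hr := hs.trans hsr
  have hregt := ha.isRegular_annulus hH htR
  have hSr := (ha.isCompact_level hr (hrt.trans htR)).measurableSet
  have hSt := (ha.isCompact_level (hr.trans hrt) htR).measurableSet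
  have hcomp := hregt.comp_harmonicKernel_eq hH (ha.isRegular_annulus hH (hrt.trans htR))
    fun x hx => ⟨hx.1, hx.2.trans hrt⟩
  nth_rw 2 [← hcomp]
  rw [← Measure.comp_assoc]
  ext B hB
  rw [Measure.restrict_apply hB, Measure.restrict_apply hB,
    Measure.bind_apply (hB.inter hSt) (Kernel.aemeasurable _),
    Measure.bind_apply (hB.inter hSt) (Kernel.aemeasurable _), ← lintegral_indicator hSr]
  refine lintegral_congr_ae ?_
  filter_upwards [ha.ae_comp_mem_union_level hH hs hsr (hrt.trans htR) hμ] with y hy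
  by_cases hyS : y ∈ level O K g r
  · rw [indicator_of_mem hyS]
  · have hyK : y ∈ K := hy.resolve_right hyS
    rw [indicator_of_notMem hyS, hregt.eq_dirac hH fun h => h.1.2 hyK,
      Measure.dirac_apply' _ (hB.inter hSt), indicator_of_notMem fun h => h.2.1.2 hyK]

lemma sweep_sweep (hH : IsNormalBauerFamily 𝒱 H) (ha : IsAnnular 𝒱 H K O g R) (hs : 0 < s)
    (hsr : s < r) (hrt : r < t) (htR : t < R) {μ : ProbabilityMeasure X}
    (hμ : (μ : Measure X) (level O K g s)ᶜ = 0) :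
    sweep 𝒱 H K O g r t (sweep 𝒱 H K O g s r μ) = sweep 𝒱 H K O g s t μ := by
  have hr := hs.trans hsr
  have ht := hr.trans hrt
  refine Subtype.ext ?_
  refine (ha.coe_sweep hH hr hrt htR (ha.sweep_compl_level hH hs hsr (hrt.trans htR) hμ)).trans
    (Eq.trans ?_ (ha.coe_sweep hH hs (hsr.trans hrt) htR hμ).symm)
  rw [ha.coe_sweep hH hs hsr (hrt.trans htR) hμ]
  simp only [sweepMeasure, Measure.comp_smul, Measure.restrict_smul, smul_smul]
  rw [ha.restrict_comp_restrict_comp hH hs hsr hrt htR hμ, ← ENNReal.ofReal_mul (by positivity)]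
  congr 2
  field_simp

lemma integral_sweep (hH : IsNormalBauerFamily 𝒱 H) (ha : IsAnnular 𝒱 H K O g R) (hr : 0 < r)
    (hrt : r < t) (htR : t < R) {μ : ProbabilityMeasure X}
    (hμ : (μ : Measure X) (level O K g r)ᶜ = 0) {f : X → ℝ} (hf : Measurable f) {C : ℝ}
    (hC : ∀ x, |f x| ≤ C) :
    ∫ x, f x ∂(sweep 𝒱 H K O g r t μ : Measure X) = t / r * ∫ x, ∫ y, (level O K g t).indicator f y
      ∂(harmonicKernel 𝒱 H (annulus O K g t) x) ∂(μ : Measure X) := by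
  have ht := hr.trans hrt
  have hSt := (ha.isCompact_level ht htR).measurableSet
  have := (ha.isRegular_annulus hH htR).isMarkovKernel hH
  rw [ha.coe_sweep hH hr hrt htR hμ, sweepMeasure, integral_smul_measure,
    ENNReal.toReal_ofReal (by positivity), smul_eq_mul, ← integral_indicator hSt,
    integral_measure_comp (integrable_of_measurable_of_abs_le (hf.indicator hSt)
      fun x => (norm_indicator_le_norm_self f x).trans (hC x))]

lemma tendsto_sweep (hH : IsNormalBauerFamily 𝒱 H) (ha : IsAnnular 𝒱 H K O g R) (hr : 0 < r)
    (hrt : r < t) (htR : t < R) {μ : ℕ → ProbabilityMeasure X} {μ₀ : ProbabilityMeasure X}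
    (hμ : ∀ᶠ k in atTop, (μ k : Measure X) (level O K g r)ᶜ = 0)
    (hμ₀ : (μ₀ : Measure X) (level O K g r)ᶜ = 0) (hlim : Tendsto μ atTop (𝓝 μ₀)) :
    Tendsto (fun k => sweep 𝒱 H K O g r t (μ k)) atTop (𝓝 (sweep 𝒱 H K O g r t μ₀)) := by
  obtain ⟨P, hP, hOP⟩ := ha.exists_isPSet
  have hSt := (ha.isCompact_level (hr.trans hrt) htR).measurableSet
  rw [ProbabilityMeasure.tendsto_iff_forall_integral_tendsto]
  intro f
  have hfC : ∀ x, |f x| ≤ ‖f‖ := f.norm_coe_le_norm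
  have hcont := (ha.isRegular_annulus hH htR).continuousOn_integral hH hP (fun x hx => hOP hx.1.1)
    (f.continuous.measurable.indicator hSt)
    fun x => (norm_indicator_le_norm_self f x).trans (hfC x)
  obtain ⟨F, C, hF, hFC, hFeq⟩ := exists_continuous_eqOn_of_isCompact
    (ha.isCompact_level hr (hrt.trans htR)) (hcont.mono (level_subset_annulus hrt))
  have hdual : ∀ ν : ProbabilityMeasure X, (ν : Measure X) (level O K g r)ᶜ = 0 →
      ∫ x, f x ∂(sweep 𝒱 H K O g r t ν : Measure X) = t / r * ∫ x, F x ∂(ν : Measure X) := by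
    intro ν hν
    rw [ha.integral_sweep hH hr hrt htR hν f.continuous.measurable hfC]
    congr 1
    refine integral_congr_ae ?_
    have hae : ∀ᵐ x ∂(ν : Measure X), x ∈ level O K g r := hν
    filter_upwards [hae] with x hx using (hFeq hx).symm
  rw [hdual μ₀ hμ₀]
  refine ((ProbabilityMeasure.tendsto_iff_forall_integral_tendsto.1 hlim
    (BoundedContinuousFunction.ofNormedAddCommGroup F hF C hFC)).const_mul (t / r)).congr' ?_
  filter_upwards [hμ] with k hk using (hdual (μ k) hk).symm

variable {η : ℕ → ℝ} {ν : ℕ → ProbabilityMeasure X}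

lemma exists_subseq_tendsto_sweep (hH : IsNormalBauerFamily 𝒱 H) (ha : IsAnnular 𝒱 H K O g R)
    (hη : ∀ n, η n ∈ Ioo 0 R) (hanti : StrictAnti η)
    (hν : ∀ n, (ν n : Measure X) (level O K g (η n))ᶜ = 0) :
    ∃ n : ℕ → ℕ, StrictMono n ∧ ∃ τ : ℕ → ProbabilityMeasure X,
      ∀ m, (τ m : Measure X) (level O K g (η m))ᶜ = 0 ∧
        Tendsto (fun k => sweep 𝒱 H K O g (η (n k)) (η m) (ν (n k))) atTop (𝓝 (τ m)) := by
  -- For `n ≤ m` the `m`-th coordinate is irrelevant; any measure on `S_{η m}` will do.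
  let ρ : ℕ → ℕ → ProbabilityMeasure X := fun n m =>
    if m < n then sweep 𝒱 H K O g (η n) (η m) (ν n) else ν m
  let 𝒞 : ℕ → Set (ProbabilityMeasure X) := fun m =>
    {μ | (μ : Measure X) (level O K g (η m))ᶜ = 0}
  have h𝒞 : IsCompact (pi univ 𝒞) :=
    isCompact_univ_pi fun m => ha.isCompact_setOf_compl_level (hη m).1 (hη m).2
  have hρ : ∀ n, ρ n ∈ pi univ 𝒞 := by
    intro n m _
    change (ρ n m : Measure X) (level O K g (η m))ᶜ = 0
    simp only [ρ]
    split_ifs with h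
    · exact ha.sweep_compl_level hH (hη n).1 (hanti h) (hη m).2 (hν n)
    · exact hν m
  obtain ⟨τ, hτ, n, hn, hlim⟩ := h𝒞.tendsto_subseq hρ
  refine ⟨n, hn, τ, fun m => ⟨hτ m (mem_univ m), (tendsto_pi_nhds.1 hlim m).congr' ?_⟩⟩
  filter_upwards [hn.tendsto_atTop.eventually (eventually_gt_atTop m)] with k hk
  exact if_pos hk

theorem exists_tendsto_sweep (hH : IsNormalBauerFamily 𝒱 H) (ha : IsAnnular 𝒱 H K O g R)
    (hη : ∀ n, η n ∈ Ioo 0 R) (hanti : StrictAnti η) (hη0 : Tendsto η atTop (𝓝 0))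
    (hν : ∀ n, (ν n : Measure X) (level O K g (η n))ᶜ = 0) :
    ∃ n : ℕ → ℕ, StrictMono n ∧ ∃ σ : ℝ → ProbabilityMeasure X,
      IsCompatibleFamily 𝒱 H K O g R σ ∧ ∀ r ∈ Ioo 0 R,
        Tendsto (fun k => sweep 𝒱 H K O g (η (n k)) r (ν (n k))) atTop (𝓝 (σ r)) := by
  obtain ⟨n, hn, τ, hτ⟩ := ha.exists_subseq_tendsto_sweep hH hη hanti hν
  have hηn : Tendsto (fun k => η (n k)) atTop (𝓝 0) := hη0.comp hn.tendsto_atTop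
  have hmass : ∀ r ∈ Ioo 0 R, ∀ᶠ k in atTop,
      (sweep 𝒱 H K O g (η (n k)) r (ν (n k)) : Measure X) (level O K g r)ᶜ = 0 := fun r hr => by
    filter_upwards [hηn.eventually_lt_const hr.1] with k hk
      using ha.sweep_compl_level hH (hη _).1 hk hr.2 (hν _)
  have hpush : ∀ (r t : ℝ) (σ : ProbabilityMeasure X), 0 < r → r < t → t < R →
      (σ : Measure X) (level O K g r)ᶜ = 0 →
      Tendsto (fun k => sweep 𝒱 H K O g (η (n k)) r (ν (n k))) atTop (𝓝 σ) →
      Tendsto (fun k => sweep 𝒱 H K O g (η (n k)) t (ν (n k))) atTop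
        (𝓝 (sweep 𝒱 H K O g r t σ)) := by
    intro r t σ hr hrt htR hσ hlim
    refine (ha.tendsto_sweep hH hr hrt htR (hmass r ⟨hr, hrt.trans htR⟩) hσ hlim).congr' ?_
    filter_upwards [hηn.eventually_lt_const hr] with k hk
      using ha.sweep_sweep hH (hη _).1 hk hrt htR (hν _)
  choose! m hm using fun (r : ℝ) (hr : 0 < r) => (hη0.eventually_lt_const hr).exists
  let σ : ℝ → ProbabilityMeasure X := fun r => sweep 𝒱 H K O g (η (m r)) r (τ (m r))
  have hσ : ∀ r ∈ Ioo 0 R, (σ r : Measure X) (level O K g r)ᶜ = 0 := fun r hr =>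
    ha.sweep_compl_level hH (hη _).1 (hm r hr.1) hr.2 (hτ _).1
  have hconv : ∀ r ∈ Ioo 0 R,
      Tendsto (fun k => sweep 𝒱 H K O g (η (n k)) r (ν (n k))) atTop (𝓝 (σ r)) := fun r hr =>
    hpush _ _ _ (hη (m r)).1 (hm r hr.1) hr.2 (hτ _).1 (hτ _).2
  refine ⟨n, hn, σ, ⟨hσ, fun r t hr hrt htR => ?_⟩, hconv⟩
  have hr' : r ∈ Ioo 0 R := ⟨hr, hrt.trans htR⟩
  exact tendsto_nhds_unique (hpush r t _ hr hrt htR (hσ r hr') (hconv r hr'))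
    (hconv t ⟨hr.trans hrt, htR⟩)

end IsAnnular

lemma IsCompatibleFamily.restrict_comp_eq [T2Space X] [BorelSpace X] [LocallyCompactSpace X]
    [SecondCountableTopology X] {σ : ℝ → ProbabilityMeasure X} (hH : IsNormalBauerFamily 𝒱 H)
    (ha : IsAnnular 𝒱 H K O g R) (hσ : IsCompatibleFamily 𝒱 H K O g R σ) (hr : 0 < r)
    (hrt : r < t) (htR : t < R) :
    (harmonicKernel 𝒱 H (annulus O K g t) ∘ₘ (σ r : Measure X)).restrict (level O K g t) =
      ENNReal.ofReal (r / t) • (σ t : Measure X) := by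
  have ht : 0 < t := hr.trans hrt
  rw [← hσ.sweep_eq r t hr hrt htR,
    ha.coe_sweep hH hr hrt htR (hσ.compl_level r ⟨hr, hrt.trans htR⟩), sweepMeasure, smul_smul,
    ← ENNReal.ofReal_mul (by positivity), show r / t * (t / r) = 1 by field_simp,
    ENNReal.ofReal_one, one_smul]

end Sweeping

section Existence

lemma frontier_diff_subset {X : Type*} [TopologicalSpace X] {U K : Set X} (hK : IsClosed K) :
    frontier (U \ K) ⊆ K ∪ frontier U := by
  rw [Set.sdiff_eq]
  refine (frontier_inter_subset U Kᶜ).trans ?_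
  rw [frontier_compl, union_comm]
  exact union_subset_union (inter_subset_right.trans hK.frontier_subset) inter_subset_left

lemma isCompact_setOf_le {X : Type*} [TopologicalSpace X] {O : Set X} {g : X → ℝ} {r R : ℝ}
    (hO : IsOpen O) (hOc : IsCompact (closure O)) (hg : ContinuousOn g (closure O))
    (hfr : ∀ x ∈ frontier O, R ≤ g x) (hr : r < R) : IsCompact {x ∈ O | g x ≤ r} := by
  have hset : {x ∈ O | g x ≤ r} = closure O ∩ g ⁻¹' Iic r := by
    refine subset_antisymm (fun x hx => ⟨subset_closure hx.1, hx.2⟩) ?_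
    rintro x ⟨hx, hgx : g x ≤ r⟩
    refine ⟨?_, hgx⟩
    by_contra hxO
    linarith [hfr x (hO.frontier_eq ▸ ⟨hx, hxO⟩)]
  rw [hset]
  exact hOc.of_isClosed_subset
    (hg.preimage_isClosed_of_isClosed isClosed_closure isClosed_Iic) inter_subset_left

lemma continuousOn_piecewise_zero {X : Type*} [TopologicalSpace X] {K W : Set X} {h : X → ℝ}
    [DecidablePred (· ∈ K)] (hK : IsClosed K) (hh : ContinuousOn h (W \ K))
    (hlim : ∀ z ∈ frontier K, Tendsto h (𝓝[W \ K] z) (𝓝 0)) :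
    ContinuousOn (K.piecewise (fun _ => 0) h) W := by
  refine ContinuousOn.piecewise' (fun z hz => ?_) (fun z hz => ?_) continuousOn_const hh
  · rw [piecewise_eq_of_mem _ _ _ (hK.frontier_subset hz.2)]
    exact tendsto_const_nhds
  · rw [piecewise_eq_of_mem _ _ _ (hK.frontier_subset hz.2)]
    exact hlim z hz.2

variable {X : Type*} [TopologicalSpace X] [MeasurableSpace X] {𝒱 : Set (Set X)}
  {H : Set X → Kernel X X} {K W₀ O : Set X} {g : X → ℝ} {r R : ℝ}

lemma IsAdmissible.disjoint_frontier (hW : IsAdmissible 𝒱 H K W₀) : Disjoint K (frontier W₀) :=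
  disjoint_left.2 fun _ hx hxf => (hW.isRegular.1.frontier_eq ▸ hxf).2 (hW.subset hx)

variable [T2Space X] [LocallyCompactSpace X] [SecondCountableTopology X]

lemma IsStronglyStable.exists_isAnnular (hH : IsNormalBauerFamily 𝒱 H)
    (hK : IsStronglyStable 𝒱 H K) : ∃ O g R, 0 < R ∧ IsAnnular 𝒱 H K O g R := by
  classical
  obtain ⟨hKc, -, W, hW, hKW, h, hh, hpos, hlim⟩ := hK
  obtain ⟨O, hO, hKO, hOW, hOc⟩ := exists_open_between_and_isCompact_closure hKc hW.1 hKW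
  have hfrW : frontier O ⊆ W \ K := fun x hx =>
    ⟨hOW (frontier_subset_closure hx), fun hxK => (hO.frontier_eq ▸ hx).2 (hKO hxK)⟩
  obtain ⟨R, hR, hRle⟩ := (hOc.of_isClosed_subset isClosed_frontier
    frontier_subset_closure).exists_forall_le' (hh.1.mono hfrW) (a := 0)
      fun x hx => hpos x (hfrW hx)
  let g : X → ℝ := K.piecewise (fun _ => 0) h
  have hgh : ∀ x ∉ K, g x = h x := fun x hx => piecewise_eq_of_notMem _ _ _ hx
  have hgc : ContinuousOn g W := continuousOn_piecewise_zero hKc.isClosed hh.1 hlim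
  have hOW' : O ⊆ W := subset_closure.trans hOW
  have hOKW : O \ K ⊆ W \ K := sdiff_subset_sdiff_left hOW'
  exact ⟨O, g, R, hR,
    { exists_isPSet := ⟨W, hW, hOW'⟩
      isOpen := hO
      isCompact := hKc
      subset := hKO
      continuousOn := hgc.mono hOW'
      eq_zero := fun x hx => piecewise_eq_of_mem _ _ _ hx
      pos := fun x hx => (hpos x (hOKW hx)).trans_eq (hgh x hx.2).symm
      isHarmonicOn := (hh.mono hOKW).congr hH fun x hx => hgh x hx.2
      isCompact_le := fun r hr => isCompact_setOf_le hO hOc (hgc.mono hOW)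
        (fun x hx => (hRle x hx).trans_eq (hgh x (hfrW hx).2).symm) hr }⟩

variable [BorelSpace X]

namespace IsAdmissible

lemma gFun_eq_zero (hH : IsNormalBauerFamily 𝒱 H) (hW : IsAdmissible 𝒱 H K W₀) {x : X}
    (hx : x ∈ K) : gFun 𝒱 H W₀ K x = 0 := by
  rw [gFun, hW.isRegular_diff.eq_dirac hH fun h => h.2 hx, measureReal_def,
    Measure.dirac_apply' _ isClosed_frontier.measurableSet,
    indicator_of_notMem (disjoint_left.1 hW.disjoint_frontier hx), ENNReal.toReal_zero]

lemma gFun_eq_one (hH : IsNormalBauerFamily 𝒱 H) (hW : IsAdmissible 𝒱 H K W₀) {x : X}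
    (hx : x ∈ frontier W₀) : gFun 𝒱 H W₀ K x = 1 := by
  have hxW : x ∉ W₀ := (hW.isRegular.1.frontier_eq ▸ hx).2
  rw [gFun, hW.isRegular_diff.eq_dirac hH fun h => hxW h.1, measureReal_def,
    Measure.dirac_apply' _ isClosed_frontier.measurableSet, indicator_of_mem hx, Pi.one_apply,
    ENNReal.toReal_one]

lemma exists_gFun_eq_integral (hH : IsNormalBauerFamily 𝒱 H) (hK : IsCompact K)
    (hW : IsAdmissible 𝒱 H K W₀) : ∃ φ : X → ℝ, Continuous φ ∧
      EqOn (gFun 𝒱 H W₀ K) (fun x => ∫ y, φ y ∂(harmonicKernel 𝒱 H (W₀ \ K) x))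
        (closure W₀) := by
  obtain ⟨φ, hφ0, hφ1, -⟩ := exists_continuous_zero_one_of_isClosed hK.isClosed
    isClosed_frontier hW.disjoint_frontier
  have hreg := hW.isRegular_diff
  refine ⟨φ, φ.continuous, fun x hx => ?_⟩
  by_cases hxD : x ∈ W₀ \ K
  · rw [gFun, ← integral_indicator_one isClosed_frontier.measurableSet]
    refine integral_congr_ae ?_
    filter_upwards [hreg.ae_mem_frontier hH hxD] with y hy
    by_cases hyf : y ∈ frontier W₀
    · rw [indicator_of_mem hyf, hφ1 hyf]
    · rw [indicator_of_notMem hyf,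
        hφ0 ((frontier_diff_subset hK.isClosed hy).resolve_right hyf), Pi.zero_apply]
  · simp only [hreg.eq_dirac hH hxD, integral_dirac]
    by_cases hxK : x ∈ K
    · rw [hW.gFun_eq_zero hH hxK, hφ0 hxK, Pi.zero_apply]
    · have hxf : x ∈ frontier W₀ := hW.isRegular.1.frontier_eq ▸ ⟨hx, fun h => hxD ⟨h, hxK⟩⟩
      rw [hW.gFun_eq_one hH hxf, hφ1 hxf, Pi.one_apply]

lemma isAnnular (hH : IsNormalBauerFamily 𝒱 H) (hK : IsCompact K)
    (hW : IsAdmissible 𝒱 H K W₀) : IsAnnular 𝒱 H K W₀ (gFun 𝒱 H W₀ K) 1 := by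
  have hreg := hW.isRegular_diff
  obtain ⟨φ, hφ, heq⟩ := hW.exists_gFun_eq_integral hH hK
  have hcont : ContinuousOn (gFun 𝒱 H W₀ K) (closure W₀) :=
    (hreg.continuous_integral hH hφ).continuousOn.congr heq
  exact
    { exists_isPSet := ⟨W₀, hW.isPSet, Subset.rfl⟩
      isOpen := hW.isRegular.1
      isCompact := hK
      subset := hW.subset
      continuousOn := hcont.mono subset_closure
      eq_zero := fun _ hx => hW.gFun_eq_zero hH hx
      pos := hW.gFun_pos
      isHarmonicOn := ((hreg.isHarmonicKernel_harmonicKernel hH).2 φ hφ).2.1.congr hH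
        (heq.mono (sdiff_subset.trans subset_closure))
      isCompact_le := fun _ hr => isCompact_setOf_le hW.isRegular.1 hW.isRegular.2.1 hcont
        (fun _ hx => (hW.gFun_eq_one hH hx).ge) hr }

end IsAdmissible

namespace IsAnnular

-- If `{g = r}` were empty, the compact set `{g ≤ r}` would be open, hence absorbing for small `W`.
lemma nonempty_level (hH : IsNormalBauerFamily 𝒱 H) (ha : IsAnnular 𝒱 H K O g R)
    (hKne : K.Nonempty) (hr0 : 0 < r) (hr : r < R) : (level O K g r).Nonempty := by
  by_contra! hempty
  obtain ⟨P, hP, hOP⟩ := ha.exists_isPSet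
  have hMo : IsOpen {x ∈ O | g x ≤ r} := by
    have hset : {x ∈ O | g x ≤ r} = O ∩ g ⁻¹' Iio r := by
      refine subset_antisymm (fun x hx => ⟨hx.1, lt_of_le_of_ne hx.2 fun h => ?_⟩)
        fun x hx => ⟨hx.1, le_of_lt hx.2⟩
      have hlevel : x ∈ level O K g r :=
        ⟨⟨hx.1, fun hxK => hr0.ne ((ha.eq_zero x hxK).symm.trans h)⟩, h⟩
      rwa [hempty] at hlevel
    rw [hset]
    exact ha.continuousOn.isOpen_inter_preimage ha.isOpen isOpen_Iio
  choose! W hW𝒱 hxW hWM using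
    fun x (hx : x ∈ {x ∈ O | g x ≤ r}) => hH.exists_closure_subset (hMo.mem_nhds hx)
  have hMP : {x ∈ O | g x ≤ r} ⊆ P := fun x hx => hOP hx.1
  obtain ⟨k, hk⟩ := hKne
  refine hP.not_isAbsorbing hH (ha.isCompact_le r hr)
    ⟨k, ha.subset hk, (ha.eq_zero k hk).le.trans hr0.le⟩ hMP (W := W)
    (fun x hx => ⟨hW𝒱 x hx, (hWM x hx).trans hMP, hxW x hx⟩) fun x hx => ?_
  filter_upwards [hH.ae_mem_frontier (hW𝒱 x hx) (hxW x hx)] with y hy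
  exact hWM x hx (frontier_subset_closure hy)

lemma exists_isCompatibleFamily (hH : IsNormalBauerFamily 𝒱 H) (ha : IsAnnular 𝒱 H K O g R)
    (hKne : K.Nonempty) (hR : 0 < R) : ∃ σ, IsCompatibleFamily 𝒱 H K O g R σ := by
  obtain ⟨η, hanti, hη, hlim⟩ := exists_seq_strictAnti_tendsto' hR
  choose x hx using fun n => ha.nonempty_level hH hKne (hη n).1 (hη n).2
  have hdirac : ∀ n, Measure.dirac (x n) (level O K g (η n))ᶜ = 0 := fun n => by
    rw [Measure.dirac_apply' _ (ha.isCompact_level (hη n).1 (hη n).2).measurableSet.compl,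
      indicator_of_notMem (notMem_compl_iff.2 (hx n))]
  obtain ⟨_, _, σ, hσ, -⟩ := ha.exists_tendsto_sweep hH hη hanti hlim
    (ν := fun n => ⟨Measure.dirac (x n), inferInstance⟩) hdirac
  exact ⟨σ, hσ⟩

end IsAnnular

namespace IsAdmissible

lemma isCompatible_of_isCompatibleFamily (hH : IsNormalBauerFamily 𝒱 H) (hK : IsCompact K)
    (hW : IsAdmissible 𝒱 H K W₀) {σ : ℝ → ProbabilityMeasure X}
    (hσ : IsCompatibleFamily 𝒱 H K W₀ (gFun 𝒱 H W₀ K) 1 σ) :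
    IsCompatible 𝒱 H W₀ K fun r => (σ r : Measure X) := by
  intro r t hr hrt ht
  have hae : ∀ᵐ x ∂(σ t : Measure X), x ∈ S 𝒱 H W₀ K t := hσ.compl_level t ⟨hr.trans hrt, ht⟩
  rw [Measure.restrict_eq_self_of_ae_mem hae]
  exact hσ.restrict_comp_eq hH (hW.isAnnular hH hK) hr hrt ht

open Classical in
theorem exists_subsequence (hH : IsNormalBauerFamily 𝒱 H) (hK : IsCompact K)
    (hW : IsAdmissible 𝒱 H K W₀) {η : ℕ → ℝ} (hη : ∀ n, η n ∈ Ioo (0 : ℝ) 1) (hanti : StrictAnti η)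
    (hη0 : Tendsto η atTop (𝓝 0)) {ν : ℕ → ProbabilityMeasure X}
    (hν : ∀ n, (ν n : Measure X) (S 𝒱 H W₀ K (η n))ᶜ = 0) :
    ∃ n : ℕ → ℕ, StrictMono n ∧
      ∃ (σk : ℝ → ℕ → ProbabilityMeasure X) (σ : ℝ → ProbabilityMeasure X),
        (∀ r ∈ Ioo (0 : ℝ) 1,
          (∀ k, η (n k) < r →
            (σk r k : Measure X) = ENNReal.ofReal (r / η (n k)) •
              (swept 𝒱 H W₀ K (ν (n k)) r).restrict (S 𝒱 H W₀ K r)) ∧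
          Tendsto (σk r) atTop (𝓝 (σ r)) ∧
          (σ r : Measure X) (S 𝒱 H W₀ K r)ᶜ = 0) ∧
        IsCompatible 𝒱 H W₀ K fun r => (σ r : Measure X) := by
  have ha := hW.isAnnular hH hK
  obtain ⟨n, hn, σ, hσ, hlim⟩ := ha.exists_tendsto_sweep hH hη hanti hη0 hν
  exact ⟨n, hn, fun r k => sweep 𝒱 H K W₀ (gFun 𝒱 H W₀ K) (η (n k)) r (ν (n k)), σ,
    fun r hr => ⟨fun k hk => ha.coe_sweep hH (hη _).1 hk hr.2 (hν _), hlim r hr,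
      hσ.compl_level r hr⟩, hW.isCompatible_of_isCompatibleFamily hH hK hσ⟩

end IsAdmissible

end Existence

section CollapseTopology

variable {X : Type*} {K : Set X}

lemma proj_eq_iff {x y : X} : proj K x = proj K y ↔ x = y ∨ (x ∈ K ∧ y ∈ K) :=
  Quotient.eq (r := collapseSetoid K)

lemma proj_eq_of_mem {x y : X} (hx : x ∈ K) (hy : y ∈ K) : proj K x = proj K y :=
  proj_eq_iff.2 (Or.inr ⟨hx, hy⟩)

/-- `V` is saturated for the projection, that is, a union of fibers. -/
def IsSaturated (K V : Set X) : Prop := Disjoint V K ∨ K ⊆ V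

namespace IsSaturated

variable {V : Set X}

lemma proj_mem_image (hV : IsSaturated K V) {x : X} : proj K x ∈ proj K '' V ↔ x ∈ V := by
  refine ⟨?_, mem_image_of_mem _⟩
  rintro ⟨y, hy, hyx⟩
  rcases proj_eq_iff.1 hyx with rfl | ⟨hyK, hxK⟩
  · exact hy
  · exact hV.elim (fun h => (disjoint_left.1 h hy hyK).elim) fun h => h hxK

lemma preimage_image (hV : IsSaturated K V) : proj K ⁻¹' (proj K '' V) = V :=
  ext fun _ => hV.proj_mem_image

end IsSaturated

open Classical in
/-- The section of the projection which maps the collapsed point to `k ∈ K`. -/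
def lift (K : Set X) (k : X) (y : Collapse K) : X :=
  if y = proj K k then k else Quotient.out y

lemma proj_lift (k : X) (y : Collapse K) : proj K (lift K k y) = y := by
  unfold lift
  split_ifs with h
  · exact h.symm
  · exact Quotient.out_eq y

lemma lift_proj_of_notMem (k : X) {x : X} (hx : x ∉ K) : lift K k (proj K x) = x :=
  (proj_eq_iff.1 (proj_lift k (proj K x))).resolve_right fun h => hx h.2

lemma lift_proj_of_mem {k x : X} (hk : k ∈ K) (hx : x ∈ K) : lift K k (proj K x) = k :=
  if_pos (proj_eq_of_mem hx hk)

variable [TopologicalSpace X]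

lemma isQuotientMap_proj : IsQuotientMap (proj K) := isQuotientMap_quotient_mk'

lemma continuous_proj : Continuous (proj K) := isQuotientMap_proj.continuous

lemma surjective_proj : Function.Surjective (proj K) := isQuotientMap_proj.surjective

lemma IsSaturated.isOpen_image {V : Set X} (hV : IsSaturated K V) (hVo : IsOpen V) :
    IsOpen (proj K '' V) := by
  rwa [← isQuotientMap_proj.isOpen_preimage, hV.preimage_image]

lemma isClosedMap_proj (hK : IsClosed K) : IsClosedMap (proj K) := by
  intro C hC
  rw [← isQuotientMap_proj.isClosed_preimage]
  by_cases hCK : Disjoint C K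
  · rwa [IsSaturated.preimage_image (Or.inl hCK)]
  · have himage : proj K '' C = proj K '' (C ∪ K) := by
      refine (image_mono subset_union_left).antisymm ?_
      rintro _ ⟨x, hx | hx, rfl⟩
      · exact mem_image_of_mem _ hx
      · obtain ⟨y, hyC, hyK⟩ := not_disjoint_iff.1 hCK
        exact ⟨y, hyC, proj_eq_of_mem hyK hx⟩
    rw [himage, IsSaturated.preimage_image (Or.inr subset_union_right)]
    exact hC.union hK

lemma eventually_nhds_proj (hK : IsClosed K) {Q : Collapse K → Prop} {x : X}
    (h : ∀ x', proj K x' = proj K x → ∀ᶠ z in 𝓝 x', Q (proj K z)) :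
    ∀ᶠ y in 𝓝 (proj K x), Q y := by
  filter_upwards [(isClosedMap_proj hK).eventually_nhds_fiber (proj K x) h] with y hy
  obtain ⟨z, rfl⟩ := surjective_proj y
  exact hy z rfl

lemma isCompact_fiber (hK : IsCompact K) (x : X) : IsCompact (proj K ⁻¹' {proj K x}) := by
  by_cases hx : x ∈ K
  · have hfiber : proj K ⁻¹' {proj K x} = K := by
      ext y
      simp only [mem_preimage, mem_singleton_iff, proj_eq_iff]
      exact ⟨fun h => h.elim (fun h => h ▸ hx) And.left, fun hy => Or.inr ⟨hy, hx⟩⟩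
    rwa [hfiber]
  · have hfiber : proj K ⁻¹' {proj K x} = {x} := by
      ext y
      simp [proj_eq_iff, hx]
    rw [hfiber]
    exact isCompact_singleton

lemma t2Space_collapse [T2Space X] (hK : IsCompact K) : T2Space (Collapse K) := by
  rw [t2Space_iff_disjoint_nhds]
  intro y₁ y₂ hne
  obtain ⟨x₁, rfl⟩ := surjective_proj y₁
  obtain ⟨x₂, rfl⟩ := surjective_proj y₂
  obtain ⟨U, V, hU, hV, hxU, hxV, hUV⟩ := SeparatedNhds.of_isCompact_isCompact
    (isCompact_fiber hK x₁) (isCompact_fiber hK x₂)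
    (disjoint_left.2 fun z hz₁ hz₂ => hne (hz₁.symm.trans hz₂))
  have hyU := (isClosedMap_proj hK.isClosed).eventually_nhds_fiber (p := (· ∈ U)) (proj K x₁)
    fun x hx => hU.mem_nhds (hxU hx)
  have hyV := (isClosedMap_proj hK.isClosed).eventually_nhds_fiber (p := (· ∈ V)) (proj K x₂)
    fun x hx => hV.mem_nhds (hxV hx)
  refine Filter.disjoint_iff.2 ⟨_, hyU, _, hyV, disjoint_left.2 fun y hy₁ hy₂ => ?_⟩
  obtain ⟨z, rfl⟩ := surjective_proj y
  exact disjoint_left.1 hUV (hy₁ z rfl) (hy₂ z rfl)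

lemma locallyCompactSpace_collapse [T2Space X] [LocallyCompactSpace X] (hK : IsCompact K) :
    LocallyCompactSpace (Collapse K) := by
  have := t2Space_collapse hK
  have : WeaklyLocallyCompactSpace (Collapse K) := by
    refine ⟨fun y => ?_⟩
    obtain ⟨x, rfl⟩ := surjective_proj y
    obtain ⟨L, hL, hKL⟩ := exists_compact_superset (hK.union (isCompact_singleton (x := x)))
    refine ⟨proj K '' L, hL.image continuous_proj, ?_⟩
    have hsat : IsSaturated K (interior L) := Or.inr (subset_union_left.trans hKL)
    exact mem_of_superset ((hsat.isOpen_image isOpen_interior).mem_nhds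
      (mem_image_of_mem _ (hKL (Or.inr rfl)))) (image_mono interior_subset)
  infer_instance

lemma isTopologicalBasis_collapse {ℬ : Set (Set X)} (hopen : ∀ V ∈ ℬ, IsOpen V)
    (hsat : ∀ V ∈ ℬ, IsSaturated K V)
    (hpt : ∀ x ∉ K, ∀ N, IsOpen N → x ∈ N → ∃ V ∈ ℬ, x ∈ V ∧ V ⊆ N)
    (hK : ∀ N, IsOpen N → K ⊆ N → ∃ V ∈ ℬ, K ⊆ V ∧ V ⊆ N) :
    TopologicalSpace.IsTopologicalBasis ((fun V => proj K '' V) '' ℬ) := by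
  refine TopologicalSpace.isTopologicalBasis_of_isOpen_of_nhds ?_ fun y N hy hN => ?_
  · rintro _ ⟨V, hV, rfl⟩
    exact (hsat V hV).isOpen_image (hopen V hV)
  · obtain ⟨x, rfl⟩ := surjective_proj y
    have hNo : IsOpen (proj K ⁻¹' N) := hN.preimage continuous_proj
    by_cases hx : x ∈ K
    · obtain ⟨V, hV, hKV, hVN⟩ := hK _ hNo fun z hz => by
        rwa [mem_preimage, proj_eq_of_mem hz hx]
      exact ⟨_, ⟨V, hV, rfl⟩, mem_image_of_mem _ (hKV hx), image_subset_iff.2 hVN⟩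
    · obtain ⟨V, hV, hxV, hVN⟩ := hpt x hx _ hNo hy
      exact ⟨_, ⟨V, hV, rfl⟩, mem_image_of_mem _ hxV, image_subset_iff.2 hVN⟩

lemma measurable_lift [T2Space X] [MeasurableSpace X] [BorelSpace X] (hK : IsCompact K) {k : X}
    (hk : k ∈ K) : Measurable (lift K k) := by
  have := t2Space_collapse hK
  refine measurable_of_continuousOn_compl_singleton (proj K k) fun y hy => ?_
  obtain ⟨x, rfl⟩ := surjective_proj y
  have hx : x ∉ K := fun h => hy (proj_eq_of_mem h hk)
  refine ContinuousAt.continuousWithinAt ?_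
  rw [ContinuousAt, lift_proj_of_notMem k hx]
  intro N hN
  refine eventually_nhds_proj hK.isClosed fun x' hx' => ?_
  obtain rfl : x' = x := (proj_eq_iff.1 hx').resolve_right fun h => hx h.2
  filter_upwards [hN, hK.isClosed.isOpen_compl.mem_nhds hx] with z hz hzK
  rwa [lift_proj_of_notMem k hzK]

end CollapseTopology

section Balls

variable {X : Type*} [TopologicalSpace X] [MeasurableSpace X] {𝒱 : Set (Set X)}
  {H : Set X → Kernel X X} {K O : Set X} {g : X → ℝ} {R r : ℝ}

/-- The open neighborhood `{g < r}` of `K`. -/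
def ball (O : Set X) (g : X → ℝ) (r : ℝ) : Set X := {x ∈ O | g x < r}

namespace IsAnnular

lemma isOpen_ball (ha : IsAnnular 𝒱 H K O g R) (r : ℝ) : IsOpen (ball O g r) :=
  ha.continuousOn.isOpen_inter_preimage ha.isOpen isOpen_Iio

lemma subset_ball (ha : IsAnnular 𝒱 H K O g R) (hr : 0 < r) : K ⊆ ball O g r :=
  fun x hx => ⟨ha.subset hx, (ha.eq_zero x hx).trans_lt hr⟩

lemma isSaturated_ball (ha : IsAnnular 𝒱 H K O g R) (hr : 0 < r) : IsSaturated K (ball O g r) :=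
  Or.inr (ha.subset_ball hr)

lemma exists_ball_subset (ha : IsAnnular 𝒱 H K O g R) (hR : 0 < R) {N : Set X} (hN : IsOpen N)
    (hKN : K ⊆ N) : ∃ c > 0, ∀ r < c, ball O g r ⊆ N := by
  have hL : IsCompact ({x ∈ O | g x ≤ R / 2} \ N) := (ha.isCompact_le _ (by linarith)).diff hN
  obtain ⟨c, hc0, hc⟩ := hL.exists_forall_le' (ha.continuousOn.mono fun x hx => hx.1.1) (a := 0)
    fun x hx => ha.pos x ⟨hx.1.1, fun h => hx.2 (hKN h)⟩
  refine ⟨min c (R / 2), lt_min hc0 (by linarith), fun r hr x hx => ?_⟩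
  obtain ⟨hrc, hrR⟩ := lt_min_iff.1 hr
  by_contra hxN
  linarith [hc x ⟨⟨hx.1, (hx.2.trans hrR).le⟩, hxN⟩, hx.2]

variable [T2Space X]

lemma closure_ball_subset (ha : IsAnnular 𝒱 H K O g R) (hr : r < R) :
    closure (ball O g r) ⊆ {x ∈ O | g x ≤ r} :=
  closure_minimal (fun _ hx => ⟨hx.1, hx.2.le⟩) (ha.isCompact_le r hr).isClosed

lemma secondCountableTopology_collapse [SecondCountableTopology X]
    (ha : IsAnnular 𝒱 H K O g R) (hR : 0 < R) : SecondCountableTopology (Collapse K) := by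
  have hbasis := isTopologicalBasis_collapse (K := K)
    (ℬ := {V ∈ TopologicalSpace.countableBasis X | Disjoint V K} ∪
      range fun n : ℕ => ball O g (1 / ((n : ℝ) + 1))) ?_ ?_ ?_ ?_
  · refine hbasis.secondCountableTopology (Countable.image ?_ _)
    exact ((TopologicalSpace.countable_countableBasis X).mono fun V hV => hV.1).union
      (countable_range _)
  · rintro V (hV | ⟨n, rfl⟩)
    · exact TopologicalSpace.isOpen_of_mem_countableBasis hV.1
    · exact ha.isOpen_ball _
  · rintro V (hV | ⟨n, rfl⟩)
    · exact Or.inl hV.2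
    · exact ha.isSaturated_ball (by positivity)
  · intro x hx N hN hxN
    obtain ⟨V, hV, hxV, hVN⟩ := (TopologicalSpace.isBasis_countableBasis X).mem_nhds_iff.1
      ((hN.sdiff ha.isCompact.isClosed).mem_nhds ⟨hxN, hx⟩)
    exact ⟨V, Or.inl ⟨hV, disjoint_left.2 fun y hy => (hVN hy).2⟩, hxV, fun y hy => (hVN hy).1⟩
  · intro N hN hKN
    obtain ⟨c, hc0, hc⟩ := ha.exists_ball_subset hR hN hKN
    obtain ⟨n, hn⟩ := exists_nat_one_div_lt hc0
    exact ⟨_, Or.inr ⟨n, rfl⟩, ha.subset_ball (by positivity), hc _ hn⟩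

end IsAnnular

end Balls

section ReplaceKernel

variable {X : Type*} [MeasurableSpace X] {K : Set X}

open Classical in
/-- The kernel which replaces points of `K` by the measure `μ`. -/
def replaceKernel (hK : MeasurableSet K) (μ : Measure X) : Kernel X X :=
  Kernel.piecewise hK (Kernel.const X μ) Kernel.id

lemma replaceKernel_of_mem (hK : MeasurableSet K) (μ : Measure X) {x : X} (hx : x ∈ K) :
    replaceKernel hK μ x = μ := by
  classical
  rw [replaceKernel, Kernel.piecewise_apply, if_pos hx, Kernel.const_apply]

lemma replaceKernel_of_notMem (hK : MeasurableSet K) (μ : Measure X) {x : X} (hx : x ∉ K) :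
    replaceKernel hK μ x = Measure.dirac x := by
  classical
  rw [replaceKernel, Kernel.piecewise_apply, if_neg hx, Kernel.id_apply]

instance (hK : MeasurableSet K) (μ : Measure X) [IsProbabilityMeasure μ] :
    IsMarkovKernel (replaceKernel hK μ) := by
  refine ⟨fun x => ?_⟩
  by_cases hx : x ∈ K
  · rwa [replaceKernel_of_mem hK μ hx]
  · rw [replaceKernel_of_notMem hK μ hx]
    infer_instance

lemma replaceKernel_comp (hK : MeasurableSet K) (μ ρ : Measure X) :
    replaceKernel hK μ ∘ₘ ρ = ρ K • μ + ρ.restrict Kᶜ := by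
  ext B hB
  rw [Measure.bind_apply hB (Kernel.aemeasurable _), ← lintegral_add_compl _ hK,
    setLIntegral_congr_fun (g := fun _ => μ B) hK fun x hx => by
      simp only [replaceKernel_of_mem hK μ hx],
    setLIntegral_congr_fun (g := B.indicator 1) hK.compl fun x hx => by
      simp only [replaceKernel_of_notMem hK μ hx, Measure.dirac_apply' _ hB],
    setLIntegral_const, lintegral_indicator_one hB, Measure.add_apply, Measure.smul_apply,
    smul_eq_mul, mul_comm]

end ReplaceKernel

lemma IsBoundaryKernel.comp_self {X : Type*} [TopologicalSpace X] [MeasurableSpace X]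
    {U : Set X} {T : Kernel X X} (hT : IsBoundaryKernel U T) (hU : IsOpen U) : T ∘ₖ T = T := by
  ext1 x
  rw [Kernel.comp_apply]
  by_cases hx : x ∈ U
  · have hae : ∀ᵐ y ∂T x, y ∈ frontier U := hT.1 x hx
    refine (Measure.bind_congr_right (g := Measure.dirac) ?_).trans Measure.bind_dirac
    filter_upwards [hae] with y hy using hT.2 y (hU.frontier_eq ▸ hy).2
  · rw [hT.2 x hx, Measure.dirac_bind T.measurable, hT.2 x hx]

lemma exists_continuous_eqOn_and_eq_const {Y : Type*} [TopologicalSpace Y] [NormalSpace Y]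
    {A B : Set Y} (hA : IsClosed A) (hB : IsClosed B) (hAB : Disjoint A B) {f : Y → ℝ}
    (hf : Continuous f) (c : ℝ) :
    ∃ F : Y → ℝ, Continuous F ∧ EqOn F f A ∧ ∀ y ∈ B, F y = c := by
  obtain ⟨φ, hφA, hφB, -⟩ := exists_continuous_zero_one_of_isClosed hA hB hAB
  refine ⟨fun y => f y + φ y * (c - f y), by fun_prop, fun y hy => ?_, fun y hy => ?_⟩
  · simp [hφA hy]
  · simp [hφB hy]

section BallKernel

lemma mem_annulus_of_mem_ball {X : Type*} {K O : Set X} {g : X → ℝ} {r : ℝ} {x : X}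
    (hx : x ∈ ball O g r) (hxK : x ∉ K) : x ∈ annulus O K g r :=
  ⟨⟨hx.1, hxK⟩, hx.2⟩

variable {X : Type*} [TopologicalSpace X] [MeasurableSpace X] {𝒱 : Set (Set X)}
  {H : Set X → Kernel X X} {K O : Set X} {g : X → ℝ} {R r s : ℝ}

variable (𝒱 H O g) in
/-- The boundary kernel for the neighborhood `{g < r}` of `K` obtained by restarting with `μ`
on `K`. -/
def ballKernel (hK : MeasurableSet K) (r : ℝ) (μ : Measure X) : Kernel X X :=
  replaceKernel hK μ ∘ₖ harmonicKernel 𝒱 H (annulus O K g r)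

lemma integral_ballKernel (hK : MeasurableSet K) (μ : Measure X) {f : X → ℝ} {x : X}
    (hf : Integrable f (ballKernel 𝒱 H O g hK r μ x)) :
    ∫ y, f y ∂(ballKernel 𝒱 H O g hK r μ x) =
      ∫ y, ∫ z, f z ∂(replaceKernel hK μ y) ∂(harmonicKernel 𝒱 H (annulus O K g r) x) :=
  Kernel.integral_comp hf

namespace IsAnnular

lemma frontier_annulus_inter_level_subset (ha : IsAnnular 𝒱 H K O g R) :
    frontier (annulus O K g r) ∩ level O K g r ⊆ frontier (ball O g r) := by
  rintro x ⟨hx, hxS⟩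
  rw [(ha.isOpen_ball r).frontier_eq]
  have hsub : annulus O K g r ⊆ ball O g r := fun y hy => ⟨hy.1.1, hy.2⟩
  exact ⟨closure_mono hsub (frontier_subset_closure hx), fun h => h.2.ne hxS.2⟩

lemma measurableSet [T2Space X] [OpensMeasurableSpace X] (ha : IsAnnular 𝒱 H K O g R) :
    MeasurableSet K :=
  ha.isCompact.measurableSet

variable [T2Space X] [LocallyCompactSpace X] [SecondCountableTopology X] [BorelSpace X]

lemma isMarkovKernel_ballKernel (hH : IsNormalBauerFamily 𝒱 H) (ha : IsAnnular 𝒱 H K O g R)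
    (hr : r < R) (μ : Measure X) [IsProbabilityMeasure μ] :
    IsMarkovKernel (ballKernel 𝒱 H O g ha.measurableSet r μ) := by
  have := (ha.isRegular_annulus hH hr).isMarkovKernel hH
  unfold ballKernel
  infer_instance

lemma ballKernel_of_notMem_annulus (hH : IsNormalBauerFamily 𝒱 H) (ha : IsAnnular 𝒱 H K O g R)
    (hr : r < R) (μ : Measure X) {x : X} (hx : x ∉ annulus O K g r) :
    ballKernel 𝒱 H O g ha.measurableSet r μ x = replaceKernel ha.measurableSet μ x := by
  rw [ballKernel, Kernel.comp_apply, (ha.isRegular_annulus hH hr).eq_dirac hH hx,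
    Measure.dirac_bind (Kernel.measurable _)]

lemma ballKernel_of_mem (hH : IsNormalBauerFamily 𝒱 H) (ha : IsAnnular 𝒱 H K O g R)
    (hr : r < R) (μ : Measure X) {x : X} (hx : x ∈ K) :
    ballKernel 𝒱 H O g ha.measurableSet r μ x = μ := by
  rw [ha.ballKernel_of_notMem_annulus hH hr μ fun h => h.1.2 hx, replaceKernel_of_mem _ _ hx]

lemma ballKernel_comp_kernel (hH : IsNormalBauerFamily 𝒱 H) (ha : IsAnnular 𝒱 H K O g R)
    (hr : r < R) (μ : Measure X) {V : Set X} (hV : V ∈ 𝒱) (hVA : V ⊆ annulus O K g r) :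
    ballKernel 𝒱 H O g ha.measurableSet r μ ∘ₖ H V = ballKernel 𝒱 H O g ha.measurableSet r μ := by
  obtain ⟨P, hP, hOP⟩ := ha.exists_isPSet
  rw [ballKernel, Kernel.comp_assoc, (ha.isRegular_annulus hH hr).comp_kernel_eq hH hP
    (fun x hx => hOP hx.1.1) hV hVA]

lemma abs_integral_harmonicKernel_annulus_sub_le (hH : IsNormalBauerFamily 𝒱 H)
    (ha : IsAnnular 𝒱 H K O g R) (hr0 : 0 < r) (hr : r < R) {φ : X → ℝ} (hφ : Measurable φ)
    {c C : ℝ} (hφC : ∀ x, |φ x| ≤ C) (hcC : |c| ≤ C) (hφK : ∀ x ∈ K, φ x = c) {x : X}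
    (hx : x ∈ ball O g r) :
    |∫ y, φ y ∂(harmonicKernel 𝒱 H (annulus O K g r) x) - c| ≤ 2 * C * (g x / r) := by
  have hreg := ha.isRegular_annulus hH hr
  have := hreg.isMarkovKernel hH
  by_cases hxK : x ∈ K
  · rw [hreg.eq_dirac hH fun h => h.1.2 hxK, integral_dirac, hφK x hxK, ha.eq_zero x hxK]
    simp
  have hxA := mem_annulus_of_mem_ball hx hxK
  have hS := (ha.isCompact_level hr0 hr).measurableSet
  have hφi : Integrable φ (harmonicKernel 𝒱 H (annulus O K g r) x) :=
    integrable_of_measurable_of_abs_le hφ hφC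
  have hconst : ∫ y, (level O K g r).indicator (fun _ => 2 * C) y
      ∂(harmonicKernel 𝒱 H (annulus O K g r) x) = 2 * C * (g x / r) := by
    rw [integral_indicator hS, setIntegral_const, Measure.real, ha.measure_level hH hr0 hr hxA,
      ENNReal.toReal_ofReal (div_nonneg (ha.pos x hxA.1).le hr0.le), smul_eq_mul, mul_comm]
  have hsub : ∫ y, φ y ∂(harmonicKernel 𝒱 H (annulus O K g r) x) - c =
      ∫ y, (φ y - c) ∂(harmonicKernel 𝒱 H (annulus O K g r) x) := by
    rw [integral_sub hφi (integrable_const _), integral_const, probReal_univ, one_smul]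
  rw [hsub, ← hconst]
  refine abs_integral_le_integral_abs.trans (integral_mono_ae (hφi.sub (integrable_const _)).abs
    ((integrable_const _).indicator hS) ?_)
  filter_upwards [hreg.ae_mem_frontier hH hxA] with y hy
  rcases ha.frontier_annulus_subset hr hy with h | h
  · rw [indicator_of_notMem fun h' => h'.1.2 h, hφK y h, sub_self, abs_zero]
  · rw [indicator_of_mem h, two_mul]
    exact (abs_sub _ _).trans (add_le_add (hφC y) hcC)

lemma continuousOn_integral_ballKernel (hH : IsNormalBauerFamily 𝒱 H)
    (ha : IsAnnular 𝒱 H K O g R) (hr0 : 0 < r) (hr : r < R) (μ : Measure X)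
    [IsProbabilityMeasure μ] {f : X → ℝ} (hf : Measurable f) {C : ℝ} (hC : ∀ x, |f x| ≤ C) :
    ContinuousOn (fun x => ∫ y, f y ∂(ballKernel 𝒱 H O g ha.measurableSet r μ x))
      (ball O g r) := by
  obtain ⟨P, hP, hOP⟩ := ha.exists_isPSet
  have hreg := ha.isRegular_annulus hH hr
  have := ha.isMarkovKernel_ballKernel hH hr μ
  set φ : X → ℝ := fun y => ∫ z, f z ∂(replaceKernel ha.measurableSet μ y) with hφ
  have hφm : Measurable φ := measurable_integral_kernel _ hf
  have hφC : ∀ y, |φ y| ≤ C := fun y => abs_integral_le_of_abs_le hC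
  refine ContinuousOn.congr (f := fun x => ∫ y, φ y ∂(harmonicKernel 𝒱 H (annulus O K g r) x)) ?_
    fun x _ => integral_ballKernel _ μ (integrable_of_measurable_of_abs_le hf hC)
  intro x hx
  refine ContinuousAt.continuousWithinAt ?_
  by_cases hxK : x ∈ K
  · have hφK : ∀ y ∈ K, φ y = ∫ y, f y ∂μ := fun y hy => by
      simp only [hφ, replaceKernel_of_mem ha.measurableSet μ hy]
    have hval : ∫ y, φ y ∂(harmonicKernel 𝒱 H (annulus O K g r) x) = ∫ y, f y ∂μ := by
      rw [hreg.eq_dirac hH fun h => h.1.2 hxK, integral_dirac, hφK x hxK]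
    have hg : Tendsto (fun y => 2 * C * (g y / r)) (𝓝 x) (𝓝 0) := by
      have hgx : Tendsto g (𝓝 x) (𝓝 0) := by
        simpa only [ha.eq_zero x hxK] using
          (ha.continuousOn.continuousAt (ha.isOpen.mem_nhds (ha.subset hxK))).tendsto
      simpa using (hgx.div_const r).const_mul (2 * C)
    rw [ContinuousAt, hval, tendsto_iff_dist_tendsto_zero]
    refine squeeze_zero' (Eventually.of_forall fun y => dist_nonneg) ?_ hg
    filter_upwards [(ha.isOpen_ball r).mem_nhds hx] with y hy
      using ha.abs_integral_harmonicKernel_annulus_sub_le hH hr0 hr hφm hφC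
        (abs_integral_le_of_abs_le hC) hφK hy
  · exact (hreg.continuousOn_integral hH hP (fun x hx => hOP hx.1.1) hφm hφC).continuousAt
      (hreg.1.mem_nhds (mem_annulus_of_mem_ball hx hxK))

variable {σ : ℝ → ProbabilityMeasure X}

lemma ae_mem_frontier_ball (hH : IsNormalBauerFamily 𝒱 H) (ha : IsAnnular 𝒱 H K O g R)
    (hσ : IsCompatibleFamily 𝒱 H K O g R σ) (hr0 : 0 < r) (hr : r < R) :
    ∀ᵐ y ∂(σ r : Measure X), y ∈ frontier (ball O g r) := by
  have hr2 : 0 < r / 2 := by linarith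
  have hlt : r / 2 < r := by linarith
  have hσ2 := hσ.compl_level (r / 2) ⟨hr2, hlt.trans hr⟩
  have hae2 : ∀ᵐ x ∂(σ (r / 2) : Measure X), x ∈ level O K g (r / 2) := hσ2
  have hswept : ∀ᵐ y ∂(harmonicKernel 𝒱 H (annulus O K g r) ∘ₘ (σ (r / 2) : Measure X)),
      y ∈ frontier (annulus O K g r) := by
    refine Measure.ae_comp_of_ae_ae isClosed_frontier.measurableSet ?_
    filter_upwards [hae2] with x hx
      using (ha.isRegular_annulus hH hr).ae_mem_frontier hH (level_subset_annulus hlt hx)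
  have hfrontier : ∀ᵐ y ∂(σ r : Measure X), y ∈ frontier (annulus O K g r) := by
    rw [← hσ.sweep_eq _ _ hr2 hlt hr, ha.coe_sweep hH hr2 hlt hr hσ2, sweepMeasure]
    exact Measure.ae_smul_measure (ae_restrict_of_ae hswept) _
  have hlevel : ∀ᵐ y ∂(σ r : Measure X), y ∈ level O K g r := hσ.compl_level r ⟨hr0, hr⟩
  filter_upwards [hfrontier, hlevel] with y hy hyS
    using ha.frontier_annulus_inter_level_subset ⟨hy, hyS⟩

lemma isBoundaryKernel_ballKernel (hH : IsNormalBauerFamily 𝒱 H) (ha : IsAnnular 𝒱 H K O g R)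
    (hσ : IsCompatibleFamily 𝒱 H K O g R σ) (hr0 : 0 < r) (hr : r < R) :
    IsBoundaryKernel (ball O g r) (ballKernel 𝒱 H O g ha.measurableSet r (σ r)) := by
  have hσfr := ha.ae_mem_frontier_ball hH hσ hr0 hr
  refine ⟨fun x hx => ?_, fun x hx => ?_⟩
  · by_cases hxK : x ∈ K
    · rw [ha.ballKernel_of_mem hH hr _ hxK]
      exact hσfr
    · refine Measure.ae_comp_of_ae_ae isClosed_frontier.measurableSet ?_
      filter_upwards [(ha.isRegular_annulus hH hr).ae_mem_frontier hH
        (mem_annulus_of_mem_ball hx hxK)] with y hy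
      by_cases hyK : y ∈ K
      · rwa [replaceKernel_of_mem _ _ hyK]
      · rw [replaceKernel_of_notMem _ _ hyK, ae_dirac_iff isClosed_frontier.measurableSet]
        exact ha.frontier_annulus_inter_level_subset
          ⟨hy, (ha.frontier_annulus_subset hr hy).resolve_left hyK⟩
  · rw [ha.ballKernel_of_notMem_annulus hH hr _ fun h => hx ⟨h.1.1, h.2⟩,
      replaceKernel_of_notMem _ _ fun h => hx (ha.subset_ball hr0 h)]

-- `σ_s H_{A_r} = (s/r) σ_r` on `S_r`, and the remaining mass `1 - s/r` sits on `K`, from where it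
-- is restarted with `σ_r`.
lemma ballKernel_comp_measure (hH : IsNormalBauerFamily 𝒱 H) (ha : IsAnnular 𝒱 H K O g R)
    (hσ : IsCompatibleFamily 𝒱 H K O g R σ) (hs : 0 < s) (hsr : s < r) (hr : r < R) :
    ballKernel 𝒱 H O g ha.measurableSet r (σ r) ∘ₘ (σ s : Measure X) = σ r := by
  have := (ha.isRegular_annulus hH hr).isMarkovKernel hH
  set ρ := harmonicKernel 𝒱 H (annulus O K g r) ∘ₘ (σ s : Measure X) with hρ
  have hρK : ρ.restrict Kᶜ = ENNReal.ofReal (s / r) • (σ r : Measure X) := by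
    rw [← hσ.restrict_comp_eq hH ha hs hsr hr, Measure.restrict_congr_set]
    filter_upwards [ha.ae_comp_mem_union_level hH hs hsr hr
      (hσ.compl_level s ⟨hs, hsr.trans hr⟩)] with y hy
    exact propext ⟨fun h => hy.resolve_left h, fun h => h.1.2⟩
  have hmass : ρ K + ENNReal.ofReal (s / r) = 1 := by
    have hKc := congrArg (fun m : Measure X => m univ) hρK
    simp only [Measure.restrict_apply_univ, Measure.smul_apply, measure_univ, smul_eq_mul,
      mul_one] at hKc
    rw [← hKc, prob_add_prob_compl ha.measurableSet]
  rw [ballKernel, ← Measure.comp_assoc, ← hρ, replaceKernel_comp, hρK, ← add_smul, hmass, one_smul]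

lemma ballKernel_comp_ballKernel (hH : IsNormalBauerFamily 𝒱 H) (ha : IsAnnular 𝒱 H K O g R)
    (hσ : IsCompatibleFamily 𝒱 H K O g R σ) (hs : 0 < s) (hsr : s ≤ r) (hr : r < R) :
    ballKernel 𝒱 H O g ha.measurableSet r (σ r) ∘ₖ ballKernel 𝒱 H O g ha.measurableSet s (σ s) =
      ballKernel 𝒱 H O g ha.measurableSet r (σ r) := by
  rcases hsr.eq_or_lt with rfl | hlt
  · exact (ha.isBoundaryKernel_ballKernel hH hσ hs hr).comp_self (ha.isOpen_ball s)
  have hreplace : ballKernel 𝒱 H O g ha.measurableSet r (σ r) ∘ₖ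
      replaceKernel ha.measurableSet (σ s) = ballKernel 𝒱 H O g ha.measurableSet r (σ r) := by
    ext1 x
    rw [Kernel.comp_apply]
    by_cases hx : x ∈ K
    · rw [replaceKernel_of_mem _ _ hx, ha.ballKernel_of_mem hH hr _ hx,
        ha.ballKernel_comp_measure hH hσ hs hlt hr]
    · rw [replaceKernel_of_notMem _ _ hx, Measure.dirac_bind (Kernel.measurable _)]
  nth_rw 2 [ballKernel]
  rw [← Kernel.comp_assoc, hreplace, ballKernel, Kernel.comp_assoc,
    (ha.isRegular_annulus hH hr).comp_harmonicKernel_eq hH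
      (ha.isRegular_annulus hH (hlt.trans hr)) fun x hx => ⟨hx.1, hx.2.trans hlt⟩]

lemma integrable_ballKernel (hH : IsNormalBauerFamily 𝒱 H) (ha : IsAnnular 𝒱 H K O g R)
    (hσ : IsCompatibleFamily 𝒱 H K O g R σ) (hr0 : 0 < r) (hr : r < R) {f : X → ℝ}
    (hf : Continuous f) (x : X) :
    Integrable f (ballKernel 𝒱 H O g ha.measurableSet r (σ r) x) := by
  have := ha.isMarkovKernel_ballKernel hH hr (σ r)
  have hbk := ha.isBoundaryKernel_ballKernel hH hσ hr0 hr
  by_cases hx : x ∈ ball O g r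
  · have hcompact : IsCompact (frontier (ball O g r)) :=
      (ha.isCompact_le r hr).of_isClosed_subset isClosed_frontier
        (frontier_subset_closure.trans (ha.closure_ball_subset hr))
    have hae : ∀ᵐ y ∂(ballKernel 𝒱 H O g ha.measurableSet r (σ r) x),
      y ∈ frontier (ball O g r) := hbk.1 x hx
    rw [← Measure.restrict_eq_self_of_ae_mem hae]
    exact hf.continuousOn.integrableOn_compact hcompact
  · rw [hbk.2 x hx]
    exact integrable_dirac (by simp)

lemma continuous_integral_ballKernel (hH : IsNormalBauerFamily 𝒱 H) (ha : IsAnnular 𝒱 H K O g R)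
    (hσ : IsCompatibleFamily 𝒱 H K O g R σ) (hr0 : 0 < r) (hr : r < R)
    {f : X → ℝ} (hf : Continuous f) :
    Continuous fun x => ∫ y, f y ∂(ballKernel 𝒱 H O g ha.measurableSet r (σ r) x) := by
  have hreg := ha.isRegular_annulus hH hr
  obtain ⟨F, hF, hFf, hFK⟩ := exists_continuous_eqOn_and_eq_const
    (ha.isOpen_ball r).isClosed_compl ha.isCompact.isClosed
    (disjoint_compl_left_iff_subset.2 (ha.subset_ball hr0)) hf (∫ y, f y ∂(σ r : Measure X))
  have hFeq : ∀ x ∉ annulus O K g r,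
      ∫ z, f z ∂(replaceKernel ha.measurableSet (σ r : Measure X) x) = F x := by
    intro x hx
    by_cases hxK : x ∈ K
    · rw [replaceKernel_of_mem _ _ hxK, hFK x hxK]
    · rw [replaceKernel_of_notMem _ _ hxK, integral_dirac,
        hFf fun h => hx (mem_annulus_of_mem_ball h hxK)]
  refine (hreg.continuous_integral hH hF).congr fun x => ?_
  rw [integral_ballKernel _ _ (ha.integrable_ballKernel hH hσ hr0 hr hf x)]
  by_cases hx : x ∈ annulus O K g r
  · refine integral_congr_ae ?_
    filter_upwards [hreg.ae_mem_frontier hH hx] with y hy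
    exact (hFeq y (hreg.1.frontier_eq ▸ hy).2).symm
  · simp only [hreg.eq_dirac hH hx, integral_dirac, hFeq x hx]

end IsAnnular

end BallKernel

section ExtendedIntegral

variable {X : Type*} [MeasurableSpace X] {μ : Measure X}

lemma eintegral_congr_ae {u v : X → EReal} (h : u =ᵐ[μ] v) : eintegral μ u = eintegral μ v := by
  have hpos : ∫⁻ y, (u y).toENNReal ∂μ = ∫⁻ y, (v y).toENNReal ∂μ :=
    lintegral_congr_ae (h.mono fun y hy => by simp only [hy])
  have hneg : ∫⁻ y, (-u y).toENNReal ∂μ = ∫⁻ y, (-v y).toENNReal ∂μ :=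
    lintegral_congr_ae (h.mono fun y hy => by simp only [hy])
  rw [eintegral, eintegral, hpos, hneg]

lemma eintegral_mono_of_nonneg {u v : X → EReal} (hu : ∀ᵐ y ∂μ, 0 ≤ u y)
    (huv : ∀ᵐ y ∂μ, u y ≤ v y) : eintegral μ u ≤ eintegral μ v := by
  rw [eintegral_of_nonneg hu,
    eintegral_of_nonneg (by filter_upwards [hu, huv] with y hy hyv using hy.trans hyv)]
  exact EReal.coe_ennreal_le_coe_ennreal_iff.2
    (lintegral_mono_ae (huv.mono fun y => EReal.toENNReal_le_toENNReal))

lemma eintegral_coe {w : X → ℝ} (hw : Integrable w μ) (h0 : ∀ x, 0 ≤ w x) :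
    eintegral μ (fun x => (w x : EReal)) = ((∫ x, w x ∂μ : ℝ) : EReal) := by
  rw [eintegral_of_nonneg (ae_of_all _ fun x => EReal.coe_nonneg.2 (h0 x))]
  simp only [EReal.toENNReal_of_ne_top (EReal.coe_ne_top _), EReal.toReal_coe]
  rw [← ofReal_integral_eq_lintegral_ofReal hw (ae_of_all _ h0), EReal.coe_ennreal_ofReal,
    max_eq_left (integral_nonneg h0)]

lemma eintegral_map {Y : Type*} [MeasurableSpace Y] {f : X → Y} (hf : Measurable f)
    {u : Y → EReal} (hu : Measurable u) : eintegral (μ.map f) u = eintegral μ (u ∘ f) := by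
  have hpos := lintegral_map (μ := μ) (measurable_ereal_toENNReal.comp hu) hf
  have hneg := lintegral_map (μ := μ) (measurable_ereal_toENNReal.comp hu.neg) hf
  exact congrArg₂ (fun a b : ℝ≥0∞ => (a : EReal) - b) hpos hneg

lemma integrable_of_nonneg_of_le [IsFiniteMeasure μ] {v : X → ℝ} {C : ℝ}
    (hv : Measurable v) (h0 : ∀ x, 0 ≤ v x) (hC : ∀ x, v x ≤ C) : Integrable v μ :=
  integrable_of_measurable_of_abs_le hv fun x => by rw [abs_of_nonneg (h0 x)]; exact hC x

lemma integral_le_of_nonneg_of_le [IsProbabilityMeasure μ] {v : X → ℝ} {C : ℝ}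
    (h0 : ∀ x, 0 ≤ v x) (hC : ∀ x, v x ≤ C) : ∫ x, v x ∂μ ≤ C :=
  (abs_le.1 (abs_integral_le_of_abs_le fun x => by rw [abs_of_nonneg (h0 x)]; exact hC x)).2

end ExtendedIntegral

lemma lowerSemicontinuous_indicator_of_nonneg {X α : Type*} [TopologicalSpace X] [Preorder α]
    [Zero α] {u : X → α} {P : Set X} (hP : IsOpen P) (hu : LowerSemicontinuousOn u P)
    (hpos : ∀ x ∈ P, 0 ≤ u x) : LowerSemicontinuous (P.indicator u) := by
  intro x t ht
  by_cases hx : x ∈ P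
  · rw [indicator_of_mem hx] at ht
    have hev := hu x hx t ht
    rw [hP.nhdsWithin_eq hx] at hev
    filter_upwards [hev, hP.mem_nhds hx] with y hy hyP
    rwa [indicator_of_mem hyP]
  · rw [indicator_of_notMem hx] at ht
    filter_upwards with y
    exact ht.trans_le (indicator_nonneg hpos y)

section Truncation

variable {X : Type*} {P : Set X} {u : X → EReal} {C : ℝ} {x : X}

/-- The truncation `min u C` on `P`, as a real function, extended by `0` to all of `X`. -/
def truncation (P : Set X) (u : X → EReal) (C : ℝ) (x : X) : ℝ := (min (P.indicator u x) C).toReal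

lemma coe_truncation (hpos : ∀ x ∈ P, 0 ≤ u x) (hC : 0 ≤ C) (x : X) :
    (truncation P u C x : EReal) = min (P.indicator u x) C :=
  EReal.coe_toReal ((min_le_right _ _).trans_lt (EReal.coe_lt_top C)).ne
    (EReal.bot_lt_zero.trans_le (le_min (indicator_nonneg hpos x) (EReal.coe_nonneg.2 hC))).ne'

lemma coe_truncation_of_mem (hpos : ∀ x ∈ P, 0 ≤ u x) (hC : 0 ≤ C) (hx : x ∈ P) :
    (truncation P u C x : EReal) = min (u x) C := by
  rw [coe_truncation hpos hC, indicator_of_mem hx]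

lemma truncation_nonneg (hpos : ∀ x ∈ P, 0 ≤ u x) (hC : 0 ≤ C) (x : X) :
    0 ≤ truncation P u C x := by
  rw [← EReal.coe_nonneg, coe_truncation hpos hC]
  exact le_min (indicator_nonneg hpos x) (EReal.coe_nonneg.2 hC)

lemma truncation_le (hpos : ∀ x ∈ P, 0 ≤ u x) (hC : 0 ≤ C) (x : X) : truncation P u C x ≤ C := by
  rw [← EReal.coe_le_coe_iff, coe_truncation hpos hC]
  exact min_le_right _ _

lemma lowerSemicontinuous_truncation [TopologicalSpace X] (hP : IsOpen P)
    (hu : LowerSemicontinuousOn u P) (hpos : ∀ x ∈ P, 0 ≤ u x) (hC : 0 ≤ C) :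
    LowerSemicontinuous (truncation P u C) := by
  intro x t ht
  change t < _ at ht
  rw [← EReal.coe_lt_coe_iff, coe_truncation hpos hC, lt_min_iff] at ht
  filter_upwards [lowerSemicontinuous_indicator_of_nonneg hP hu hpos x t ht.1] with y hy
  change t < _
  rw [← EReal.coe_lt_coe_iff, coe_truncation hpos hC]
  exact lt_min hy ht.2

end Truncation

section BoundedSuperharmonic

variable {X : Type*} [TopologicalSpace X] [MeasurableSpace X] {𝒱 : Set (Set X)}
  {H : Set X → Kernel X X} {P U : Set X} {u : X → EReal} {v : X → ℝ} {C : ℝ} {x : X}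

/-- `v` is positive, lower semicontinuous and bounded by `C` on all of `X`, and satisfies the mean
value inequality for the sets of the base with closure in `U`; such are the truncations of positive
hyperharmonic functions on `U`, extended by `0`. -/
structure IsBoundedSuperharmonic (𝒱 : Set (Set X)) (H : Set X → Kernel X X) (U : Set X) (v : X → ℝ)
    (C : ℝ) : Prop where
  lowerSemicontinuous : LowerSemicontinuous v
  nonneg : ∀ x, 0 ≤ v x
  le : ∀ x, v x ≤ C
  integral_le : ∀ W ∈ 𝒱, closure W ⊆ U → ∀ x ∈ W, ∫ y, v y ∂(H W x) ≤ v x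

lemma IsBoundedSuperharmonic.mono (hv : IsBoundedSuperharmonic 𝒱 H P v C) (hUP : U ⊆ P) :
    IsBoundedSuperharmonic 𝒱 H U v C :=
  ⟨hv.lowerSemicontinuous, hv.nonneg, hv.le, fun W hW hWU => hv.integral_le W hW (hWU.trans hUP)⟩

lemma isBoundedSuperharmonic_zero : IsBoundedSuperharmonic 𝒱 H U (fun _ => 0) 0 :=
  ⟨lowerSemicontinuous_const, fun _ => le_rfl, fun _ => le_rfl, fun _ _ _ _ _ =>
    (integral_zero X ℝ).le⟩

lemma IsHyperharmonicOn.isBoundedSuperharmonic_truncation [OpensMeasurableSpace X]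
    (hH : IsNormalBauerFamily 𝒱 H) (hP : IsOpen P)
    (hu : IsHyperharmonicOn H (fullChoice 𝒱 P) u P) (hpos : ∀ x ∈ P, 0 ≤ u x) (hC : 0 ≤ C) :
    IsBoundedSuperharmonic 𝒱 H P (truncation P u C) C := by
  have h0 := truncation_nonneg hpos hC
  have hle := truncation_le hpos hC
  have hlsc := lowerSemicontinuous_truncation hP hu.1 hpos hC
  refine ⟨hlsc, h0, hle, fun W hW hWP x hx => ?_⟩
  have := hH.isMarkovKernel hW
  have hxP : x ∈ P := hWP (subset_closure hx)
  rw [← EReal.coe_le_coe_iff, coe_truncation_of_mem hpos hC hxP]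
  refine le_min ?_ (EReal.coe_le_coe_iff.2 (integral_le_of_nonneg_of_le h0 hle))
  calc ((∫ y, truncation P u C y ∂(H W x) : ℝ) : EReal)
      = eintegral (H W x) fun y => truncation P u C y :=
        (eintegral_coe (integrable_of_nonneg_of_le hlsc.measurable h0 hle) h0).symm
    _ ≤ eintegral (H W x) u := by
        refine eintegral_mono_of_nonneg (ae_of_all _ fun y => EReal.coe_nonneg.2 (h0 y)) ?_
        filter_upwards [hH.ae_mem_frontier hW hx] with y hy
        rw [coe_truncation_of_mem hpos hC (hWP (frontier_subset_closure hy))]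
        exact min_le_left _ _
    _ ≤ u x := hu.2.2 x hxP W ⟨hW, hWP, hx⟩

lemma IsPSet.exists_isBoundedSuperharmonic_ne [OpensMeasurableSpace X]
    (hH : IsNormalBauerFamily 𝒱 H) (hP : IsPSet 𝒱 H P) {x' : X} (hx : x ∈ P) (hx' : x' ∈ P)
    (hne : x ≠ x') : ∃ v C, IsBoundedSuperharmonic 𝒱 H P v C ∧ v x ≠ v x' := by
  obtain ⟨u, hu, hpos, hux⟩ := hP.2 x hx x' hx' hne
  obtain ⟨C, hminC, hCmax⟩ := EReal.lt_iff_exists_real_btwn.1 (min_lt_max.2 hux)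
  have hC : 0 ≤ C := EReal.coe_nonneg.1 ((le_min (hpos x hx) (hpos x' hx')).trans hminC.le)
  refine ⟨_, C, hu.isBoundedSuperharmonic_truncation hH hP.1 hpos hC, fun h => ?_⟩
  have hmin : min (u x) C = min (u x') C := by
    rw [← coe_truncation_of_mem hpos hC hx, ← coe_truncation_of_mem hpos hC hx', h]
  rcases min_lt_iff.1 hminC with hlt | hlt <;> rcases lt_max_iff.1 hCmax with hgt | hgt
  · exact hlt.not_gt hgt
  · rw [min_eq_left hlt.le, min_eq_right hgt.le] at hmin
    exact hlt.ne hmin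
  · rw [min_eq_left hlt.le, min_eq_right hgt.le] at hmin
    exact hlt.ne hmin.symm
  · exact hlt.not_gt hgt

end BoundedSuperharmonic

section CollapseKernel

variable {X : Type*} [TopologicalSpace X] [MeasurableSpace X] {K : Set X}

lemma measurable_proj [OpensMeasurableSpace X] : Measurable (proj K) :=
  continuous_proj.measurable

/-- The kernel `H₀ (proj K '' V)` on `X₀` is induced by the boundary kernel `T` for the saturated
set `V`, which has the regularity properties required of the kernels of a normal Bauer family. -/
structure Represents (H₀ : Set (Collapse K) → Kernel (Collapse K) (Collapse K)) (V : Set X)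
    (T : Kernel X X) : Prop where
  isOpen : IsOpen V
  isSaturated : IsSaturated K V
  isCompact_closure : IsCompact (closure V)
  isMarkovKernel : IsMarkovKernel T
  isBoundaryKernel : IsBoundaryKernel V T
  continuous_integral : ∀ f : X → ℝ, Continuous f → Continuous fun x => ∫ y, f y ∂(T x)
  continuousOn_integral : ∀ f : X → ℝ, Measurable f → (∃ C : ℝ, ∀ x, |f x| ≤ C) →
    ContinuousOn (fun x => ∫ y, f y ∂(T x)) V
  map_eq : ∀ x, H₀ (proj K '' V) (proj K x) = (T x).map (proj K)

namespace Represents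

variable {H₀ : Set (Collapse K) → Kernel (Collapse K) (Collapse K)} {V W : Set X}
  {T T' : Kernel X X}

lemma isCompact_closure_image (hK : IsClosed K) (hT : Represents H₀ V T) :
    IsCompact (closure (proj K '' V)) := by
  rw [(isClosedMap_proj hK).closure_image_eq_of_continuous continuous_proj]
  exact hT.isCompact_closure.image continuous_proj

variable [OpensMeasurableSpace X]

lemma integral_eq (hT : Represents H₀ V T) {f : Collapse K → ℝ} (hf : Measurable f) (x : X) :
    ∫ y, f y ∂(H₀ (proj K '' V) (proj K x)) = ∫ y, f (proj K y) ∂(T x) := by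
  rw [hT.map_eq, integral_map measurable_proj.aemeasurable hf.aestronglyMeasurable]

lemma eintegral_eq (hT : Represents H₀ V T) {u : Collapse K → EReal} (hu : Measurable u) (x : X) :
    eintegral (H₀ (proj K '' V) (proj K x)) u = eintegral (T x) (u ∘ proj K) := by
  rw [hT.map_eq, eintegral_map measurable_proj hu]

lemma measure_univ_image (hT : Represents H₀ V T) (y : Collapse K) :
    H₀ (proj K '' V) y univ = 1 := by
  obtain ⟨x, rfl⟩ := surjective_proj y
  have := hT.isMarkovKernel
  rw [hT.map_eq, Measure.map_apply measurable_proj MeasurableSet.univ, preimage_univ, measure_univ]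

lemma isBoundaryKernel_image (hT : Represents H₀ V T) :
    IsBoundaryKernel (proj K '' V) (H₀ (proj K '' V)) := by
  have hfrontier : frontier V ⊆ proj K ⁻¹' frontier (proj K '' V) := by
    intro y hy
    rw [hT.isOpen.frontier_eq] at hy
    rw [mem_preimage, (hT.isSaturated.isOpen_image hT.isOpen).frontier_eq]
    exact ⟨image_closure_subset_closure_image continuous_proj (mem_image_of_mem _ hy.1),
      fun h => hy.2 (hT.isSaturated.proj_mem_image.1 h)⟩
  constructor
  · rintro _ ⟨x, hx, rfl⟩
    rw [hT.map_eq, Measure.map_apply measurable_proj isClosed_frontier.measurableSet.compl,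
      preimage_compl]
    exact measure_mono_null (compl_subset_compl.2 hfrontier) (hT.isBoundaryKernel.1 x hx)
  · intro y hy
    obtain ⟨x, rfl⟩ := surjective_proj y
    rw [hT.map_eq, hT.isBoundaryKernel.2 x fun h => hy (mem_image_of_mem _ h),
      Measure.map_dirac' measurable_proj]

lemma comp_eq (hT : Represents H₀ V T) (hT' : Represents H₀ W T') (h : T ∘ₖ T' = T) :
    H₀ (proj K '' V) ∘ₖ H₀ (proj K '' W) = H₀ (proj K '' V) := by
  ext1 y
  obtain ⟨x, rfl⟩ := surjective_proj y
  ext B hB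
  rw [Kernel.comp_apply' _ _ _ hB, hT'.map_eq, lintegral_map (Kernel.measurable_coe _ hB)
    measurable_proj]
  simp only [hT.map_eq, Measure.map_apply measurable_proj hB]
  rw [← Kernel.comp_apply' _ _ _ (measurable_proj hB), h]

lemma continuous_integral_image (hT : Represents H₀ V T) {f : Collapse K → ℝ}
    (hf : Continuous f) : Continuous fun y => ∫ z, f z ∂(H₀ (proj K '' V) y) := by
  rw [isQuotientMap_proj.continuous_iff]
  exact (hT.continuous_integral _ (hf.comp continuous_proj)).congr
    fun x => (hT.integral_eq hf.measurable x).symm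

lemma continuousOn_integral_image (hT : Represents H₀ V T) {f : Collapse K → ℝ}
    (hf : Measurable f) (hC : ∃ C : ℝ, ∀ y, |f y| ≤ C) :
    ContinuousOn (fun y => ∫ z, f z ∂(H₀ (proj K '' V) y)) (proj K '' V) := by
  rw [isQuotientMap_proj.continuousOn_isOpen_iff (hT.isSaturated.isOpen_image hT.isOpen),
    hT.isSaturated.preimage_image]
  obtain ⟨C, hC⟩ := hC
  exact (hT.continuousOn_integral _ (hf.comp measurable_proj) ⟨C, fun x => hC _⟩).congr
    fun x _ => hT.integral_eq hf x

end Represents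

variable [T2Space X] [BorelSpace X]

/-- The kernel on `X₀` induced by a kernel `T` on `X` whose image measures are constant on `K`. -/
def descend (hK : IsCompact K) {k : X} (hk : k ∈ K) (T : Kernel X X) :
    Kernel (Collapse K) (Collapse K) :=
  (T.comap (lift K k) (measurable_lift hK hk)).map (proj K)

lemma descend_proj (hK : IsCompact K) {k : X} (hk : k ∈ K) {T : Kernel X X}
    (hT : ∀ x ∈ K, (T x).map (proj K) = (T k).map (proj K)) (x : X) :
    descend hK hk T (proj K x) = (T x).map (proj K) := by
  rw [descend, Kernel.map_apply _ measurable_proj, Kernel.comap_apply]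
  by_cases hx : x ∈ K
  · rw [lift_proj_of_mem hk hx, hT x hx]
  · rw [lift_proj_of_notMem k hx]

end CollapseKernel

section DarnedKernel

variable {X : Type*} [TopologicalSpace X] [T2Space X] [MeasurableSpace X] [BorelSpace X]
  {𝒱 : Set (Set X)} {H : Set X → Kernel X X} {K O V : Set X} {g : X → ℝ} {R r s : ℝ}
  {σ : ℝ → ProbabilityMeasure X} {k : X}

open Classical in
variable (𝒱 H O g R σ) in
/-- The kernels of the darning: the images of the kernels `ballKernel` for the balls `{g < r}`,
`0 < r < R`, and of the given kernels for the sets away from `K`. -/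
def darnedKernel (hK : IsCompact K) {k : X} (hk : k ∈ K) (Z : Set (Collapse K)) :
    Kernel (Collapse K) (Collapse K) :=
  descend hK hk (if h : ∃ r ∈ Ioo 0 R, Z = proj K '' ball O g r
    then ballKernel 𝒱 H O g hK.measurableSet h.choose (σ h.choose) else H (proj K ⁻¹' Z))

lemma darnedKernel_image (hH : IsNormalBauerFamily 𝒱 H) (ha : IsAnnular 𝒱 H K O g R) (hk : k ∈ K)
    (hV : V ∈ 𝒱) (hVK : Disjoint (closure V) K) (x : X) :
    darnedKernel 𝒱 H O g R σ ha.isCompact hk (proj K '' V) (proj K x) =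
      (H V x).map (proj K) := by
  have hsub : ∀ y ∈ K, y ∉ V := fun y hy h => disjoint_left.1 hVK (subset_closure h) hy
  have hsat : IsSaturated K V := Or.inl (hVK.mono_left subset_closure)
  have hno : ¬ ∃ r ∈ Ioo 0 R, proj K '' V = proj K '' ball O g r := by
    rintro ⟨r, hr, h⟩
    exact hsub k hk (hsat.proj_mem_image.1 (h ▸ mem_image_of_mem _ (ha.subset_ball hr.1 hk)))
  rw [darnedKernel, dif_neg hno, hsat.preimage_image]
  refine descend_proj _ hk (fun y hy => ?_) x
  rw [hH.eq_dirac hV (hsub y hy), hH.eq_dirac hV (hsub k hk), Measure.map_dirac' measurable_proj,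
    Measure.map_dirac' measurable_proj, proj_eq_of_mem hy hk]

lemma represents_of_mem (hH : IsNormalBauerFamily 𝒱 H) (ha : IsAnnular 𝒱 H K O g R) (hk : k ∈ K)
    (hV : V ∈ 𝒱) (hVK : Disjoint (closure V) K) :
    Represents (darnedKernel 𝒱 H O g R σ ha.isCompact hk) V (H V) where
  isOpen := hH.isOpen hV
  isSaturated := Or.inl (hVK.mono_left subset_closure)
  isCompact_closure := hH.isCompact_closure V hV
  isMarkovKernel := hH.isMarkovKernel hV
  isBoundaryKernel := hH.isBoundaryKernel V hV
  continuous_integral := hH.continuous_integral V hV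
  continuousOn_integral := hH.continuousOn_integral V hV
  map_eq := darnedKernel_image hH ha hk hV hVK

variable [LocallyCompactSpace X] [SecondCountableTopology X]

lemma IsAnnular.le_of_ball_subset (hH : IsNormalBauerFamily 𝒱 H) (ha : IsAnnular 𝒱 H K O g R)
    (hK : K.Nonempty) (hr : r ∈ Ioo 0 R) (h : ball O g s ⊆ ball O g r) : s ≤ r := by
  by_contra! hlt
  obtain ⟨x, hx⟩ := ha.nonempty_level hH hK hr.1 hr.2
  exact (h ⟨hx.1.1, hx.2.trans_lt hlt⟩).2.ne hx.2

lemma darnedKernel_ball (hH : IsNormalBauerFamily 𝒱 H) (ha : IsAnnular 𝒱 H K O g R) (hk : k ∈ K)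
    (hr : r ∈ Ioo 0 R) (x : X) :
    darnedKernel 𝒱 H O g R σ ha.isCompact hk (proj K '' ball O g r) (proj K x) =
      (ballKernel 𝒱 H O g ha.measurableSet r (σ r) x).map (proj K) := by
  have hex : ∃ s ∈ Ioo 0 R, proj K '' ball O g r = proj K '' ball O g s := ⟨r, hr, rfl⟩
  have hchoose : hex.choose = r := by
    obtain ⟨hmem, himage⟩ := hex.choose_spec
    have hball : ball O g r = ball O g hex.choose := by
      simpa only [(ha.isSaturated_ball hr.1).preimage_image,
        (ha.isSaturated_ball hmem.1).preimage_image] using congrArg (proj K ⁻¹' ·) himage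
    exact le_antisymm (ha.le_of_ball_subset hH ⟨k, hk⟩ hr hball.ge)
      (ha.le_of_ball_subset hH ⟨k, hk⟩ hmem hball.le)
  rw [darnedKernel, dif_pos hex, hchoose]
  refine descend_proj _ hk (fun y hy => ?_) x
  rw [ha.ballKernel_of_mem hH hr.2 _ hy, ha.ballKernel_of_mem hH hr.2 _ hk]

lemma represents_ball (hH : IsNormalBauerFamily 𝒱 H) (ha : IsAnnular 𝒱 H K O g R) (hk : k ∈ K)
    (hσ : IsCompatibleFamily 𝒱 H K O g R σ) (hr : r ∈ Ioo 0 R) :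
    Represents (darnedKernel 𝒱 H O g R σ ha.isCompact hk) (ball O g r)
      (ballKernel 𝒱 H O g ha.measurableSet r (σ r)) where
  isOpen := ha.isOpen_ball r
  isSaturated := ha.isSaturated_ball hr.1
  isCompact_closure :=
    (ha.isCompact_le r hr.2).of_isClosed_subset isClosed_closure (ha.closure_ball_subset hr.2)
  isMarkovKernel := ha.isMarkovKernel_ballKernel hH hr.2 _
  isBoundaryKernel := ha.isBoundaryKernel_ballKernel hH hσ hr.1 hr.2
  continuous_integral _ hf := ha.continuous_integral_ballKernel hH hσ hr.1 hr.2 hf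
  continuousOn_integral _ hf := fun ⟨_, hC⟩ =>
    ha.continuousOn_integral_ballKernel hH hr.1 hr.2 _ hf hC
  map_eq := darnedKernel_ball hH ha hk hr

end DarnedKernel

section Transport

variable {X : Type*} {K V : Set X} {k : X} {𝒞 : X → Set (Set X)}

/-- The choice on `X₀` induced by a choice `𝒞` on `X`; at the point of `X₀` representing `K` it
consists of the images of the sets in `𝒞 k`. -/
def imageChoice (K : Set X) (k : X) (𝒞 : X → Set (Set X)) (y : Collapse K) :
    Set (Set (Collapse K)) :=
  (fun V => proj K '' V) '' 𝒞 (lift K k y)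

lemma apply_lift_proj {β : Type*} {u : X → β} (hk : k ∈ K) (hu : ∀ x ∈ K, u x = u k) (x : X) :
    u (lift K k (proj K x)) = u x := by
  by_cases hx : x ∈ K
  · rw [lift_proj_of_mem hk hx, hu x hx]
  · rw [lift_proj_of_notMem k hx]

lemma IsSaturated.lift_mem (hV : IsSaturated K V) {y : Collapse K} (hy : y ∈ proj K '' V) :
    lift K k y ∈ V :=
  hV.proj_mem_image.1 (by rwa [proj_lift])

variable [TopologicalSpace X]

lemma closure_image_proj_subset (hK : IsClosed K) {W : Set X} (h : closure W ⊆ V) :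
    closure (proj K '' W) ⊆ proj K '' V := by
  rw [(isClosedMap_proj hK).closure_image_eq_of_continuous continuous_proj]
  exact image_mono h

lemma isLocalChoice_image (hK : IsClosed K) (hk : k ∈ K) (hV : IsSaturated K V) {ℬ : Set (Set X)}
    (h𝒞 : ∀ x ∈ V, ∀ W ∈ 𝒞 x, W ∈ ℬ ∧ closure W ⊆ V ∧ x ∈ W)
    (hout : ∀ x ∈ V, x ∉ K → ∀ N, IsOpen N → x ∈ N → ∃ W ∈ 𝒞 x, W ⊆ N)
    (hin : k ∈ V → ∀ N, IsOpen N → K ⊆ N → ∃ W ∈ 𝒞 k, W ⊆ N) :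
    IsLocalChoice ((fun V => proj K '' V) '' ℬ) (proj K '' V) (imageChoice K k 𝒞) := by
  intro y hy
  have hyV : lift K k y ∈ V := hV.lift_mem hy
  refine ⟨?_, fun N hN => ?_⟩
  · rintro _ ⟨W, hW, rfl⟩
    obtain ⟨hWℬ, hWV, hyW⟩ := h𝒞 _ hyV W hW
    exact ⟨mem_image_of_mem _ hWℬ, closure_image_proj_subset hK hWV,
      ⟨_, hyW, proj_lift k y⟩⟩
  obtain ⟨N', hN'N, hN'o, hyN'⟩ := mem_nhds_iff.1 hN
  have hpre := hN'o.preimage (continuous_proj (K := K))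
  have hmem : lift K k y ∈ proj K ⁻¹' N' := by rwa [mem_preimage, proj_lift]
  suffices ∃ W ∈ 𝒞 (lift K k y), W ⊆ proj K ⁻¹' N' by
    obtain ⟨W, hW, hWN⟩ := this
    exact ⟨_, mem_image_of_mem _ hW, (image_subset_iff.2 hWN).trans hN'N⟩
  by_cases hyK : lift K k y ∈ K
  · have hyk : lift K k y = k := by
      rw [← proj_lift k y]
      exact lift_proj_of_mem hk hyK
    rw [hyk] at hyV ⊢
    refine hin hyV _ hpre fun x hx => ?_
    rw [mem_preimage, proj_eq_of_mem hx hyK]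
    exact hmem
  · exact hout _ hyV hyK _ hpre hmem

lemma lowerSemicontinuousOn_comp_lift (hK : IsClosed K) (hk : k ∈ K) (hV : IsSaturated K V)
    (hVo : IsOpen V) {u : X → EReal} (hu : LowerSemicontinuousOn u V)
    (hconst : ∀ x ∈ K, u x = u k) :
    LowerSemicontinuousOn (u ∘ lift K k) (proj K '' V) := by
  intro y hy t ht
  refine eventually_nhdsWithin_of_eventually_nhds ?_
  obtain ⟨x, hx, rfl⟩ := hy
  refine eventually_nhds_proj hK fun x' hx' => ?_
  have hx'V : x' ∈ V := hV.proj_mem_image.1 (hx' ▸ mem_image_of_mem _ hx)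
  have ht' : t < u x' := by
    rw [← apply_lift_proj hk hconst, hx']
    exact ht
  have hev := hu x' hx'V t ht'
  rw [hVo.nhdsWithin_eq hx'V] at hev
  filter_upwards [hev] with z hz
  change t < u (lift K k (proj K z))
  rwa [apply_lift_proj hk hconst]

variable [T2Space X] [MeasurableSpace X] [BorelSpace X]

lemma isHyperharmonicOn_image {H₀ : Set (Collapse K) → Kernel (Collapse K) (Collapse K)}
    (hK : IsCompact K) (hk : k ∈ K) (hV : IsSaturated K V) (hVo : IsOpen V) {u : X → EReal}
    (hu : Measurable u) (hlsc : LowerSemicontinuousOn u V) (hbot : ∀ x ∈ V, u x ≠ ⊥)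
    (hconst : ∀ x ∈ K, u x = u k)
    (hle : ∀ x ∈ V, ∀ W ∈ 𝒞 x, ∃ T, Represents H₀ W T ∧ eintegral (T x) u ≤ u x) :
    IsHyperharmonicOn H₀ (imageChoice K k 𝒞) (u ∘ lift K k) (proj K '' V) := by
  have hlift : (u ∘ lift K k) ∘ proj K = u := funext (apply_lift_proj hk hconst)
  refine ⟨lowerSemicontinuousOn_comp_lift hK.isClosed hk hV hVo hlsc hconst,
    fun y hy => hbot _ (hV.lift_mem hy), ?_⟩
  rintro y hy _ ⟨W, hW, rfl⟩
  obtain ⟨T, hT, hTle⟩ := hle _ (hV.lift_mem hy) W hW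
  have heq := hT.eintegral_eq (hu.comp (measurable_lift hK hk)) (lift K k y)
  rw [proj_lift, hlift] at heq
  exact heq.trans_le hTle

end Transport

section AwayFromCompact

variable {X : Type*} [TopologicalSpace X] [T2Space X] [MeasurableSpace X] [BorelSpace X]
  {𝒱 : Set (Set X)} {H : Set X → Kernel X X} {K O V : Set X} {g : X → ℝ} {R : ℝ}
  {σ : ℝ → ProbabilityMeasure X} {k : X}

/-- The subsets of `X` whose images form the base of `X₀`: the given sets away from `K` and the
balls `{g < r}`, `0 < r < R`. -/
def darnedBase (𝒱 : Set (Set X)) (K O : Set X) (g : X → ℝ) (R : ℝ) : Set (Set X) :=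
  {V ∈ 𝒱 | Disjoint (closure V) K} ∪ (fun r => ball O g r) '' Ioo 0 R

lemma isHyperharmonicOn_image_indicator (hH : IsNormalBauerFamily 𝒱 H)
    (ha : IsAnnular 𝒱 H K O g R) (hk : k ∈ K) (hV : IsOpen V) (hVK : Disjoint V K)
    {𝒲 : X → Set (Set X)} (h𝒲 : IsLocalChoice 𝒱 V 𝒲) {u : X → EReal}
    (hu : IsHyperharmonicOn H 𝒲 u V) (hpos : ∀ x ∈ V, 0 ≤ u x) :
    IsHyperharmonicOn (darnedKernel 𝒱 H O g R σ ha.isCompact hk) (imageChoice K k 𝒲)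
      (V.indicator u ∘ lift K k) (proj K '' V) := by
  have hlsc := lowerSemicontinuous_indicator_of_nonneg hV hu.1 hpos
  have hoff : ∀ x ∈ K, V.indicator u x = 0 := fun x hx =>
    indicator_of_notMem (fun h => disjoint_left.1 hVK h hx) u
  refine isHyperharmonicOn_image ha.isCompact hk (Or.inl hVK) hV hlsc.measurable
    (hlsc.lowerSemicontinuousOn V) (fun x hx => ?_) (fun x hx => by rw [hoff x hx, hoff k hk])
    fun x hx W hW => ?_
  · rw [indicator_of_mem hx]
    exact hu.2.1 x hx
  · obtain ⟨hW𝒱, hWV, hxW⟩ := (h𝒲 x hx).1 W hW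
    refine ⟨H W, represents_of_mem hH ha hk hW𝒱 (hVK.mono_left hWV), ?_⟩
    have hae : V.indicator u =ᵐ[H W x] u := by
      filter_upwards [hH.ae_mem_frontier hW𝒱 hxW] with y hy
      exact indicator_of_mem (hWV (frontier_subset_closure hy)) u
    rw [eintegral_congr_ae hae, indicator_of_mem hx]
    exact hu.2.2 x hx W hW

lemma separates_image_of_mem (hH : IsNormalBauerFamily 𝒱 H) (ha : IsAnnular 𝒱 H K O g R)
    (hk : k ∈ K) (hV : V ∈ 𝒱) (hVK : Disjoint (closure V) K) :
    ∃ 𝒲, IsLocalChoice ((fun V => proj K '' V) '' darnedBase 𝒱 K O g R) (proj K '' V) 𝒲 ∧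
      PosHyperharmonicSeparates (darnedKernel 𝒱 H O g R σ ha.isCompact hk) 𝒲 (proj K '' V) := by
  have hVK' : Disjoint V K := hVK.mono_left subset_closure
  obtain ⟨𝒲, h𝒲, hsep⟩ := hH.separates V hV
  refine ⟨imageChoice K k 𝒲, isLocalChoice_image ha.isCompact.isClosed hk (Or.inl hVK')
    (fun x hx W hW => ?_) (fun x hx _ N hN hxN => (h𝒲 x hx).2 N (hN.mem_nhds hxN))
    (fun hkV => (disjoint_left.1 hVK' hkV hk).elim), ?_⟩
  · obtain ⟨hW𝒱, hWV, hxW⟩ := (h𝒲 x hx).1 W hW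
    exact ⟨Or.inl ⟨hW𝒱, hVK'.mono_left hWV⟩, hWV, hxW⟩
  rintro _ ⟨x, hx, rfl⟩ _ ⟨x', hx', rfl⟩ hne
  obtain ⟨u, hu, hpos, hux⟩ := hsep x hx x' hx' fun h => hne (by rw [h])
  refine ⟨_, isHyperharmonicOn_image_indicator hH ha hk (hH.isOpen hV) hVK' h𝒲 hu hpos,
    fun y _ => indicator_nonneg hpos _, ?_⟩
  have hlift : ∀ z ∈ V, (V.indicator u ∘ lift K k) (proj K z) = u z := fun z hz => by
    rw [Function.comp_apply, lift_proj_of_notMem k (disjoint_left.1 hVK' hz), indicator_of_mem hz]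
  rwa [hlift x hx, hlift x' hx']

end AwayFromCompact

section Cap

variable {X : Type*} {𝒱 : Set (Set X)} {K O W : Set X} {g v : X → ℝ} {R r N C d : ℝ} {k x x' : X}

/-- A local choice on the ball `{g < r}`, constant on `K`: the smaller balls for the points of `K`,
the sets of the base with closure in `{0 < g < r}` for the other points. -/
def ballChoice [TopologicalSpace X] (𝒱 : Set (Set X)) (K O : Set X) (g : X → ℝ) (r : ℝ) (x : X) :
    Set (Set X) :=
  {W | (x ∈ K ∧ ∃ s ∈ Ioo 0 r, W = ball O g s) ∨
    (x ∉ K ∧ W ∈ 𝒱 ∧ closure W ⊆ annulus O K g r ∧ x ∈ W)}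

/-- The function `min (v + N (r - g)) d`, where `g` is replaced by `0` outside the ball `{g < r}`.
If `d ≤ N r`, it attains its maximum `d` on `K`. -/
def cap (O : Set X) (g : X → ℝ) (r : ℝ) (v : X → ℝ) (N d : ℝ) (x : X) : ℝ :=
  min (v x + N * (r - (ball O g r).indicator g x)) d

lemma cap_le (x : X) : cap O g r v N d x ≤ d :=
  min_le_right _ _

lemma cap_of_mem (hx : x ∈ ball O g r) : cap O g r v N d x = min (v x + N * (r - g x)) d := by
  rw [cap, indicator_of_mem hx]

lemma indicator_ball_le (hr : 0 ≤ r) (x : X) : (ball O g r).indicator g x ≤ r :=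
  indicator_le' (fun _ hx => hx.2.le) (fun _ _ => hr) x

lemma cap_nonneg (hr : 0 ≤ r) (hv : ∀ x, 0 ≤ v x) (hN : 0 ≤ N) (hd : 0 ≤ d) (x : X) :
    0 ≤ cap O g r v N d x :=
  le_min (add_nonneg (hv x) (mul_nonneg hN (sub_nonneg.2 (indicator_ball_le hr x)))) hd

variable [TopologicalSpace X] [MeasurableSpace X] {H : Set X → Kernel X X}
  {σ : ℝ → ProbabilityMeasure X}

namespace IsAnnular

lemma nonneg (ha : IsAnnular 𝒱 H K O g R) (hx : x ∈ O) : 0 ≤ g x := by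
  by_cases hxK : x ∈ K
  · exact (ha.eq_zero x hxK).ge
  · exact (ha.pos x ⟨hx, hxK⟩).le

lemma indicator_ball_nonneg (ha : IsAnnular 𝒱 H K O g R) (x : X) :
    0 ≤ (ball O g r).indicator g x :=
  indicator_nonneg (fun _ hx => ha.nonneg hx.1) x

lemma cap_of_mem_compact (ha : IsAnnular 𝒱 H K O g R) (hr : 0 < r) (hv : ∀ x, 0 ≤ v x)
    (hd : d ≤ N * r) (hx : x ∈ K) : cap O g r v N d x = d := by
  rw [cap_of_mem (ha.subset_ball hr hx), ha.eq_zero x hx, sub_zero]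
  exact min_eq_right (hd.trans (le_add_of_nonneg_left (hv x)))

lemma lowerSemicontinuousOn_cap (ha : IsAnnular 𝒱 H K O g R) (hv : LowerSemicontinuous v) :
    LowerSemicontinuousOn (cap O g r v N d) (ball O g r) := by
  have hg : ContinuousOn g (ball O g r) := ha.continuousOn.mono fun x hx => hx.1
  have hcont : ContinuousOn (fun x => N * (r - (ball O g r).indicator g x)) (ball O g r) :=
    continuousOn_const.mul (continuousOn_const.sub
      (hg.congr fun x hx => indicator_of_mem (s := ball O g r) hx g))
  exact ((hv.lowerSemicontinuousOn _).add hcont.lowerSemicontinuousOn).inf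
    lowerSemicontinuousOn_const

variable [OpensMeasurableSpace X]

lemma measurable_indicator_ball (ha : IsAnnular 𝒱 H K O g R) :
    Measurable ((ball O g r).indicator g) := by
  classical
  rw [← piecewise_eq_indicator]
  exact ContinuousOn.measurable_piecewise (ha.continuousOn.mono fun x hx => hx.1)
    continuousOn_const (ha.isOpen_ball r).measurableSet

lemma measurable_cap (ha : IsAnnular 𝒱 H K O g R) (hv : Measurable v) :
    Measurable (cap O g r v N d) :=
  (hv.add ((measurable_const.sub ha.measurable_indicator_ball).const_mul N)).min measurable_const

lemma integral_cap_le (hH : IsNormalBauerFamily 𝒱 H) (ha : IsAnnular 𝒱 H K O g R) (hr : 0 ≤ r)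
    (hv : IsBoundedSuperharmonic 𝒱 H (annulus O K g r) v C) (hN : 0 ≤ N) (hd : 0 ≤ d)
    (hW : W ∈ 𝒱) (hWA : closure W ⊆ annulus O K g r) (hx : x ∈ W) :
    ∫ y, cap O g r v N d y ∂(H W x) ≤ cap O g r v N d x := by
  have := hH.isMarkovKernel hW
  have hcap : ∀ y, 0 ≤ cap O g r v N d y := cap_nonneg hr hv.nonneg hN hd
  have hv_int : Integrable v (H W x) :=
    integrable_of_nonneg_of_le hv.lowerSemicontinuous.measurable hv.nonneg hv.le
  have hg_int : Integrable ((ball O g r).indicator g) (H W x) :=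
    integrable_of_nonneg_of_le ha.measurable_indicator_ball ha.indicator_ball_nonneg
      (indicator_ball_le hr)
  have hN_int : Integrable (fun y => N * (r - (ball O g r).indicator g y)) (H W x) :=
    ((integrable_const r).sub hg_int).const_mul N
  have hg : ∫ y, (ball O g r).indicator g y ∂(H W x) = (ball O g r).indicator g x := by
    have hmem : ∀ y ∈ closure W, (ball O g r).indicator g y = g y := fun y hy =>
      indicator_of_mem (s := ball O g r) ⟨(hWA hy).1.1, (hWA hy).2⟩ g
    rw [hmem x (subset_closure hx),
      ← ha.isHarmonicOn.2 W hW (fun y hy => (hWA hy).1) x hx]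
    refine integral_congr_ae ?_
    filter_upwards [hH.ae_mem_frontier hW hx] with y hy
    exact hmem y (frontier_subset_closure hy)
  refine le_min ?_ (integral_le_of_nonneg_of_le hcap cap_le)
  calc ∫ y, cap O g r v N d y ∂(H W x)
      ≤ ∫ y, (v y + N * (r - (ball O g r).indicator g y)) ∂(H W x) :=
        integral_mono (integrable_of_nonneg_of_le
          (ha.measurable_cap hv.lowerSemicontinuous.measurable) hcap cap_le)
          (hv_int.add hN_int) fun y => min_le_left _ _
    _ = ∫ y, v y ∂(H W x) + N * (r - (ball O g r).indicator g x) := by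
        rw [integral_add hv_int hN_int, integral_const_mul,
          integral_sub (integrable_const r) hg_int, hg, integral_const, probReal_univ, one_smul]
    _ ≤ v x + N * (r - (ball O g r).indicator g x) := by
        gcongr
        exact hv.integral_le W hW hWA x hx

end IsAnnular

variable [BorelSpace X] [T2Space X] [LocallyCompactSpace X] [SecondCountableTopology X]

namespace IsAnnular

lemma isHyperharmonicOn_cap (hH : IsNormalBauerFamily 𝒱 H) (ha : IsAnnular 𝒱 H K O g R)
    (hk : k ∈ K) (hσ : IsCompatibleFamily 𝒱 H K O g R σ) (hr : r ∈ Ioo 0 R)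
    (hv : IsBoundedSuperharmonic 𝒱 H (annulus O K g r) v C) (hN : 0 ≤ N) (hd0 : 0 ≤ d)
    (hd : d ≤ N * r) :
    IsHyperharmonicOn (darnedKernel 𝒱 H O g R σ ha.isCompact hk)
      (imageChoice K k (ballChoice 𝒱 K O g r))
      ((fun x => (cap O g r v N d x : EReal)) ∘ lift K k) (proj K '' ball O g r) := by
  have hmeas : Measurable (cap O g r v N d) := ha.measurable_cap hv.lowerSemicontinuous.measurable
  have hcap : ∀ x, 0 ≤ cap O g r v N d x := cap_nonneg hr.1.le hv.nonneg hN hd0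
  have hcapK : ∀ x ∈ K, cap O g r v N d x = d := fun x =>
    ha.cap_of_mem_compact hr.1 hv.nonneg hd
  have hlsc : LowerSemicontinuousOn (fun x => (cap O g r v N d x : EReal)) (ball O g r) :=
    continuous_coe_real_ereal.comp_lowerSemicontinuousOn
      (ha.lowerSemicontinuousOn_cap hv.lowerSemicontinuous) fun _ _ => EReal.coe_le_coe_iff.2
  refine isHyperharmonicOn_image ha.isCompact hk (ha.isSaturated_ball hr.1) (ha.isOpen_ball r)
    (measurable_coe_real_ereal.comp hmeas) hlsc (fun x _ => EReal.coe_ne_bot _)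
    (fun x hx => by rw [hcapK x hx, hcapK k hk]) ?_
  suffices ∀ x ∈ ball O g r, ∀ W ∈ ballChoice 𝒱 K O g r x,
      ∃ T, Represents (darnedKernel 𝒱 H O g R σ ha.isCompact hk) W T ∧
        ∫ y, cap O g r v N d y ∂(T x) ≤ cap O g r v N d x by
    intro x hx W hW
    obtain ⟨T, hT, hle⟩ := this x hx W hW
    have := hT.isMarkovKernel
    refine ⟨T, hT, ?_⟩
    rw [eintegral_coe (integrable_of_nonneg_of_le hmeas hcap cap_le) hcap]
    exact EReal.coe_le_coe_iff.2 hle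
  rintro x - W (⟨hxK, s, hs, rfl⟩ | ⟨-, hW, hWA, hxW⟩)
  · have hT := represents_ball hH ha hk hσ ⟨hs.1, hs.2.trans hr.2⟩
    have := hT.isMarkovKernel
    refine ⟨_, hT, ?_⟩
    rw [hcapK x hxK]
    exact integral_le_of_nonneg_of_le hcap cap_le
  · exact ⟨_, represents_of_mem hH ha hk hW (disjoint_left.2 fun y hy => (hWA hy).1.2),
      ha.integral_cap_le hH hr.1.le hv hN hd0 hW hWA hxW⟩

end IsAnnular

end Cap

section DarnedFamily

variable {X : Type*} [TopologicalSpace X] [MeasurableSpace X]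
  {𝒱 : Set (Set X)} {H : Set X → Kernel X X} {K O : Set X} {g : X → ℝ} {R r s : ℝ}
  {σ : ℝ → ProbabilityMeasure X} {k x x' : X}

namespace IsAnnular

lemma exists_mem_Ioo_ball_subset (ha : IsAnnular 𝒱 H K O g R) (hs : 0 < s) (hsR : s ≤ R)
    {N : Set X} (hN : IsOpen N) (hKN : K ⊆ N) : ∃ c ∈ Ioo 0 s, ball O g c ⊆ N := by
  obtain ⟨c, hc, hcN⟩ := ha.exists_ball_subset (hs.trans_le hsR) hN hKN
  obtain ⟨t, ht0, ht⟩ := exists_between (lt_min hc hs)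
  exact ⟨t, ⟨ht0, ht.trans_le (min_le_right _ _)⟩, hcN t (ht.trans_le (min_le_left _ _))⟩

lemma exists_cap_ne_of_ne (ha : IsAnnular 𝒱 H K O g R) (hr : 0 ≤ r) (hx : x ∈ ball O g r)
    (hx' : x' ∈ ball O g r) (hne : g x ≠ g x') :
    ∃ v C N d, IsBoundedSuperharmonic 𝒱 H (annulus O K g r) v C ∧ 0 ≤ N ∧ 0 ≤ d ∧ d ≤ N * r ∧
      cap O g r v N d x ≠ cap O g r v N d x' := by
  refine ⟨_, 0, 1, r, isBoundedSuperharmonic_zero, zero_le_one, hr, (one_mul r).ge, ?_⟩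
  have hcap : ∀ z ∈ ball O g r, cap O g r (fun _ => 0) 1 r z = r - g z := fun z hz => by
    rw [cap_of_mem hz, zero_add, one_mul, min_eq_left (sub_le_self r (ha.nonneg hz.1))]
  rw [hcap x hx, hcap x' hx']
  exact fun h => hne (sub_right_injective h)

lemma exists_cap_ne_of_notMem [OpensMeasurableSpace X] (hH : IsNormalBauerFamily 𝒱 H)
    (ha : IsAnnular 𝒱 H K O g R) (hx : x ∈ ball O g r) (hxK : x ∉ K) (hx' : x' ∈ ball O g r)
    (hx'K : x' ∉ K) (hne : x ≠ x') :
    ∃ v C N d, IsBoundedSuperharmonic 𝒱 H (annulus O K g r) v C ∧ 0 ≤ N ∧ 0 ≤ d ∧ d ≤ N * r ∧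
      cap O g r v N d x ≠ cap O g r v N d x' := by
  obtain ⟨P, hP, hOP⟩ := ha.exists_isPSet
  obtain ⟨v, C, hv, hvne⟩ := hP.exists_isBoundedSuperharmonic_ne hH (hOP hx.1) (hOP hx'.1) hne
  have hC : 0 ≤ C := (hv.nonneg x).trans (hv.le x)
  set δ := min (g x) (g x')
  have hδ : 0 < δ := lt_min (ha.pos x ⟨hx.1, hxK⟩) (ha.pos x' ⟨hx'.1, hx'K⟩)
  have hδr : δ < r := (min_le_left _ _).trans_lt hx.2
  -- Where `δ ≤ g`, the minimum in `cap` is the affine term in `N`, so two values of `N` suffice.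
  obtain ⟨N, hN, hNne⟩ : ∃ N, 2 * C / δ ≤ N ∧ v x + N * (r - g x) ≠ v x' + N * (r - g x') := by
    by_contra! hcon
    have heq₁ := hcon (2 * C / δ) le_rfl
    have heq₂ := hcon (2 * C / δ + 1) (by linarith)
    have hg : g x = g x' := by linarith
    rw [hg] at heq₁
    exact hvne (add_right_cancel heq₁)
  have hN0 : 0 ≤ N := (by positivity : 0 ≤ 2 * C / δ).trans hN
  have hNδ : 2 * C ≤ N * δ := (div_le_iff₀ hδ).1 hN
  have hNr : N * δ ≤ N * r := mul_le_mul_of_nonneg_left hδr.le hN0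
  have hcap : ∀ z ∈ ball O g r, δ ≤ g z → cap O g r v N (N * r - C) z = v z + N * (r - g z) := by
    intro z hz hgz
    have := mul_le_mul_of_nonneg_left hgz hN0
    rw [cap_of_mem hz, min_eq_left (by linarith [hv.le z])]
  refine ⟨v, C, N, N * r - C, hv.mono fun y hy => hOP hy.1.1, hN0, by linarith,
    sub_le_self _ hC, ?_⟩
  rwa [hcap x hx (min_le_left _ _), hcap x' hx' (min_le_right _ _)]

lemma exists_cap_ne [OpensMeasurableSpace X] (hH : IsNormalBauerFamily 𝒱 H)
    (ha : IsAnnular 𝒱 H K O g R) (hr : 0 ≤ r) (hx : x ∈ ball O g r) (hx' : x' ∈ ball O g r)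
    (hne : proj K x ≠ proj K x') :
    ∃ v C N d, IsBoundedSuperharmonic 𝒱 H (annulus O K g r) v C ∧ 0 ≤ N ∧ 0 ≤ d ∧ d ≤ N * r ∧
      cap O g r v N d x ≠ cap O g r v N d x' := by
  by_cases hxK : x ∈ K
  · refine ha.exists_cap_ne_of_ne hr hx hx' ?_
    rw [ha.eq_zero x hxK]
    exact (ha.pos x' ⟨hx'.1, fun hx'K => hne (proj_eq_of_mem hxK hx'K)⟩).ne
  by_cases hx'K : x' ∈ K
  · refine ha.exists_cap_ne_of_ne hr hx hx' ?_
    rw [ha.eq_zero x' hx'K]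
    exact (ha.pos x ⟨hx.1, hxK⟩).ne'
  · exact ha.exists_cap_ne_of_notMem hH hx hxK hx' hx'K fun h => hne (by rw [h])

variable [T2Space X] [LocallyCompactSpace X]

lemma isLocalChoice_ballChoice (hH : IsNormalBauerFamily 𝒱 H) (ha : IsAnnular 𝒱 H K O g R)
    (hk : k ∈ K) (hr : r ∈ Ioo 0 R) :
    IsLocalChoice ((fun V => proj K '' V) '' darnedBase 𝒱 K O g R) (proj K '' ball O g r)
      (imageChoice K k (ballChoice 𝒱 K O g r)) := by
  refine isLocalChoice_image ha.isCompact.isClosed hk (ha.isSaturated_ball hr.1) ?_ ?_ ?_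
  · rintro x - W (⟨hxK, s, hs, rfl⟩ | ⟨-, hW, hWA, hxW⟩)
    · have hsR : s < R := hs.2.trans hr.2
      exact ⟨Or.inr ⟨s, ⟨hs.1, hsR⟩, rfl⟩, (ha.closure_ball_subset hsR).trans fun y hy =>
        ⟨hy.1, hy.2.trans_lt hs.2⟩, ha.subset_ball hs.1 hxK⟩
    · exact ⟨Or.inl ⟨hW, disjoint_left.2 fun y hy => (hWA hy).1.2⟩,
        fun y hy => ⟨(hWA hy).1.1, (hWA hy).2⟩, hxW⟩
  · intro x hx hxK N hN hxN
    have hopen : IsOpen (N ∩ (ball O g r \ K)) :=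
      hN.inter ((ha.isOpen_ball r).sdiff ha.isCompact.isClosed)
    obtain ⟨W, hW, hxW, hWN⟩ := hH.exists_closure_subset (hopen.mem_nhds ⟨hxN, hx, hxK⟩)
    exact ⟨W, Or.inr ⟨hxK, hW, fun y hy => mem_annulus_of_mem_ball (hWN hy).2.1 (hWN hy).2.2, hxW⟩,
      fun y hy => (hWN (subset_closure hy)).1⟩
  · intro _ N hN hKN
    obtain ⟨c, hc, hcN⟩ := ha.exists_mem_Ioo_ball_subset hr.1 hr.2.le hN hKN
    exact ⟨_, Or.inl ⟨hk, c, hc, rfl⟩, hcN⟩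

lemma isTopologicalBasis_darnedBase (hH : IsNormalBauerFamily 𝒱 H) (ha : IsAnnular 𝒱 H K O g R)
    (hR : 0 < R) : TopologicalSpace.IsTopologicalBasis
      ((fun V => proj K '' V) '' darnedBase 𝒱 K O g R) := by
  refine isTopologicalBasis_collapse ?_ ?_ (fun x hxK N hN hxN => ?_) fun N hN hKN => ?_
  · rintro V (⟨hV, -⟩ | ⟨r, -, rfl⟩)
    exacts [hH.isOpen hV, ha.isOpen_ball r]
  · rintro V (⟨-, hVK⟩ | ⟨r, hr, rfl⟩)
    exacts [Or.inl (hVK.mono_left subset_closure), ha.isSaturated_ball hr.1]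
  · obtain ⟨W, hW, hxW, hWN⟩ := hH.exists_closure_subset
      ((hN.sdiff ha.isCompact.isClosed).mem_nhds ⟨hxN, hxK⟩)
    exact ⟨W, Or.inl ⟨hW, disjoint_left.2 fun y hy => (hWN hy).2⟩, hxW,
      fun y hy => (hWN (subset_closure hy)).1⟩
  · obtain ⟨c, hc, hcN⟩ := ha.exists_mem_Ioo_ball_subset hR le_rfl hN hKN
    exact ⟨_, Or.inr ⟨c, hc, rfl⟩, ha.subset_ball hc.1, hcN⟩

variable [BorelSpace X] [SecondCountableTopology X]

lemma separates_image_ball (hH : IsNormalBauerFamily 𝒱 H) (ha : IsAnnular 𝒱 H K O g R)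
    (hk : k ∈ K) (hσ : IsCompatibleFamily 𝒱 H K O g R σ) (hr : r ∈ Ioo 0 R) :
    PosHyperharmonicSeparates (darnedKernel 𝒱 H O g R σ ha.isCompact hk)
      (imageChoice K k (ballChoice 𝒱 K O g r)) (proj K '' ball O g r) := by
  rintro _ ⟨x, hx, rfl⟩ _ ⟨x', hx', rfl⟩ hne
  obtain ⟨v, C, N, d, hv, hN, hd0, hd, hcap⟩ := ha.exists_cap_ne hH hr.1.le hx hx' hne
  refine ⟨_, ha.isHyperharmonicOn_cap hH hk hσ hr hv hN hd0 hd,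
    fun y _ => EReal.coe_nonneg.2 (cap_nonneg hr.1.le hv.nonneg hN hd0 _), ?_⟩
  have hconst : ∀ z ∈ K, cap O g r v N d z = cap O g r v N d k := fun z hz => by
    rw [ha.cap_of_mem_compact hr.1 hv.nonneg hd hz, ha.cap_of_mem_compact hr.1 hv.nonneg hd hk]
  rw [Function.comp_apply, Function.comp_apply, apply_lift_proj hk hconst,
    apply_lift_proj hk hconst]
  exact fun h => hcap (EReal.coe_injective h)

lemma exists_represents (hH : IsNormalBauerFamily 𝒱 H) (ha : IsAnnular 𝒱 H K O g R) (hk : k ∈ K)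
    (hσ : IsCompatibleFamily 𝒱 H K O g R σ) {V : Set X} (hV : V ∈ darnedBase 𝒱 K O g R) :
    ∃ T, Represents (darnedKernel 𝒱 H O g R σ ha.isCompact hk) V T := by
  rcases hV with ⟨hV, hVK⟩ | ⟨r, hr, rfl⟩
  exacts [⟨_, represents_of_mem hH ha hk hV hVK⟩, ⟨_, represents_ball hH ha hk hσ hr⟩]

lemma darnedKernel_comp_eq (hH : IsNormalBauerFamily 𝒱 H) (ha : IsAnnular 𝒱 H K O g R)
    (hk : k ∈ K) (hσ : IsCompatibleFamily 𝒱 H K O g R σ) {V W : Set X}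
    (hV : V ∈ darnedBase 𝒱 K O g R) (hW : W ∈ darnedBase 𝒱 K O g R) (hWV : W ⊆ V) :
    darnedKernel 𝒱 H O g R σ ha.isCompact hk (proj K '' V) ∘ₖ
      darnedKernel 𝒱 H O g R σ ha.isCompact hk (proj K '' W) =
        darnedKernel 𝒱 H O g R σ ha.isCompact hk (proj K '' V) := by
  rcases hV with ⟨hV, hVK⟩ | ⟨r, hr, rfl⟩ <;> rcases hW with ⟨hW, hWK⟩ | ⟨s, hs, rfl⟩
  · exact (represents_of_mem hH ha hk hV hVK).comp_eq (represents_of_mem hH ha hk hW hWK)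
      (hH.comp_eq V hV W hW hWV)
  · exact (disjoint_left.1 hVK (subset_closure (hWV (ha.subset_ball hs.1 hk))) hk).elim
  · refine (represents_ball hH ha hk hσ hr).comp_eq (represents_of_mem hH ha hk hW hWK)
      (ha.ballKernel_comp_kernel hH hr.2 _ hW fun x hx => ?_)
    exact mem_annulus_of_mem_ball (hWV hx) (disjoint_left.1 hWK (subset_closure hx))
  · exact (represents_ball hH ha hk hσ hr).comp_eq (represents_ball hH ha hk hσ hs)
      (ha.ballKernel_comp_ballKernel hH hσ hs.1 (ha.le_of_ball_subset hH ⟨k, hk⟩ hr hWV) hr.2)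

lemma isNormalBauerFamily_darnedKernel (hH : IsNormalBauerFamily 𝒱 H)
    (ha : IsAnnular 𝒱 H K O g R) (hR : 0 < R) (hk : k ∈ K)
    (hσ : IsCompatibleFamily 𝒱 H K O g R σ) :
    IsNormalBauerFamily ((fun V => proj K '' V) '' darnedBase 𝒱 K O g R)
      (darnedKernel 𝒱 H O g R σ ha.isCompact hk) where
  isTopologicalBasis := ha.isTopologicalBasis_darnedBase hH hR
  isCompact_closure := by
    rintro _ ⟨V, hV, rfl⟩
    obtain ⟨T, hT⟩ := ha.exists_represents hH hk hσ hV
    exact hT.isCompact_closure_image ha.isCompact.isClosed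
  isBoundaryKernel := by
    rintro _ ⟨V, hV, rfl⟩
    obtain ⟨T, hT⟩ := ha.exists_represents hH hk hσ hV
    exact hT.isBoundaryKernel_image
  comp_eq := by
    rintro _ ⟨V, hV, rfl⟩ _ ⟨W, hW, rfl⟩ hWV
    obtain ⟨T, hT⟩ := ha.exists_represents hH hk hσ hV
    exact ha.darnedKernel_comp_eq hH hk hσ hV hW fun x hx =>
      hT.isSaturated.proj_mem_image.1 (hWV (mem_image_of_mem _ hx))
  continuous_integral := by
    rintro _ ⟨V, hV, rfl⟩ f hf
    obtain ⟨T, hT⟩ := ha.exists_represents hH hk hσ hV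
    exact hT.continuous_integral_image hf
  normal := by
    rintro _ ⟨V, hV, rfl⟩ y
    obtain ⟨T, hT⟩ := ha.exists_represents hH hk hσ hV
    exact hT.measure_univ_image y
  separates := by
    rintro _ ⟨V, ⟨hV, hVK⟩ | ⟨r, hr, rfl⟩, rfl⟩
    · exact separates_image_of_mem hH ha hk hV hVK
    · exact ⟨_, ha.isLocalChoice_ballChoice hH hk hr, ha.separates_image_ball hH hk hσ hr⟩
  continuousOn_integral := by
    rintro _ ⟨V, hV, rfl⟩ f hf hC
    obtain ⟨T, hT⟩ := ha.exists_represents hH hk hσ hV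
    exact hT.continuousOn_integral_image hf hC

end IsAnnular

variable [T2Space X] [LocallyCompactSpace X] [BorelSpace X]
  [SecondCountableTopology X]

lemma IsStronglyStable.exists_isDarning (hH : IsNormalBauerFamily 𝒱 H)
    (hK : IsStronglyStable 𝒱 H K) : ∃ 𝒱₀ H₀, IsDarning 𝒱 H K 𝒱₀ H₀ := by
  obtain ⟨O, g, R, hR, ha⟩ := hK.exists_isAnnular hH
  obtain ⟨k, hk⟩ := hK.2.1
  obtain ⟨σ, hσ⟩ := ha.exists_isCompatibleFamily hH hK.2.1 hR
  exact ⟨_, _, t2Space_collapse ha.isCompact, locallyCompactSpace_collapse ha.isCompact,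
    ha.secondCountableTopology_collapse hR, ha.isNormalBauerFamily_darnedKernel hH hR hk hσ,
    fun V hV hVK => mem_image_of_mem _ (Or.inl ⟨hV, hVK⟩),
    fun V hV hVK => darnedKernel_image hH ha hk hV hVK⟩

end DarnedFamily

end Darning

end

theorem proposition2p4 {X : Type*} [TopologicalSpace X] [T2Space X] [LocallyCompactSpace X]
    [SecondCountableTopology X] [MeasurableSpace X] [BorelSpace X]
    (𝒱 : Set (Set X)) (H : Set X → Kernel X X) (hH : Darning.IsNormalBauerFamily 𝒱 H)
    (K : Set X) (hK : Darning.IsStronglyStable 𝒱 H K) :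
    (∀ W₀ : Set X, Darning.IsAdmissible 𝒱 H K W₀ →
      ∀ η : ℕ → ℝ, (∀ n, η n ∈ Ioo (0 : ℝ) 1) → StrictAnti η → Tendsto η atTop (𝓝 0) →
      ∀ ν : ℕ → ProbabilityMeasure X,
        (∀ n, (ν n : Measure X) (Darning.S 𝒱 H W₀ K (η n))ᶜ = 0) →
      ∃ n : ℕ → ℕ, StrictMono n ∧
      ∃ (σk : ℝ → ℕ → ProbabilityMeasure X) (σ : ℝ → ProbabilityMeasure X),
        (∀ r ∈ Ioo (0 : ℝ) 1,
          (∀ k, η (n k) < r →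
            (σk r k : Measure X) = ENNReal.ofReal (r / η (n k)) •
              (Darning.swept 𝒱 H W₀ K (ν (n k)) r).restrict (Darning.S 𝒱 H W₀ K r)) ∧
          Tendsto (σk r) atTop (𝓝 (σ r)) ∧
          (σ r : Measure X) (Darning.S 𝒱 H W₀ K r)ᶜ = 0) ∧
        Darning.IsCompatible 𝒱 H W₀ K fun r => (σ r : Measure X)) ∧
    ∃ (𝒱₀ : Set (Set (Darning.Collapse K)))
      (H₀ : Set (Darning.Collapse K) → Kernel (Darning.Collapse K) (Darning.Collapse K)),
      Darning.IsDarning 𝒱 H K 𝒱₀ H₀ :=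
  ⟨fun _ hW _ hη hanti hη0 _ hν => hW.exists_subsequence hH hK.1 hη hanti hη0 hν,
   hK.exists_isDarning hH⟩
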